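/- Model. Programs run on a random access machine whose memory consists of natural-number variables and two-dimensional arrays of natural numbers; one step performs one assignment of a constant, addition, truncated subtraction, array read or write, fair coin flip, request of a fresh sample, or one unit of control flow (sequencing, test of a variable for zero in a conditional or a loop). For a graph $G$ on the vertex set $[n]$ let $\mathrm{Aut}(G)\le S_n$ be its automorphism group, and let $d_{\mathrm{TV}}$ be total variation distance. A *random-walk sampler* is a list $(s_1,\dots,s_m)$ of permutations of $[n]$ together with a number $T$ of steps: it starts at the identity and, $T$ times, picks a uniformly random index $i\in[m]$ and multiplies the current permutation by $s_i$; it outputs the permutation reached. (For $m=0$ the walk stays at the identity.) Its running time counts the choice of an index and the multiplication of two permutations as one unit each. Theorem. (1) (Inverse generation is easy.) There are one program $A$, a constant $C$, and functions $k(n,\delta)$, $T(n,\varepsilon)$ with values in $\mathbb N$ such that for every $n$, every graph $G$ on $[n]$ and all rational $\varepsilon,\delta\in(0,1]$ the following holds. $A$ is given $n,\varepsilon,\delta$ (each of $\varepsilon,\delta$ as numerator and denominator) and access to independent uniform random samples from $\mathrm{Aut}(G)$ in one-line notation, but not $G$ itself. Then, for all outcomes of the random choices, $A$ halts within $C\,(n+\log(1/\varepsilon)+\log(1/\delta)+1)^{C}$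 steps, having drawn exactly $k=k(n,\delta)\le C\,(n\log n+\log(1/\delta)+1)$ samples $g_1,\dots,g_k$, and it outputs the random-walk sampler with generators $g_1,\dots,g_k,g_1^{-1},\dots,g_k^{-1}$ and $T(n,\varepsilon)$ steps (that is, a random walk from the identity on the Cayley graph, with multiplicities, generated by the samples and their inverses), whose running time is at most $C\,(n\log n+\log(1/\varepsilon)+1)$. With probability at least $1-\delta$ the output distribution $D$ of this sampler satisfies $d_{\mathrm{TV}}(D,\mathcal U_{\mathrm{Aut}(G)})\le\varepsilon$. (2) (Forward generation is as hard as graph isomorphism.) There are constants $c\ge 1$ and $C$ such that for every $t:\mathbb N\to\mathbb N$: if there is a randomized program which, given the adjacency matrix of any graph $G$ on $[n]$ (for any $n$), halts within $t(n)$ steps and outputs a permutation whose distribution is within total variation distance $1/2$ of the uniform distribution on $\mathrm{Aut}(G)$ (an output that is not a permutation being allowed and counted as an extra outcome), then there is a randomized program which, given the adjacency matrices of any two graphs on $[n]$, halts within $C\,(t(n^{c})+1)^{C}$ steps and decides with probability at least $2/3$ whether the two graphs are isomorphic. -/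

import Mathlib

noncomputable section

namespace InvGen

open Equiv

/-! ### Randomized array programs with a step count -/

/-- Programs for a random access machine. The memory consists of natural-number variables
`var x` and two-dimensional arrays `arr a`, all addressed by natural numbers. The names of
variables and arrays are fixed in the program text; array indices are computed at run time.
The arithmetic is addition and truncated subtraction, one operation per step, so that a number
gains at most one bit per step. -/
inductive Prog : Type
  /-- do nothing -/
  | skip : Prog
  /-- `var x := c` -/
  | const (x c : ℕ) : Prog
  /-- `var x := var y + var z` -/
  | add (x y z : ℕ) : Prog
  /-- `var x := var y - var z`, truncated at `0` -/
  | sub (x y z : ℕ) : Prog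
  /-- `var x := arr a [var i] [var j]` -/
  | load (x a i j : ℕ) : Prog
  /-- `arr a [var i] [var j] := var x` -/
  | store (a i j x : ℕ) : Prog
  /-- `var x :=` a fair random bit -/
  | flip (x : ℕ) : Prog
  /-- request a fresh sample from the sample source and write it to row `var i` of `arr a` -/
  | draw (a i : ℕ) : Prog
  /-- `p` and then `q` -/
  | seq (p q : Prog) : Prog
  /-- `if var x ≠ 0 then p else q` -/
  | ite (x : ℕ) (p q : Prog) : Prog
  /-- `while var x ≠ 0 do p` -/
  | loop (x : ℕ) (p : Prog) : Prog

/-- The program contains no instruction that requests a sample. -/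
def Prog.DrawFree : Prog → Prop
  | .draw _ _ => False
  | .seq p q => p.DrawFree ∧ q.DrawFree
  | .ite _ p q => p.DrawFree ∧ q.DrawFree
  | .loop _ p => p.DrawFree
  | _ => True

/-- A source of independent samples: their law, and the row of numbers by which a sample is
presented to the program. -/
structure Source (Ω : Type) where
  law : PMF Ω
  row : Ω → ℕ → ℕ

/-- The memory. The field `samples` records the samples received so far, oldest first; no
instruction can read it. -/
structure State (Ω : Type) where
  var : ℕ → ℕ
  arr : ℕ → ℕ → ℕ → ℕ
  samples : List Ω

variable {Ω : Type}

def State.setVar (s : State Ω) (x v : ℕ) : State Ω :=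
  { s with var := Function.update s.var x v }

def State.setRow (s : State Ω) (a i : ℕ) (r : ℕ → ℕ) : State Ω :=
  { s with arr := Function.update s.arr a (Function.update (s.arr a) i r) }

def State.setArr (s : State Ω) (a i j v : ℕ) : State Ω :=
  s.setRow a i (Function.update (s.arr a i) j v)

/-- The initial memory: the given variables and arrays, no sample received yet. -/
def State.init (var : ℕ → ℕ) (arr : ℕ → ℕ → ℕ → ℕ) : State Ω := ⟨var, arr, []⟩

/-- A configuration: the stack of programs still to be executed, and the memory. -/
structure Config (Ω : Type) where
  todo : List Prog
  state : State Ω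

/-- The machine has halted. -/
def Config.Halted (c : Config Ω) : Prop := c.todo = []

/-- One step of the machine. A halted configuration stays as it is. -/
def step (src : Source Ω) : Config Ω → PMF (Config Ω)
  | ⟨[], s⟩ => PMF.pure ⟨[], s⟩
  | ⟨.skip :: k, s⟩ => PMF.pure ⟨k, s⟩
  | ⟨.const x c :: k, s⟩ => PMF.pure ⟨k, s.setVar x c⟩
  | ⟨.add x y z :: k, s⟩ => PMF.pure ⟨k, s.setVar x (s.var y + s.var z)⟩
  | ⟨.sub x y z :: k, s⟩ => PMF.pure ⟨k, s.setVar x (s.var y - s.var z)⟩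
  | ⟨.load x a i j :: k, s⟩ => PMF.pure ⟨k, s.setVar x (s.arr a (s.var i) (s.var j))⟩
  | ⟨.store a i j x :: k, s⟩ => PMF.pure ⟨k, s.setArr a (s.var i) (s.var j) (s.var x)⟩
  | ⟨.flip x :: k, s⟩ =>
      (PMF.uniformOfFintype Bool).map fun b => ⟨k, s.setVar x b.toNat⟩
  | ⟨.draw a i :: k, s⟩ =>
      src.law.map fun ω =>
        ⟨k, { s.setRow a (s.var i) (src.row ω) with samples := s.samples ++ [ω] }⟩
  | ⟨.seq p q :: k, s⟩ => PMF.pure ⟨p :: q :: k, s⟩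
  | ⟨.ite x p q :: k, s⟩ => PMF.pure ⟨(if s.var x ≠ 0 then p else q) :: k, s⟩
  | ⟨.loop x p :: k, s⟩ =>
      PMF.pure ⟨if s.var x ≠ 0 then p :: .loop x p :: k else k, s⟩

/-- The law of the configuration after `t` steps. -/
def runFrom (src : Source Ω) : ℕ → Config Ω → PMF (Config Ω)
  | 0, c => PMF.pure c
  | t + 1, c => (step src c).bind (runFrom src t)

/-- The law of the configuration reached by the program `p`, started in the memory `s`, after
`t` steps. -/
def run (src : Source Ω) (p : Prog) (s : State Ω) (t : ℕ) : PMF (Config Ω) :=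
  runFrom src t ⟨[p], s⟩

/-- The trivial source, for programs that request no samples. -/
def noSource : Source Unit := ⟨PMF.pure (), fun _ _ => 0⟩

/-- The probability of an event. -/
def prob {α : Type} (μ : PMF α) (E : Set α) : ℝ := (μ.toOuterMeasure E).toReal

/-- Total variation distance of two distributions on a finite set. -/
def tvDist {α : Type} [Fintype α] (μ ν : PMF α) : ℝ :=
  (1 / 2) * ∑ a, |(μ a).toReal - (ν a).toReal|

/-! ### Graphs, automorphisms and their encodings -/

/-- The automorphism group of a graph on `n` vertices, as a subgroup of the symmetric group. -/
def Aut {n : ℕ} (G : SimpleGraph (Fin n)) : Subgroup (Perm (Fin n)) where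
  carrier := {σ | ∀ x y, G.Adj x y ↔ G.Adj (σ x) (σ y)}
  one_mem' := fun _ _ => Iff.rfl
  mul_mem' := fun {σ τ} hσ hτ x y => (hτ x y).trans (hσ (τ x) (τ y))
  inv_mem' := fun {σ} hσ x y => by
    have h := hσ (σ⁻¹ x) (σ⁻¹ y)
    rw [← Perm.mul_apply, ← Perm.mul_apply, mul_inv_cancel] at h
    exact h.symm

/-- The uniform distribution over the automorphism group. -/
def uniformAut {n : ℕ} (G : SimpleGraph (Fin n)) : PMF (Perm (Fin n)) :=
  haveI : Fintype (Aut G) := Fintype.ofFinite _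
  (PMF.uniformOfFintype (Aut G)).map Subtype.val

/-- One-line notation of a permutation, followed by zeros. -/
def oneLine {n : ℕ} (σ : Perm (Fin n)) (v : ℕ) : ℕ :=
  if h : v < n then (σ ⟨v, h⟩ : ℕ) else 0

/-- The source of uniform random automorphisms of `G`, presented in one-line notation. -/
def autSource {n : ℕ} (G : SimpleGraph (Fin n)) : Source (Perm (Fin n)) :=
  ⟨uniformAut G, oneLine⟩

open Classical in
/-- The permutation whose one-line notation stands in the first `n` entries of the row, if
there is one. -/
def readPerm (n : ℕ) (r : ℕ → ℕ) : Option (Perm (Fin n)) :=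
  if h : ∃ σ : Perm (Fin n), ∀ v : Fin n, r v = (σ v : ℕ) then some h.choose else none

open Classical in
/-- The adjacency matrix of a graph, padded with zeros. -/
def adjArray {n : ℕ} (G : SimpleGraph (Fin n)) (u v : ℕ) : ℕ :=
  if ∃ (hu : u < n) (hv : v < n), G.Adj ⟨u, hu⟩ ⟨v, hv⟩ then 1 else 0

/-! ### Random walks on Cayley graphs as samplers -/

/-- A sampler that performs a random walk on a Cayley graph of permutations: a list of
generators (with multiplicity) and a number of steps. -/
structure CayleySampler (n : ℕ) where
  gens : List (Perm (Fin n))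
  steps : ℕ

/-- The walk of the given number of steps along the list `S`, started from the permutation `x`
with the clock at `t`: in every step a uniformly random position of the list is chosen and the
current permutation is multiplied by the generator there; choosing a position and
multiplying two permutations are charged one unit of time each. -/
def walk {n : ℕ} (S : List (Perm (Fin n))) : ℕ → Perm (Fin n) × ℕ → PMF (Perm (Fin n) × ℕ)
  | 0, z => PMF.pure z
  | m + 1, (x, t) =>
      if h : 0 < S.length then
        haveI : Nonempty (Fin S.length) := ⟨⟨0, h⟩⟩
        (PMF.uniformOfFintype (Fin S.length)).bind fun i => walk S m (x * S.get i, t + 2)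
      else walk S m (x, t + 2)

/-- The joint law of the output and the running time of the sampler, started at the identity. -/
def CayleySampler.exec {n : ℕ} (W : CayleySampler n) : PMF (Perm (Fin n) × ℕ) :=
  walk W.gens W.steps (1, 0)

/-- The output distribution of the sampler. -/
def CayleySampler.law {n : ℕ} (W : CayleySampler n) : PMF (Perm (Fin n)) :=
  W.exec.map Prod.fst

/-- The running time of the sampler is at most `b` for all outcomes of its random choices. -/
def CayleySampler.TimeAtMost {n : ℕ} (W : CayleySampler n) (b : ℝ) : Prop :=
  ∀ z ∈ W.exec.support, (z.2 : ℝ) ≤ b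

/-- The memory holds the description of the sampler `W`: the number of generators in `var 0`,
the number of steps in `var 1`, and the generators in one-line notation in the rows of
`arr 0`. -/
def Describes {n : ℕ} {Ω : Type} (s : State Ω) (W : CayleySampler n) : Prop :=
  s.var 0 = W.gens.length ∧ s.var 1 = W.steps ∧
    ∀ (i : Fin W.gens.length) (v : Fin n), s.arr 0 i v = (W.gens.get i v : ℕ)

/-- The input of the inverse generation problem: the number `n` and the rational numbers `ε`
and `δ`, each as numerator and denominator. -/
def inverseInput {Ω : Type} (n : ℕ) (ε δ : ℚ) : State Ω :=
  State.init
    (fun x => match x with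
      | 0 => n
      | 1 => ε.num.toNat
      | 2 => ε.den
      | 3 => δ.num.toNat
      | 4 => δ.den
      | _ => 0)
    (fun _ _ _ => 0)

/-! ### Forward generation and graph isomorphism -/

/-- The input of forward generation: the number of vertices in `var 0`, the graph in `arr 0`. -/
def graphInput {n : ℕ} (G : SimpleGraph (Fin n)) : State Unit :=
  State.init (fun x => if x = 0 then n else 0) (fun a => if a = 0 then adjArray G else 0)

/-- The randomized program `p`, given a graph with `n` vertices, halts within `t n` steps and
leaves in row `0` of `arr 1` a permutation whose distribution is within total variation
distance `η` of uniform over the automorphism group. (`none` stands for an output that is not a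
permutation.) -/
def GeneratesAut (p : Prog) (t : ℕ → ℕ) (η : ℝ) : Prop :=
  p.DrawFree ∧ ∀ (n : ℕ) (G : SimpleGraph (Fin n)),
    (∀ c ∈ (run noSource p (graphInput G) (t n)).support, c.Halted) ∧
    tvDist
      ((run noSource p (graphInput G) (t n)).map fun c => readPerm n (c.state.arr 1 0))
      ((uniformAut G).map some) ≤ η

/-- The input of graph isomorphism: the number of vertices in `var 0`, the graphs in `arr 0`
and `arr 1`. -/
def graphPairInput {n : ℕ} (G₁ G₂ : SimpleGraph (Fin n)) : State Unit :=
  State.init (fun x => if x = 0 then n else 0)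
    (fun a => if a = 0 then adjArray G₁ else if a = 1 then adjArray G₂ else 0)

/-- The randomized program `p`, given two graphs with `n` vertices, halts within `t n` steps
and decides with probability at least `2/3` whether they are isomorphic. The answer is `1` (yes)
or `0` (no) in `var 0`. -/
def DecidesGraphIso (p : Prog) (t : ℕ → ℕ) : Prop :=
  p.DrawFree ∧ ∀ (n : ℕ) (G₁ G₂ : SimpleGraph (Fin n)),
    (∀ c ∈ (run noSource p (graphPairInput G₁ G₂) (t n)).support, c.Halted) ∧
    (Nonempty (G₁ ≃g G₂) →
      2 / 3 ≤ prob (run noSource p (graphPairInput G₁ G₂) (t n)) {c | c.state.var 0 = 1}) ∧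
    (IsEmpty (G₁ ≃g G₂) →
      2 / 3 ≤ prob (run noSource p (graphPairInput G₁ G₂) (t n)) {c | c.state.var 0 = 0})

end InvGen

end

/-!
First part. Let `g₁, …, g_k` be uniform samples from a group `H`, with `k` of order
`log₂ (|H| / δ)`. A word of even length in the samples and their inverses either has a letter that
occurs exactly once, up to inversion, and then its value is uniform in `H`, or is one of the rare
words in which every letter repeats. So the expected trace of an even power of the transition
matrix minus the averaging projection is at most `|H|` times the proportion of repetitive words,
which is small; Markov's inequality gives a spectral gap of `1 / 2` with probability `1 - δ`, and
then `log₂ (|H| / ε)` steps of the walk suffice.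

Second part. Put thirteen disjoint cones side by side, the first over `G₁` and twelve over `G₂`,
and pad with isolated vertices. If `G₁ ≃g G₂` the cones are interchangeable, and a uniform
automorphism moves the first cone with probability at least `12 / 13`; if not, the first cone never
moves. The error `1 / 2` of the generator leaves `11 / 26`, and since a claimed image of the first
cone can be verified, two independent runs succeed with probability at least `2 / 3` and never err
on non-isomorphic graphs. Renaming variables and arrays lets both runs, and the checking code,
share one memory; the input has `n ^ 6` vertices, and any generator needs almost that many steps to
write down a permutation, which pays for building the gadget.
-/

noncomputable section

namespace InvGen

open Equiv

/-! ### Program logic -/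

section ProgramLogic

variable {Ω : Type} {src : Source Ω}

theorem bind_congr_support {α β : Type} {μ : PMF α} {f g : α → PMF β}
    (h : ∀ a ∈ μ.support, f a = g a) : μ.bind f = μ.bind g := by
  ext b
  simp only [PMF.bind_apply]
  refine tsum_congr fun a => ?_
  by_cases ha : a ∈ μ.support
  · rw [h a ha]
  · rw [PMF.mem_support_iff, not_not] at ha
    simp [ha]

theorem runFrom_nil (t : ℕ) (s : State Ω) : runFrom src t ⟨[], s⟩ = PMF.pure ⟨[], s⟩ := by
  induction t with
  | zero => rfl
  | succ t ih => simp [runFrom, step, ih]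

/-- Executing the stack `l` from the memory `s` takes at most `t` steps and leaves a memory with
law `μ`, whatever stack `K` remains to be executed afterwards. The running time may depend on the
random choices, so it is part of the law `ν`: a state `z.1` that has time `z.2` left passes
that time on to `K`. -/
def Exec (src : Source Ω) (l : List Prog) (s : State Ω) (t : ℕ) (μ : PMF (State Ω)) : Prop :=
  ∃ ν : PMF (State Ω × ℕ), ν.map Prod.fst = μ ∧ ∀ (K : List Prog) (u : ℕ),
    runFrom src (t + u) ⟨l ++ K, s⟩ = ν.bind fun z => runFrom src (z.2 + u) ⟨K, z.1⟩

namespace Exec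

variable {p q : Prog} {l l' : List Prog} {s s' : State Ω} {t t' : ℕ} {μ : PMF (State Ω)}
  {κ : State Ω → PMF (State Ω)}

theorem mono (h : Exec src l s t μ) (ht : t ≤ t') : Exec src l s t' μ := by
  obtain ⟨ν, rfl, h⟩ := h
  refine ⟨ν.map fun z => (z.1, z.2 + (t' - t)), by rw [PMF.map_comp]; rfl, fun K u => ?_⟩
  rw [show t' + u = t + (t' - t + u) by omega, h, PMF.bind_map]
  simp only [Function.comp_def, add_assoc]

theorem runFrom_eq (h : Exec src l s t μ) :
    runFrom src t ⟨l, s⟩ = μ.map fun s' => ⟨[], s'⟩ := by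
  obtain ⟨ν, rfl, h⟩ := h
  have hrun := h [] 0
  simp only [List.append_nil, add_zero, runFrom_nil] at hrun
  rw [hrun, PMF.map_comp, ← PMF.bind_pure_comp]
  rfl

theorem run_eq (h : Exec src [p] s t μ) : run src p s t = μ.map fun s' => ⟨[], s'⟩ :=
  h.runFrom_eq

theorem nil (s : State Ω) : Exec src [] s 0 (PMF.pure s) :=
  ⟨PMF.pure (s, 0), by rw [PMF.pure_map], fun K u => by simp⟩

theorem append (h : Exec src l s t μ) (h' : ∀ s' ∈ μ.support, Exec src l' s' t' (κ s')) :
    Exec src (l ++ l') s (t + t') (μ.bind κ) := by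
  obtain ⟨ν, rfl, h⟩ := h
  have : Nonempty (PMF (State Ω × ℕ)) := ⟨ν⟩
  choose! ξ hξ hrun using h'
  have hmem : ∀ z ∈ ν.support, z.1 ∈ (ν.map Prod.fst).support := fun z hz => by
    rw [PMF.support_map]; exact ⟨z, hz, rfl⟩
  refine ⟨ν.bind fun z => (ξ z.1).map fun y => (y.1, y.2 + z.2), ?_, fun K u => ?_⟩
  · rw [PMF.map_bind, PMF.bind_map]
    refine bind_congr_support fun z hz => ?_
    rw [PMF.map_comp, Function.comp_apply, ← hξ z.1 (hmem z hz)]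
    rfl
  · rw [List.append_assoc, add_assoc, h, PMF.bind_bind]
    refine bind_congr_support fun z hz => ?_
    rw [add_left_comm, hrun z.1 (hmem z hz), PMF.bind_map]
    simp only [Function.comp_def, add_assoc]

theorem pure_append (h : Exec src l s t (PMF.pure s')) (h' : Exec src l' s' t' μ) :
    Exec src (l ++ l') s (t + t') μ := by
  have happ : Exec src (l ++ l') s (t + t') ((PMF.pure s').bind fun _ => μ) :=
    h.append fun s₁ hs₁ => by
      rw [PMF.mem_support_pure_iff] at hs₁
      exact hs₁ ▸ h'
  rwa [PMF.pure_bind] at happ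

theorem of_step (hs : ∀ K, step src ⟨p :: K, s⟩ = PMF.pure ⟨l ++ K, s'⟩)
    (h : Exec src (l ++ l') s' t μ) : Exec src (p :: l') s (t + 1) μ := by
  obtain ⟨ν, hν, h⟩ := h
  refine ⟨ν, hν, fun K u => ?_⟩
  rw [add_right_comm, List.cons_append, runFrom, hs, PMF.pure_bind, ← List.append_assoc, h]

theorem basic (hs : ∀ K, step src ⟨p :: K, s⟩ = PMF.pure ⟨K, s'⟩) :
    Exec src [p] s 1 (PMF.pure s') :=
  of_step (l := []) hs (nil s')

theorem seq (h : Exec src (p :: q :: l) s t μ) : Exec src (.seq p q :: l) s (t + 1) μ :=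
  of_step (l := [p, q]) (fun _ => rfl) h

theorem ite {x : ℕ} (h : Exec src ((if s.var x ≠ 0 then p else q) :: l) s t μ) :
    Exec src (.ite x p q :: l) s (t + 1) μ :=
  of_step (l := [if s.var x ≠ 0 then p else q]) (fun _ => rfl) h

theorem loop_zero {x : ℕ} (hx : s.var x = 0) : Exec src [.loop x p] s 1 (PMF.pure s) :=
  basic fun K => by simp [step, hx]

theorem loop_succ {x : ℕ} (hx : s.var x ≠ 0) (h : Exec src (p :: .loop x p :: l) s t μ) :
    Exec src (.loop x p :: l) s (t + 1) μ :=
  of_step (l := [p, .loop x p]) (fun K => by simp [step, hx]) h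

end Exec

/-- The memory after the sample `ω` has been received. -/
def State.recv (src : Source Ω) (s : State Ω) (a i : ℕ) (ω : Ω) : State Ω :=
  { s.setRow a (s.var i) (src.row ω) with samples := s.samples ++ [ω] }

theorem Exec.draw {a i : ℕ} {l : List Prog} {s : State Ω} {t : ℕ} {κ : Ω → PMF (State Ω)}
    (h : ∀ ω, Exec src l (s.recv src a i ω) t (κ ω)) :
    Exec src (.draw a i :: l) s (t + 1) (src.law.bind κ) := by
  choose ξ hξ h using h
  refine ⟨src.law.bind ξ, by rw [PMF.map_bind]; simp only [hξ], fun K u => ?_⟩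
  rw [add_right_comm, PMF.bind_bind, List.cons_append, runFrom, step, PMF.bind_map]
  exact congrArg _ (funext fun ω => h ω K u)

theorem step_append (p : Prog) (l K : List Prog) (s : State Ω) :
    step src ⟨p :: l ++ K, s⟩ =
      (step src ⟨p :: l, s⟩).map fun c => ⟨c.todo ++ K, c.state⟩ := by
  cases p
  case loop x p => by_cases hx : s.var x = 0 <;> simp [step, hx, PMF.pure_map]
  all_goals simp [step, PMF.pure_map, PMF.map_comp, Function.comp_def]

theorem exists_exec_of_halted (t : ℕ) (l : List Prog) (s : State Ω)
    (h : ∀ c ∈ (runFrom src t ⟨l, s⟩).support, c.Halted) : ∃ μ, Exec src l s t μ := by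
  induction t generalizing l s with
  | zero =>
    obtain rfl : l = [] := h ⟨l, s⟩ (by simp [runFrom])
    exact ⟨_, .nil s⟩
  | succ t ih =>
    cases l with
    | nil => exact ⟨_, (Exec.nil s).mono (Nat.zero_le _)⟩
    | cons p l =>
      have : Nonempty (PMF (State Ω)) := ⟨PMF.pure s⟩
      have : Nonempty (PMF (State Ω × ℕ)) := ⟨PMF.pure (s, 0)⟩
      have hrest : ∀ c ∈ (step src ⟨p :: l, s⟩).support, ∃ μ, Exec src c.todo c.state t μ :=
        fun c hc => ih _ _ fun c' hc' => h c' ((PMF.mem_support_bind_iff _ _ _).2 ⟨c, hc, hc'⟩)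
      choose! μ ξ _ hξ using hrest
      refine ⟨_, (step src ⟨p :: l, s⟩).bind ξ, rfl, fun K u => ?_⟩
      rw [add_right_comm, runFrom, step_append, PMF.bind_map, PMF.bind_bind]
      exact bind_congr_support fun c hc => hξ c hc K u

/-- From the memory `s` the program `p` runs deterministically, for at most `t` steps, into a
memory that satisfies `Q`: a total-correctness triple with a time bound. -/
def Reaches (src : Source Ω) (s : State Ω) (p : Prog) (t : ℕ) (Q : State Ω → Prop) : Prop :=
  ∃ s', Exec src [p] s t (PMF.pure s') ∧ Q s'

namespace Reaches

variable {p q : Prog} {s : State Ω} {t t' x : ℕ} {Q Q' R : State Ω → Prop}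

theorem mono (h : Reaches src s p t Q) (ht : t ≤ t') (hQ : ∀ s', Q s' → Q' s') :
    Reaches src s p t' Q' := by
  obtain ⟨s', h, hs⟩ := h
  exact ⟨s', h.mono ht, hQ _ hs⟩

theorem seq (h : Reaches src s p t Q) (h' : ∀ s', Q s' → Reaches src s' q t' R) :
    Reaches src s (.seq p q) (t + t' + 1) R := by
  obtain ⟨s₁, h, hs₁⟩ := h
  obtain ⟨s₂, h', hs₂⟩ := h' s₁ hs₁
  exact ⟨s₂, (h.pure_append h').seq, hs₂⟩

theorem ite (h₁ : s.var x ≠ 0 → Reaches src s p t Q) (h₂ : s.var x = 0 → Reaches src s q t Q) :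
    Reaches src s (.ite x p q) (t + 1) Q := by
  by_cases hx : s.var x = 0
  · obtain ⟨s', h, hq⟩ := h₂ hx
    exact ⟨s', Exec.ite (by simpa [hx] using h), hq⟩
  · obtain ⟨s', h, hq⟩ := h₁ hx
    exact ⟨s', Exec.ite (by simpa [hx] using h), hq⟩

end Reaches

/-! ### The rule of constancy -/

/-- The variables that occur as targets of instructions. -/
def Prog.varsWritten : Prog → List ℕ
  | .const x _ | .add x _ _ | .sub x _ _ | .load x _ _ _ | .flip x => [x]
  | .seq p q | .ite _ p q => p.varsWritten ++ q.varsWritten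
  | .loop _ p => p.varsWritten
  | .skip | .store _ _ _ _ | .draw _ _ => []

/-- The arrays that occur as targets of instructions. -/
def Prog.arrsWritten : Prog → List ℕ
  | .store a _ _ _ | .draw a _ => [a]
  | .seq p q | .ite _ p q => p.arrsWritten ++ q.arrsWritten
  | .loop _ p => p.arrsWritten
  | .skip | .const _ _ | .add _ _ _ | .sub _ _ _ | .load _ _ _ _ | .flip _ => []

/-- The memory `s'` agrees with `s` wherever the program `p` cannot write. -/
structure Frame (p : Prog) (s s' : State Ω) : Prop where
  var : ∀ x ∉ p.varsWritten, s'.var x = s.var x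
  arr : ∀ a ∉ p.arrsWritten, s'.arr a = s.arr a
  samples : p.DrawFree → s'.samples = s.samples

theorem Frame.trans {p : Prog} {s s' s'' : State Ω} (h : Frame p s s') (h' : Frame p s' s'') :
    Frame p s s'' :=
  ⟨fun x hx => (h'.var x hx).trans (h.var x hx), fun a ha => (h'.arr a ha).trans (h.arr a ha),
    fun hd => (h'.samples hd).trans (h.samples hd)⟩

theorem runFrom_eq_of_step_eq {β : Type} {N : Prog → Prop} {f : State Ω → β}
    (hstep : ∀ c : Config Ω, (∀ q ∈ c.todo, N q) → ∀ c' ∈ (step src c).support,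
      (∀ q ∈ c'.todo, N q) ∧ f c'.state = f c.state)
    (t : ℕ) (c : Config Ω) (hc : ∀ q ∈ c.todo, N q) :
    ∀ c' ∈ (runFrom src t c).support, f c'.state = f c.state := by
  induction t generalizing c with
  | zero => simp [runFrom]
  | succ t ih =>
    intro c' hc'
    rw [runFrom, PMF.mem_support_bind_iff] at hc'
    obtain ⟨d, hd, hc'⟩ := hc'
    obtain ⟨hN, hf⟩ := hstep c hc d hd
    exact (ih d hN c' hc').trans hf

theorem step_var_eq (x : ℕ) (c : Config Ω) (hc : ∀ q ∈ c.todo, x ∉ q.varsWritten) :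
    ∀ c' ∈ (step src c).support,
      (∀ q ∈ c'.todo, x ∉ q.varsWritten) ∧ c'.state.var x = c.state.var x := by
  obtain ⟨_ | ⟨p, l⟩, s⟩ := c
  · simp [step]
  cases p
  case flip y =>
    simp_all only [step, Prog.varsWritten, List.forall_mem_cons, PMF.support_map]
    rintro _ ⟨b, -, rfl⟩
    simp_all [State.setVar]
  all_goals simp_all [step, Prog.varsWritten, State.setVar, State.setArr, State.setRow]
  all_goals split_ifs <;> simp_all [Prog.varsWritten]

theorem step_arr_eq (a : ℕ) (c : Config Ω) (hc : ∀ q ∈ c.todo, a ∉ q.arrsWritten) :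
    ∀ c' ∈ (step src c).support,
      (∀ q ∈ c'.todo, a ∉ q.arrsWritten) ∧ c'.state.arr a = c.state.arr a := by
  obtain ⟨_ | ⟨p, l⟩, s⟩ := c
  · simp [step]
  cases p
  case flip y =>
    simp_all only [step, Prog.arrsWritten, List.forall_mem_cons, PMF.support_map]
    rintro _ ⟨b, -, rfl⟩
    simp_all [State.setVar]
  all_goals simp_all [step, Prog.arrsWritten, State.setVar, State.setArr, State.setRow]
  all_goals split_ifs <;> simp_all [Prog.arrsWritten]

theorem step_samples_eq (c : Config Ω) (hc : ∀ q ∈ c.todo, q.DrawFree) :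
    ∀ c' ∈ (step src c).support,
      (∀ q ∈ c'.todo, q.DrawFree) ∧ c'.state.samples = c.state.samples := by
  obtain ⟨_ | ⟨p, l⟩, s⟩ := c
  · simp [step]
  cases p
  case flip y =>
    simp_all only [step, Prog.DrawFree, List.forall_mem_cons, PMF.support_map]
    rintro _ ⟨b, -, rfl⟩
    simp_all [State.setVar]
  all_goals simp_all [step, Prog.DrawFree, State.setVar, State.setArr, State.setRow]
  all_goals split_ifs <;> simp_all [Prog.DrawFree]

theorem Exec.frame {p : Prog} {s : State Ω} {t : ℕ} {μ : PMF (State Ω)}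
    (h : Exec src [p] s t μ) {s' : State Ω} (hs' : s' ∈ μ.support) : Frame p s s' := by
  have hrun : (⟨[], s'⟩ : Config Ω) ∈ (runFrom src t ⟨[p], s⟩).support := by
    rw [h.runFrom_eq, PMF.support_map]
    exact ⟨s', hs', rfl⟩
  exact ⟨fun x hx => runFrom_eq_of_step_eq (f := fun s => s.var x) (step_var_eq x) t _
      (by simpa using hx) _ hrun,
    fun a ha => runFrom_eq_of_step_eq (f := fun s => s.arr a) (step_arr_eq a) t _
      (by simpa using ha) _ hrun,
    fun hd => runFrom_eq_of_step_eq (f := State.samples) step_samples_eq t _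
      (by simpa using hd) _ hrun⟩

theorem Reaches.frame {p : Prog} {s : State Ω} {t : ℕ} {Q : State Ω → Prop}
    (h : Reaches src s p t Q) : Reaches src s p t fun s' => Q s' ∧ Frame p s s' := by
  obtain ⟨s', h, hs⟩ := h
  exact ⟨s', h, hs, h.frame (by simp)⟩

theorem Frame.refl (p : Prog) (s : State Ω) : Frame p s s :=
  ⟨fun _ _ => rfl, fun _ _ => rfl, fun _ => rfl⟩

theorem Reaches.loop {x t : ℕ} {p : Prog} {s₀ : State Ω} (I : ℕ → State Ω → Prop) (N : ℕ)
    (hN : I N s₀) (h0 : ∀ s, I 0 s → s.var x = 0)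
    (body : ∀ m s, m < N → Frame (.loop x p) s₀ s → I (m + 1) s →
      s.var x ≠ 0 ∧ Reaches src s p t (I m)) :
    Reaches src s₀ (.loop x p) (N * (t + 1) + 1) (I 0) := by
  suffices ∀ m ≤ N, ∀ s, Frame (.loop x p) s₀ s → I m s →
      Reaches src s (.loop x p) (m * (t + 1) + 1) (I 0) from
    this N le_rfl s₀ (.refl _ _) hN
  intro m hm
  induction m with
  | zero => exact fun s _ hs => ⟨s, (Exec.loop_zero (h0 s hs)).mono (by omega), hs⟩
  | succ m ih =>
    intro s hframe hs
    obtain ⟨hx, h⟩ := body m s (by omega) hframe hs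
    obtain ⟨s₁, h, hs₁, hframe₁⟩ := h.frame
    have hloop : Frame (.loop x p) s s₁ := ⟨hframe₁.var, hframe₁.arr, hframe₁.samples⟩
    obtain ⟨s₂, h', hs₂⟩ := ih (by omega) s₁ (hframe.trans hloop) hs₁
    exact ⟨s₂, (Exec.loop_succ hx (h.pure_append h')).mono (by ring_nf; omega), hs₂⟩

/-! ### Straight-line code and counting loops -/

/-- Straight-line instructions. -/
def Prog.IsBasic : Prog → Bool
  | .skip | .const _ _ | .add _ _ _ | .sub _ _ _ | .load _ _ _ _ | .store _ _ _ _ => true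
  | _ => false

/-- The effect of a straight-line instruction. -/
def State.effect (s : State Ω) : Prog → State Ω
  | .const x c => s.setVar x c
  | .add x y z => s.setVar x (s.var y + s.var z)
  | .sub x y z => s.setVar x (s.var y - s.var z)
  | .load x a i j => s.setVar x (s.arr a (s.var i) (s.var j))
  | .store a i j x => s.setArr a (s.var i) (s.var j) (s.var x)
  | _ => s

/-- A block of straight-line code. -/
def block : List Prog → Prog
  | [] => .skip
  | p :: l => .seq p (block l)

theorem reaches_basic {p : Prog} (hp : p.IsBasic) {s : State Ω} {Q : State Ω → Prop}
    (h : Q (s.effect p)) : Reaches src s p 1 Q := by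
  refine ⟨_, .basic fun K => ?_, h⟩
  cases p <;> first | rfl | cases hp

theorem reaches_block {l : List Prog} {s : State Ω} {Q : State Ω → Prop}
    (h : Q (l.foldl State.effect s)) (hl : ∀ p ∈ l, p.IsBasic := by decide) :
    Reaches src s (block l) (2 * l.length + 1) Q := by
  induction l generalizing s with
  | nil => exact ⟨s, .basic fun _ => rfl, h⟩
  | cons p l ih =>
    have hp : Reaches src s p 1 (· = s.effect p) := reaches_basic (hl p (by simp)) rfl
    have hl' : ∀ q ∈ l, q.IsBasic := fun q hq => hl q (by simp [hq])
    refine (hp.seq (t' := 2 * l.length + 1) fun s' hs' => ih (hs' ▸ h) hl').mono ?_ fun _ h => h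
    simp only [List.length_cons]
    omega

@[simp] theorem State.setVar_var (s : State Ω) (x v y : ℕ) :
    (s.setVar x v).var y = if y = x then v else s.var y := by
  simp [State.setVar, Function.update_apply]

@[simp] theorem State.setVar_arr (s : State Ω) (x v : ℕ) : (s.setVar x v).arr = s.arr := rfl

@[simp] theorem State.setVar_samples (s : State Ω) (x v : ℕ) :
    (s.setVar x v).samples = s.samples := rfl

@[simp] theorem State.setArr_var (s : State Ω) (a i j v : ℕ) :
    (s.setArr a i j v).var = s.var := rfl

@[simp] theorem State.setArr_arr (s : State Ω) (a i j v a' i' j' : ℕ) :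
    (s.setArr a i j v).arr a' i' j' =
      if a' = a ∧ i' = i ∧ j' = j then v else s.arr a' i' j' := by
  by_cases ha : a' = a <;> by_cases hi : i' = i <;>
    simp [State.setArr, State.setRow, Function.update_apply, ha, hi]

@[simp] theorem State.recv_var (s : State Ω) (a i : ℕ) (ω : Ω) :
    (s.recv src a i ω).var = s.var := rfl

@[simp] theorem State.recv_arr (s : State Ω) (a i : ℕ) (ω : Ω) (a' i' j' : ℕ) :
    (s.recv src a i ω).arr a' i' j' =
      if a' = a ∧ i' = s.var i then src.row ω j' else s.arr a' i' j' := by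
  by_cases ha : a' = a <;> by_cases hi : i' = s.var i <;>
    simp [State.recv, State.setRow, ha, hi]

/-- `for x downto 0 do p`: the variable `one` has to hold `1`, and the body `p` sees the values
`var x - 1, …, 0` in `x`. -/
def countdown (x one : ℕ) (p : Prog) : Prog :=
  .loop x (.seq (.sub x x one) p)

theorem reaches_countdown {x one t : ℕ} {p : Prog} {s₀ : State Ω} (I : ℕ → State Ω → Prop)
    (hx : x ∉ p.varsWritten) (hone : one ∉ (countdown x one p).varsWritten)
    (h1 : s₀.var one = 1) (h0 : I (s₀.var x) s₀)
    (body : ∀ m s, m < s₀.var x → Frame (countdown x one p) s₀ s → I (m + 1) s →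
      Reaches src (s.setVar x m) p t (I m)) :
    Reaches src s₀ (countdown x one p) (s₀.var x * (t + 3) + 1) (I 0) := by
  refine (Reaches.loop (t := t + 2) (fun m s => s.var x = m ∧ I m s) (s₀.var x) ⟨rfl, h0⟩
    (fun s hs => hs.1) ?_).mono le_rfl fun s hs => hs.2
  rintro m s hm hframe ⟨hxm, hI⟩
  refine ⟨by omega, ?_⟩
  have hsub : s.effect (.sub x x one) = s.setVar x m := by
    rw [State.effect, hframe.var one hone, h1, hxm, Nat.add_sub_cancel]
  have hdec : Reaches src s (.sub x x one) 1 (· = s.setVar x m) := reaches_basic rfl hsub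
  refine (hdec.seq (t' := t) fun s₁ hs₁ => by
    rw [hs₁]; exact (body m s hm hframe hI).frame).mono (by omega) ?_
  exact fun s₂ ⟨hI₂, hframe₂⟩ => ⟨by simp [hframe₂.var x hx], hI₂⟩

end ProgramLogic

/-! ### Words in random group elements -/

section Words

variable {H ι : Type*} [Group H] {q : ℕ}

/-- A generator or its inverse: the letters of words over the family `g`. -/
def letter (g : ι → H) (a : ι × Bool) : H := if a.2 then g a.1 else (g a.1)⁻¹

/-- The value in the group of a word over the family `g`. -/
def wordVal (g : ι → H) (w : Fin q → ι × Bool) : H :=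
  (List.ofFn fun p => letter g (w p)).prod

theorem wordVal_cons (g : ι → H) (a : ι × Bool) (w : Fin q → ι × Bool) :
    wordVal g (Fin.cons a w : Fin (q + 1) → ι × Bool) = letter g a * wordVal g w := by
  simp [wordVal, List.ofFn_succ]

theorem eq_of_wordVal_eq {g g' : ι → H} {w : Fin q → ι × Bool} {p : Fin q}
    (hp : ∀ p' ≠ p, (w p').1 ≠ (w p).1) (hg : ∀ i ≠ (w p).1, g i = g' i)
    (hw : wordVal g w = wordVal g' w) : g (w p).1 = g' (w p).1 := by
  induction q with
  | zero => exact p.elim0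
  | succ q ih =>
    rw [← Fin.cons_self_tail w, wordVal_cons, wordVal_cons] at hw
    rcases Fin.eq_zero_or_eq_succ p with rfl | ⟨p, rfl⟩
    · have htail : wordVal g (Fin.tail w) = wordVal g' (Fin.tail w) := by
        simp only [wordVal, letter, Fin.tail]
        congr! 3 with p'
        all_goals rw [hg _ (hp p'.succ (Fin.succ_ne_zero _))]
      rw [htail, mul_left_inj] at hw
      unfold letter at hw
      split_ifs at hw
      exacts [hw, inv_injective hw]
    · have hhead : letter g (w 0) = letter g' (w 0) := by
        simp only [letter, hg _ (hp 0 (Fin.succ_ne_zero _).symm)]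
      rw [hhead, mul_right_inj] at hw
      exact ih (w := Fin.tail w) (p := p)
        (fun p' hne => hp p'.succ fun h => hne (Fin.succ_injective _ h)) hg hw

/-- Every index that occurs in the word occurs there at least twice. -/
def Repetitive (w : Fin q → ι × Bool) : Prop :=
  ∀ p, ∃ p' ≠ p, (w p').1 = (w p).1

variable [Fintype H] [DecidableEq H] [Fintype ι] [DecidableEq ι]

theorem card_wordVal_eq_one_mul_card_le {w : Fin q → ι × Bool} (hw : ¬ Repetitive w) :
    (Finset.univ.filter fun g : ι → H => wordVal g w = 1).card * Fintype.card H ≤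
      Fintype.card H ^ Fintype.card ι := by
  unfold Repetitive at hw
  push Not at hw
  obtain ⟨p, hp⟩ := hw
  rw [← Finset.card_univ, ← Finset.card_product, Finset.card_univ, ← Fintype.card_fun,
    ← Finset.card_univ]
  refine Finset.card_le_card_of_injOn (fun z => Function.update z.1 (w p).1 z.2)
    (fun _ _ => Finset.mem_univ _) ?_
  rintro ⟨g, x⟩ hg ⟨g', x'⟩ hg' h
  simp only [Finset.coe_product, Set.mem_prod, Finset.mem_coe, Finset.mem_filter,
    Finset.mem_univ, true_and, and_true] at hg hg'
  have hx : x = x' := by simpa using congrFun h (w p).1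
  have hne : ∀ i ≠ (w p).1, g i = g' i := fun i hi => by simpa [hi] using congrFun h i
  refine Prod.ext (funext fun i => ?_) hx
  by_cases hi : i = (w p).1
  · exact hi ▸ eq_of_wordVal_eq hp hne (hg.trans hg'.symm)
  · exact hne i hi

open Classical in
theorem card_wordVal_eq_one_mul_card_le_ite (w : Fin q → ι × Bool) :
    (Finset.univ.filter fun g : ι → H => wordVal g w = 1).card * Fintype.card H ≤
      Fintype.card H ^ Fintype.card ι * if Repetitive w then Fintype.card H else 1 := by
  split_ifs with hw
  · refine Nat.mul_le_mul_right _ ((Finset.card_le_univ _).trans_eq ?_)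
    rw [Fintype.card_fun]
  · simpa using card_wordVal_eq_one_mul_card_le hw

end Words

/-! ### Repetitive words are rare -/

section Repetitive

variable {ι : Type*} [Fintype ι] {m : ℕ}

open Classical in
theorem card_repetitive_le (hm : m ≤ Fintype.card ι) :
    (Finset.univ.filter fun w : Fin (2 * m) → ι × Bool => Repetitive w).card ≤
      (Fintype.card ι).choose m * m ^ (2 * m) * 2 ^ (2 * m) := by
  have hsub : (Finset.univ.filter fun w : Fin (2 * m) → ι × Bool => Repetitive w) ⊆
      (Finset.powersetCard m (Finset.univ : Finset ι)).biUnion fun S =>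
        Fintype.piFinset fun _ => S ×ˢ (Finset.univ : Finset Bool) := by
    intro w hw
    rw [Finset.mem_filter] at hw
    have hcard : 2 * (Finset.univ.image fun p => (w p).1).card ≤ 2 * m := by
      refine (Finset.mul_card_image_le_card _ _ ?_).trans_eq (by simp)
      intro b hb
      obtain ⟨p, -, rfl⟩ := Finset.mem_image.1 hb
      obtain ⟨p', hne, hp'⟩ := hw.2 p
      exact Finset.one_lt_card.2 ⟨p', by simp [hp'], p, by simp, hne⟩
    obtain ⟨S, hS, hSm⟩ := Finset.exists_superset_card_eq
      (s := Finset.univ.image fun p => (w p).1) (n := m) (by omega) hm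
    rw [Finset.mem_biUnion]
    refine ⟨S, by simp [Finset.mem_powersetCard, hSm], ?_⟩
    rw [Fintype.mem_piFinset]
    exact fun p => by simpa using hS (Finset.mem_image_of_mem _ (Finset.mem_univ p))
  refine (Finset.card_le_card hsub).trans (Finset.card_biUnion_le.trans ?_)
  rw [Finset.sum_congr rfl (g := fun _ => m ^ (2 * m) * 2 ^ (2 * m))]
  · simp [mul_assoc]
  · intro S hS
    rw [Fintype.card_piFinset]
    simp [(Finset.mem_powersetCard.1 hS).2, mul_pow]

theorem pow_self_le_three_pow_mul_factorial (m : ℕ) :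
    (m : ℝ) ^ m ≤ 3 ^ m * (m.factorial : ℝ) := by
  have hpos : (0 : ℝ) < m.factorial := by exact_mod_cast m.factorial_pos
  calc (m : ℝ) ^ m ≤ Real.exp m * m.factorial :=
        (div_le_iff₀ hpos).1 (Real.pow_div_factorial_le_exp m m.cast_nonneg m)
    _ = Real.exp 1 ^ m * m.factorial := by rw [← Real.exp_nat_mul, mul_one]
    _ ≤ 3 ^ m * m.factorial := by gcongr; exact Real.exp_one_lt_three.le

open Classical in
theorem card_repetitive_le_div (hm : 24 * m ≤ Fintype.card ι) :
    ((Finset.univ.filter fun w : Fin (2 * m) → ι × Bool => Repetitive w).card : ℝ) ≤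
      (2 * Fintype.card ι) ^ (2 * m) / 8 ^ m := by
  have hcard : ((Finset.univ.filter fun w : Fin (2 * m) → ι × Bool => Repetitive w).card : ℝ) ≤
      ((Fintype.card ι).choose m : ℝ) * m ^ (2 * m) * 2 ^ (2 * m) := by
    exact_mod_cast card_repetitive_le (by omega)
  set k := Fintype.card ι
  have hchoose : (k.choose m : ℝ) * m ^ m ≤ (k : ℝ) ^ m * 3 ^ m :=
    calc (k.choose m : ℝ) * m ^ m ≤ (k : ℝ) ^ m / (m.factorial : ℝ) * (3 ^ m * m.factorial) := by
          gcongr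
          exacts [Nat.choose_le_pow_div m k, pow_self_le_three_pow_mul_factorial m]
      _ = (k : ℝ) ^ m * 3 ^ m := by field_simp
  have hpow : (24 * (m : ℝ)) ^ m ≤ (k : ℝ) ^ m := by
    gcongr
    exact_mod_cast hm
  rw [le_div_iff₀ (by positivity)]
  refine (mul_le_mul_of_nonneg_right hcard (by positivity)).trans ?_
  calc (k.choose m : ℝ) * m ^ (2 * m) * 2 ^ (2 * m) * 8 ^ m
      = ((k.choose m : ℝ) * m ^ m) * (m ^ m * 8 ^ m) * 2 ^ (2 * m) := by
        rw [two_mul, pow_add (m : ℝ)]; ring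
    _ ≤ ((k : ℝ) ^ m * 3 ^ m) * (m ^ m * 8 ^ m) * 2 ^ (2 * m) := by gcongr
    _ = (k : ℝ) ^ m * (24 * (m : ℝ)) ^ m * 2 ^ (2 * m) := by
        rw [show (24 * (m : ℝ)) = 3 * (m * 8) by ring, mul_pow 3, mul_pow (m : ℝ) 8]; ring
    _ ≤ (k : ℝ) ^ m * (k : ℝ) ^ m * 2 ^ (2 * m) := by gcongr
    _ = (2 * k) ^ (2 * m) := by rw [mul_pow, two_mul m, pow_add (k : ℝ)]; ring

end Repetitive

/-! ### Transition matrices -/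

section TransitionMatrix

variable {H ι : Type*} [Group H] [DecidableEq H] [Fintype ι]

/-- The permutation matrix of the right multiplication by `s`. -/
def mulMat (s : H) : Matrix H H ℝ := Matrix.of fun x y => if x * s = y then 1 else 0

theorem mulMat_one : mulMat (1 : H) = 1 := by
  ext x y
  simp [mulMat, Matrix.one_apply]

theorem mulMat_transpose (s : H) : (mulMat s).transpose = mulMat s⁻¹ := by
  ext x y
  simp only [mulMat, Matrix.transpose_apply, Matrix.of_apply]
  congr 1
  rw [eq_iff_iff, eq_comm, mul_inv_eq_iff_eq_mul]

/-- The transition matrix of the random walk along the elements `g i` and their inverses. -/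
def walkMat (g : ι → H) : Matrix H H ℝ :=
  (2 * Fintype.card ι : ℝ)⁻¹ • ∑ a : ι × Bool, mulMat (letter g a)

theorem walkMat_transpose (g : ι → H) : (walkMat g).transpose = walkMat g := by
  simp [walkMat, Matrix.transpose_sum, mulMat_transpose, Fintype.sum_prod_type, letter, add_comm]

/-- The matrix with constant entries and row sums `1`: the transition matrix to equilibrium. -/
def avgMat (H : Type*) [Fintype H] : Matrix H H ℝ :=
  Matrix.of fun _ _ => (Fintype.card H : ℝ)⁻¹

variable [Fintype H]

theorem mulMat_mul (s t : H) : mulMat s * mulMat t = mulMat (s * t) := by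
  ext x y
  simp only [mulMat, Matrix.mul_apply, Matrix.of_apply, ite_mul, one_mul, zero_mul,
    Finset.sum_ite_eq, Finset.mem_univ, if_true, mul_assoc]

theorem trace_mulMat (s : H) :
    (mulMat s).trace = if s = 1 then (Fintype.card H : ℝ) else 0 := by
  simp only [Matrix.trace, Matrix.diag, mulMat, Matrix.of_apply, mul_eq_left]
  split_ifs <;> simp

theorem avgMat_mul_avgMat {H : Type*} [Fintype H] [Nonempty H] :
    avgMat H * avgMat H = avgMat H := by
  ext x y
  simp [avgMat, Matrix.mul_apply]

theorem trace_avgMat {H : Type*} [Fintype H] [Nonempty H] : (avgMat H).trace = 1 := by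
  simp [avgMat, Matrix.trace]

theorem mulMat_mul_avgMat (s : H) : mulMat s * avgMat H = avgMat H := by
  ext x y
  simp [mulMat, avgMat, Matrix.mul_apply]

theorem sum_mulMat_pow (g : ι → H) (q : ℕ) :
    (∑ a : ι × Bool, mulMat (letter g a)) ^ q =
      ∑ w : Fin q → ι × Bool, mulMat (wordVal g w) := by
  induction q with
  | zero => simp [wordVal, mulMat_one]
  | succ q ih =>
    rw [pow_succ', ih, Finset.sum_mul_sum, ← Finset.sum_product', Finset.univ_product_univ,
      ← Equiv.sum_comp (Fin.consEquiv fun _ : Fin (q + 1) => ι × Bool)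
        (fun w => mulMat (wordVal g w))]
    refine Finset.sum_congr rfl fun z _ => ?_
    rw [mulMat_mul, ← wordVal_cons]
    rfl

theorem trace_walkMat_pow (g : ι → H) (q : ℕ) :
    (walkMat g ^ q).trace = (2 * Fintype.card ι : ℝ)⁻¹ ^ q *
      ∑ w : Fin q → ι × Bool, if wordVal g w = 1 then (Fintype.card H : ℝ) else 0 := by
  rw [walkMat, smul_pow, sum_mulMat_pow, Matrix.trace_smul, Matrix.trace_sum]
  simp only [trace_mulMat, smul_eq_mul]

theorem walkMat_mul_avgMat [Nonempty ι] (g : ι → H) : walkMat g * avgMat H = avgMat H := by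
  have hcard : (2 * (Fintype.card ι : ℝ))⁻¹ * Fintype.card (ι × Bool) = 1 := by
    rw [Fintype.card_prod, Fintype.card_bool, mul_comm (Fintype.card ι), Nat.cast_mul]
    exact inv_mul_cancel₀ (by positivity)
  simp only [walkMat, Matrix.smul_mul, Finset.sum_mul, mulMat_mul_avgMat, Finset.sum_const,
    Finset.card_univ, ← Nat.cast_smul_eq_nsmul ℝ, smul_smul, hcard, one_smul]

theorem avgMat_mul_walkMat [Nonempty ι] (g : ι → H) : avgMat H * walkMat g = avgMat H := by
  rw [← (avgMat H * walkMat g).transpose_transpose, Matrix.transpose_mul, walkMat_transpose]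
  exact congrArg Matrix.transpose (walkMat_mul_avgMat g)

theorem walkMat_sub_avgMat_pow_succ [Nonempty ι] (g : ι → H) (q : ℕ) :
    (walkMat g - avgMat H) ^ (q + 1) = walkMat g ^ (q + 1) - avgMat H := by
  have hpow : ∀ q, avgMat H * walkMat g ^ q = avgMat H := fun q => by
    induction q with
    | zero => simp
    | succ q ih => rw [pow_succ, ← mul_assoc, ih, avgMat_mul_walkMat]
  induction q with
  | zero => simp
  | succ q ih =>
    rw [pow_succ', ih, sub_mul, mul_sub, mul_sub, walkMat_mul_avgMat, avgMat_mul_avgMat, hpow,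
      ← pow_succ', sub_self, sub_zero]

theorem walkMat_sub_avgMat_pow_transpose (g : ι → H) (q : ℕ) :
    ((walkMat g - avgMat H) ^ q).transpose = (walkMat g - avgMat H) ^ q := by
  rw [Matrix.transpose_pow, Matrix.transpose_sub, walkMat_transpose]
  rfl

theorem sum_sq_walkMat_sub_avgMat_pow [Nonempty ι] {m : ℕ} (hm : 0 < m) (g : ι → H) :
    ∑ x, ∑ y, ((walkMat g - avgMat H) ^ m) x y ^ 2 = (walkMat g ^ (2 * m)).trace - 1 := by
  obtain ⟨q, hq⟩ : ∃ q, 2 * m = q + 1 := ⟨2 * m - 1, by omega⟩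
  rw [← trace_avgMat (H := H), ← Matrix.trace_sub, hq, ← walkMat_sub_avgMat_pow_succ, ← hq,
    two_mul, pow_add]
  nth_rewrite 3 [← walkMat_sub_avgMat_pow_transpose]
  simp only [Matrix.trace, Matrix.diag, Matrix.mul_apply, Matrix.transpose_apply, sq]

variable [DecidableEq ι]

open Classical in
theorem sum_card_wordVal_eq_one_le {m : ℕ} (hm : 24 * m ≤ Fintype.card ι) :
    ∑ w : Fin (2 * m) → ι × Bool,
      ((Finset.univ.filter fun g : ι → H => wordVal g w = 1).card * Fintype.card H : ℝ) ≤
    (2 * Fintype.card ι) ^ (2 * m) *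
      (Fintype.card H ^ Fintype.card ι * (1 + Fintype.card H / 8 ^ m)) := by
  calc _ ≤ ∑ w : Fin (2 * m) → ι × Bool, (Fintype.card H : ℝ) ^ Fintype.card ι *
          (if Repetitive w then (Fintype.card H : ℝ) else 1) := by
        refine Finset.sum_le_sum fun w _ => ?_
        exact_mod_cast card_wordVal_eq_one_mul_card_le_ite (H := H) w
    _ ≤ ∑ w : Fin (2 * m) → ι × Bool, (Fintype.card H : ℝ) ^ Fintype.card ι *
          (1 + if Repetitive w then (Fintype.card H : ℝ) else 0) := by
        gcongr
        split_ifs <;> simp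
    _ = (Fintype.card H : ℝ) ^ Fintype.card ι * ((2 * Fintype.card ι) ^ (2 * m) +
          (Finset.univ.filter fun w : Fin (2 * m) → ι × Bool => Repetitive w).card *
            Fintype.card H) := by
        rw [← Finset.mul_sum, Finset.sum_add_distrib, ← Finset.sum_filter]
        simp [mul_comm (2 : ℝ)]
    _ ≤ (Fintype.card H : ℝ) ^ Fintype.card ι * ((2 * Fintype.card ι) ^ (2 * m) +
          (2 * Fintype.card ι) ^ (2 * m) / 8 ^ m * Fintype.card H) := by
        gcongr
        exact card_repetitive_le_div hm
    _ = _ := by ring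

theorem sum_trace_walkMat_pow_sub_one_le [Nonempty ι] {m : ℕ} (hm : 24 * m ≤ Fintype.card ι) :
    ∑ g : ι → H, ((walkMat g ^ (2 * m)).trace - 1) ≤
      (Fintype.card H : ℝ) ^ Fintype.card ι * (Fintype.card H / 8 ^ m) := by
  have htrace : ∑ g : ι → H, (walkMat g ^ (2 * m)).trace ≤
      (Fintype.card H : ℝ) ^ Fintype.card ι * (1 + Fintype.card H / 8 ^ m) := by
    simp only [trace_walkMat_pow]
    rw [← Finset.mul_sum, Finset.sum_comm, inv_pow, inv_mul_le_iff₀ (by positivity)]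
    refine (Finset.sum_congr rfl fun w _ => ?_).trans_le (sum_card_wordVal_eq_one_le hm)
    rw [← Finset.sum_filter, Finset.sum_const, nsmul_eq_mul]
  simp only [Finset.sum_sub_distrib, Finset.sum_const, Finset.card_univ, Fintype.card_fun,
    nsmul_eq_mul, mul_one, Nat.cast_pow]
  linarith

end TransitionMatrix

/-! ### Random Cayley graphs are expanders -/

section Expander

open scoped Matrix.Norms.L2Operator

variable {H ι : Type*} [Fintype H] [DecidableEq H] [Fintype ι]

theorem l2_opNorm_sq_le (A : Matrix H H ℝ) : ‖A‖ ^ 2 ≤ ∑ x, ∑ y, A x y ^ 2 := by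
  have hnn : 0 ≤ ∑ x, ∑ y, A x y ^ 2 := by positivity
  refine (Real.le_sqrt (norm_nonneg _) hnn).1 ?_
  rw [Matrix.cstar_norm_def]
  refine ContinuousLinearMap.opNorm_le_bound _ (Real.sqrt_nonneg _) fun v => ?_
  refine (sq_le_sq₀ (norm_nonneg _) (by positivity)).1 ?_
  rw [mul_pow, Real.sq_sqrt hnn, EuclideanSpace.norm_sq_eq, EuclideanSpace.norm_sq_eq,
    Finset.sum_mul]
  refine Finset.sum_le_sum fun x _ => ?_
  simp only [Real.norm_eq_abs, sq_abs]
  exact Finset.sum_mul_sq_le_sq_mul_sq _ _ _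

theorem sum_sq_col_le_l2_opNorm_sq (A : Matrix H H ℝ) (y : H) : ∑ x, A x y ^ 2 ≤ ‖A‖ ^ 2 := by
  have hmul := Matrix.l2_opNorm_mulVec A (EuclideanSpace.single y (1 : ℝ))
  rw [PiLp.norm_single, norm_one, mul_one] at hmul
  refine le_trans (le_of_eq ?_) (pow_le_pow_left₀ (norm_nonneg _) hmul 2)
  simp [EuclideanSpace.norm_sq_eq]

variable [Group H]

theorem l2_opNorm_pow_le_trace [Nonempty ι] (g : ι → H) (e : ℕ) :
    ‖walkMat g - avgMat H‖ ^ (2 * 2 ^ e) ≤ (walkMat g ^ (2 * 2 ^ e)).trace - 1 := by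
  have hsa : IsSelfAdjoint (walkMat g - avgMat H) := by
    have := walkMat_sub_avgMat_pow_transpose g 1
    rwa [pow_one, ← Matrix.conjTranspose_eq_transpose_of_trivial] at this
  have hpow : ‖(walkMat g - avgMat H) ^ 2 ^ e‖ = ‖walkMat g - avgMat H‖ ^ 2 ^ e :=
    congrArg NNReal.toReal (hsa.nnnorm_pow_two_pow e)
  rw [← sum_sq_walkMat_sub_avgMat_pow (by positivity), mul_comm, pow_mul, ← hpow]
  exact l2_opNorm_sq_le _

theorem card_half_lt_norm_walkMat_sub_avgMat_le [DecidableEq ι] [Nonempty ι] {e : ℕ}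
    (he : 24 * 2 ^ e ≤ Fintype.card ι) :
    ((Finset.univ.filter fun g : ι → H => 1 / 2 < ‖walkMat g - avgMat H‖).card : ℝ) ≤
      (Fintype.card H : ℝ) ^ Fintype.card ι * (Fintype.card H / 2 ^ 2 ^ e) := by
  have hnn : ∀ g : ι → H, 0 ≤ (walkMat g ^ (2 * 2 ^ e)).trace - 1 := fun g =>
    (by positivity : 0 ≤ ‖walkMat g - avgMat H‖ ^ (2 * 2 ^ e)).trans (l2_opNorm_pow_le_trace g e)
  have hmarkov : ((Finset.univ.filter fun g : ι → H => 1 / 2 < ‖walkMat g - avgMat H‖).card : ℝ) *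
      (1 / 4) ^ 2 ^ e ≤ ∑ g : ι → H, ((walkMat g ^ (2 * 2 ^ e)).trace - 1) := by
    rw [← nsmul_eq_mul]
    refine (Finset.card_nsmul_le_sum _ _ _ fun g hg => ?_).trans
      (Finset.sum_le_sum_of_subset_of_nonneg (Finset.filter_subset _ _) fun g _ _ => hnn g)
    refine le_trans ?_ (l2_opNorm_pow_le_trace g e)
    rw [show (1 / 4 : ℝ) = (1 / 2) ^ 2 by norm_num, ← pow_mul]
    exact pow_le_pow_left₀ (by norm_num) (Finset.mem_filter.1 hg).2.le _
  have hbound := hmarkov.trans (sum_trace_walkMat_pow_sub_one_le he)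
  rw [one_div_pow, mul_one_div, div_le_iff₀ (by positivity)] at hbound
  refine hbound.trans_eq ?_
  rw [show (8 : ℝ) = 2 * 4 by norm_num, mul_pow]
  field_simp

theorem sum_abs_walkMat_pow_sub_inv_card_le [Nonempty ι] {T : ℕ} (hT : 0 < T) {g : ι → H}
    (hg : ‖walkMat g - avgMat H‖ ≤ 1 / 2) :
    ∑ x, |(walkMat g ^ T) 1 x - (Fintype.card H : ℝ)⁻¹| ≤
      Real.sqrt (Fintype.card H) / 2 ^ T := by
  obtain ⟨q, rfl⟩ : ∃ q, T = q + 1 := ⟨T - 1, by omega⟩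
  have hentry : ∀ x, (walkMat g ^ (q + 1)) 1 x - (Fintype.card H : ℝ)⁻¹ =
      ((walkMat g - avgMat H) ^ (q + 1)) x 1 := fun x => by
    rw [← walkMat_sub_avgMat_pow_transpose, Matrix.transpose_apply, walkMat_sub_avgMat_pow_succ]
    rfl
  have hnorm : ‖(walkMat g - avgMat H) ^ (q + 1)‖ ≤ (1 / 2) ^ (q + 1) :=
    (norm_pow_le' _ (Nat.succ_pos q)).trans (pow_le_pow_left₀ (norm_nonneg _) hg _)
  simp only [hentry]
  refine (sq_le_sq₀ (by positivity) (by positivity)).1 ?_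
  calc _ ≤ (Fintype.card H : ℝ) * ∑ x, ((walkMat g - avgMat H) ^ (q + 1)) x 1 ^ 2 := by
        simpa only [sq_abs, Finset.card_univ] using sq_sum_le_card_mul_sum_sq
          (f := fun x => |((walkMat g - avgMat H) ^ (q + 1)) x 1|) (s := Finset.univ)
    _ ≤ (Fintype.card H : ℝ) * ((1 / 2) ^ (q + 1)) ^ 2 := by
        gcongr
        exact (sum_sq_col_le_l2_opNorm_sq _ _).trans
          (pow_le_pow_left₀ (norm_nonneg _) hnorm 2)
    _ = (Real.sqrt (Fintype.card H) / 2 ^ (q + 1)) ^ 2 := by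
        rw [div_pow (√_), Real.sq_sqrt (Nat.cast_nonneg _), one_div, inv_pow, inv_pow,
          div_eq_mul_inv]

end Expander

/-! ### Probabilities -/

section Probability

variable {α β γ : Type}

theorem toOuterMeasure_ne_top (μ : PMF α) (E : Set α) : μ.toOuterMeasure E ≠ ⊤ := by
  refine ne_top_of_le_ne_top ENNReal.one_ne_top ?_
  rw [← (PMF.toOuterMeasure_apply_eq_one_iff μ (s := Set.univ)).2 (Set.subset_univ _)]
  exact μ.toOuterMeasure.mono (Set.subset_univ _)

theorem prob_map (μ : PMF α) (f : α → β) (E : Set β) :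
    prob (μ.map f) E = prob μ (f ⁻¹' E) := by
  rw [prob, PMF.toOuterMeasure_map_apply]
  rfl

theorem prob_mono_support {μ : PMF α} {E F : Set α}
    (h : ∀ a ∈ μ.support, a ∈ E → a ∈ F) : prob μ E ≤ prob μ F :=
  ENNReal.toReal_mono (toOuterMeasure_ne_top μ F)
    (PMF.toOuterMeasure_mono μ fun a ha => h a ha.2 ha.1)

theorem prob_eq_sum [Fintype α] (μ : PMF α) (E : Set α) [DecidablePred (· ∈ E)] :
    prob μ E = ∑ a, if a ∈ E then (μ a).toReal else 0 := by
  rw [prob, PMF.toOuterMeasure_apply_fintype, ENNReal.toReal_sum]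
  · refine Finset.sum_congr rfl fun a _ => ?_
    by_cases ha : a ∈ E <;> simp [ha]
  · intro a _
    by_cases ha : a ∈ E <;> simp [ha, PMF.apply_ne_top]

theorem prob_uniformOfFintype [Fintype α] [Nonempty α] (E : Set α) [DecidablePred (· ∈ E)] :
    prob (PMF.uniformOfFintype α) E =
      ((Finset.univ.filter fun a => a ∈ E).card : ℝ) / Fintype.card α := by
  rw [prob_eq_sum]
  simp [← Finset.sum_filter, div_eq_mul_inv]

theorem one_sub_le_prob_uniformOfFintype [Fintype α] [Nonempty α] {E : Set α}
    [DecidablePred (· ∉ E)] {δ : ℝ}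
    (h : ((Finset.univ.filter fun a => a ∉ E).card : ℝ) ≤ δ * Fintype.card α) :
    1 - δ ≤ prob (PMF.uniformOfFintype α) E := by
  classical
  have hsplit : ((Finset.univ.filter (· ∈ E)).card : ℝ) + (Finset.univ.filter (· ∉ E)).card =
      Fintype.card α := by
    exact_mod_cast Finset.card_filter_add_card_filter_not (s := Finset.univ) (· ∈ E)
  rw [prob_uniformOfFintype, le_div_iff₀ (by positivity)]
  linarith

theorem map_uniformOfFintype_equiv [Fintype α] [Nonempty α] [Fintype β] [Nonempty β]
    (e : α ≃ β) : (PMF.uniformOfFintype α).map e = PMF.uniformOfFintype β := by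
  classical
  ext b
  simp only [PMF.map_apply, PMF.uniformOfFintype_apply, tsum_fintype, ← e.symm_apply_eq,
    Finset.sum_ite_eq, Finset.mem_univ, if_true, Fintype.card_congr e]

theorem bind_map_prodMk_uniformOfFintype [Fintype α] [Nonempty α] [Fintype β] [Nonempty β] :
    (PMF.uniformOfFintype α).bind (fun a => (PMF.uniformOfFintype β).map (Prod.mk a)) =
      PMF.uniformOfFintype (α × β) := by
  classical
  ext ⟨a, b⟩
  simp only [PMF.bind_apply, PMF.map_apply, PMF.uniformOfFintype_apply, tsum_fintype,
    Prod.mk.injEq, Fintype.card_prod, Nat.cast_mul, ite_and]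
  rw [Finset.sum_eq_single a (fun a' _ h => by simp [h.symm]) (by simp),
    ENNReal.mul_inv (by simp) (by simp)]
  simp

/-- The law of `k` independent samples. -/
def iid (law : PMF α) : ℕ → PMF (List α)
  | 0 => PMF.pure []
  | k + 1 => law.bind fun ω => (iid law k).map (List.cons ω)

theorem iid_map_uniformOfFintype [Fintype α] [Nonempty α] (f : α → β) (k : ℕ) :
    iid ((PMF.uniformOfFintype α).map f) k =
      (PMF.uniformOfFintype (Fin k → α)).map fun g => List.ofFn fun i => f (g i) := by
  induction k with
  | zero =>
    simp only [iid, List.ofFn_zero]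
    exact (PMF.map_const _ _).symm
  | succ k ih =>
    rw [iid, ih, ← map_uniformOfFintype_equiv (Fin.consEquiv fun _ : Fin (k + 1) => α),
      ← bind_map_prodMk_uniformOfFintype, PMF.map_comp, PMF.map_bind, PMF.bind_map]
    refine congrArg _ (funext fun a => ?_)
    rw [Function.comp_apply, PMF.map_comp, PMF.map_comp]
    congr 1
    funext g
    simp [Fin.consEquiv, List.ofFn_succ]

theorem prob_eq_one {μ : PMF α} {E : Set α} (h : μ.support ⊆ E) : prob μ E = 1 := by
  rw [prob, (PMF.toOuterMeasure_apply_eq_one_iff _ _).2 h, ENNReal.toReal_one]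

theorem prob_compl (μ : PMF α) (E : Set α) : prob μ Eᶜ = 1 - prob μ E := by
  have h : μ.toOuterMeasure Eᶜ + μ.toOuterMeasure E = 1 := by
    rw [PMF.toOuterMeasure_apply, PMF.toOuterMeasure_apply, ← ENNReal.tsum_add, ← μ.tsum_coe]
    exact tsum_congr fun a => congrFun (Set.indicator_compl_add_self E μ) a
  rw [eq_sub_iff_add_eq, prob, prob,
    ← ENNReal.toReal_add (toOuterMeasure_ne_top μ _) (toOuterMeasure_ne_top μ _), h,
    ENNReal.toReal_one]

theorem prob_le_one (μ : PMF α) (E : Set α) : prob μ E ≤ 1 := by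
  rw [← sub_nonneg, ← prob_compl]
  exact ENNReal.toReal_nonneg

theorem prob_le_add_tvDist [Fintype α] (μ ν : PMF α) (E : Set α) :
    prob ν E ≤ prob μ E + tvDist μ ν := by
  classical
  have htotal : ∀ ρ : PMF α, ∑ a, (ρ a).toReal = 1 := fun ρ => by
    simpa [prob_eq_sum] using prob_eq_one (Set.subset_univ ρ.support)
  have hterm : ∀ a, 2 * ((if a ∈ E then (ν a).toReal else 0) -
      (if a ∈ E then (μ a).toReal else 0)) ≤
        |(μ a).toReal - (ν a).toReal| + ((ν a).toReal - (μ a).toReal) := fun a => by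
    have hle := le_abs_self ((μ a).toReal - (ν a).toReal)
    have hge := neg_le_abs ((μ a).toReal - (ν a).toReal)
    split_ifs <;> linarith
  have hsum := Finset.sum_le_sum fun a (_ : a ∈ Finset.univ) => hterm a
  rw [← Finset.mul_sum, Finset.sum_sub_distrib, Finset.sum_add_distrib, Finset.sum_sub_distrib,
    htotal, htotal] at hsum
  rw [prob_eq_sum, prob_eq_sum, tvDist]
  linarith

theorem prob_bind_map_le {μ : PMF α} {ν : PMF β} {F : α → β → γ} {E : Set γ} {A : Set α}
    {B : Set β} (h : ∀ a ∈ μ.support, ∀ b ∈ ν.support, F a b ∈ E → a ∈ A ∧ b ∈ B) :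
    prob (μ.bind fun a => ν.map (F a)) E ≤ prob μ A * prob ν B := by
  have hle : (μ.bind fun a => ν.map (F a)).toOuterMeasure E ≤
      μ.toOuterMeasure A * ν.toOuterMeasure B := by
    rw [PMF.toOuterMeasure_bind_apply, PMF.toOuterMeasure_apply μ, ← ENNReal.tsum_mul_right]
    refine ENNReal.tsum_le_tsum fun a => ?_
    rw [PMF.toOuterMeasure_map_apply]
    by_cases ha : a ∈ μ.support
    · by_cases haA : a ∈ A
      · rw [Set.indicator_of_mem haA]
        exact mul_le_mul_right
          (PMF.toOuterMeasure_mono _ fun b hb => (h a ha b hb.2 hb.1).2) _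
      · have hzero : ν.toOuterMeasure (F a ⁻¹' E) = 0 :=
          (PMF.toOuterMeasure_apply_eq_zero_iff _ _).2
            (Set.disjoint_left.2 fun b hb hbE => haA (h a ha b hb hbE).1)
        rw [hzero, mul_zero]
        exact zero_le
    · rw [(PMF.apply_eq_zero_iff _ _).2 ha, zero_mul]
      exact zero_le
  rw [prob, prob, prob, ← ENNReal.toReal_mul]
  exact ENNReal.toReal_mono (ENNReal.mul_ne_top (toOuterMeasure_ne_top _ _)
    (toOuterMeasure_ne_top _ _)) hle

theorem one_sub_sq_le_prob_bind_map {μ : PMF α} {F : α → α → β} {E : Set β} {A : Set α}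
    (h : ∀ a ∈ μ.support, ∀ b ∈ μ.support, a ∈ A ∨ b ∈ A → F a b ∈ E) :
    1 - (1 - prob μ A) ^ 2 ≤ prob (μ.bind fun a => μ.map (F a)) E := by
  have hle : prob (μ.bind fun a => μ.map (F a)) Eᶜ ≤ prob μ Aᶜ * prob μ Aᶜ :=
    prob_bind_map_le fun a ha b hb hE => not_or.1 fun hA => hE (h a ha b hb hA)
  rw [prob_compl, prob_compl] at hle
  linarith

end Probability

/-! ### Random walks on subgroups of the symmetric group -/

/-- The generators of a random walk along the list: its members and their inverses. -/
def withInverses {G : Type*} [Group G] (l : List G) : List G :=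
  l ++ l.map (fun g => g⁻¹)

theorem sum_get_withInverses {G M : Type*} [Group G] [AddCommMonoid M] {k : ℕ} (g : Fin k → G)
    (F : G → M) : ∑ i, F ((withInverses (List.ofFn g)).get i) =
      ∑ a : Fin k × Bool, F (letter g a) := by
  rw [show (fun i : Fin _ => F ((withInverses (List.ofFn g)).get i)) =
      fun i => F (withInverses (List.ofFn g))[i.1] from rfl,
    Fin.sum_univ_fun_getElem, withInverses, List.map_append, List.sum_append]
  simp [List.sum_ofFn, Function.comp_def, Fintype.sum_prod_type, letter, Finset.sum_add_distrib]

/-- The uniform distribution over a subgroup. -/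
def uniformSubgroup {G : Type} [Group G] [Finite G] (H : Subgroup G) : PMF G :=
  haveI : Fintype H := Fintype.ofFinite _
  (PMF.uniformOfFintype H).map Subtype.val

theorem uniformSubgroup_eq_map {G : Type} [Group G] [Finite G] (H : Subgroup G) [Fintype H] :
    uniformSubgroup H = (PMF.uniformOfFintype H).map Subtype.val := by
  unfold uniformSubgroup
  congr!

open Classical in
theorem uniformSubgroup_apply {G : Type} [Group G] [Finite G] (H : Subgroup G) [Fintype H]
    (z : G) : (uniformSubgroup H z).toReal = if z ∈ H then (Fintype.card H : ℝ)⁻¹ else 0 := by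
  rw [uniformSubgroup_eq_map, PMF.map_apply, tsum_fintype]
  simp only [PMF.uniformOfFintype_apply]
  by_cases hz : z ∈ H
  · rw [Finset.sum_eq_single ⟨z, hz⟩ (fun b _ hb => if_neg fun h => hb (Subtype.ext h.symm))
      (by simp)]
    simp [hz]
  · rw [Finset.sum_eq_zero fun (b : H) _ => if_neg fun h : z = b => hz (h ▸ b.2)]
    simp [hz]

theorem walk_support_snd {n : ℕ} (S : List (Perm (Fin n))) (m : ℕ) (x : Perm (Fin n)) (t : ℕ) :
    ∀ z ∈ (walk S m (x, t)).support, z.2 = t + 2 * m := by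
  induction m generalizing x t with
  | zero => simp [walk]
  | succ m ih =>
    intro z hz
    rw [walk] at hz
    split_ifs at hz with h
    · rw [PMF.mem_support_bind_iff] at hz
      obtain ⟨i, -, hz⟩ := hz
      rw [ih _ _ z hz]; ring
    · rw [ih _ _ z hz]; ring

section Walk

variable {n k T : ℕ} {H : Subgroup (Perm (Fin n))}

theorem coe_letter (g : Fin k → H) (a : Fin k × Bool) :
    ((letter g a : H) : Perm (Fin n)) = letter (fun i => (g i : Perm (Fin n))) a := by
  simp only [letter, apply_ite Subtype.val, Subgroup.coe_inv]

/-- The sampler that walks along the permutations `g i` and their inverses. -/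
def walkSampler (T : ℕ) (l : List (Perm (Fin n))) : CayleySampler n := ⟨withInverses l, T⟩

variable [Fintype H] [NeZero k]

open Classical in
theorem walk_apply (g : Fin k → H) (T : ℕ) (y : H) (t : ℕ) (z : Perm (Fin n)) :
    (((walk (withInverses (List.ofFn fun i => (g i : Perm (Fin n)))) T (↑y, t)).map
      Prod.fst) z).toReal = if h : z ∈ H then (walkMat g ^ T) y ⟨z, h⟩ else 0 := by
  have hlen : (withInverses (List.ofFn fun i => (g i : Perm (Fin n)))).length = 2 * k := by
    simp [withInverses, two_mul]
  have hpos : 0 < (withInverses (List.ofFn fun i => (g i : Perm (Fin n)))).length := by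
    have := NeZero.pos k
    omega
  induction T generalizing y t with
  | zero =>
    have hne : z ∉ H → (y : Perm (Fin n)) ≠ z := fun hz h => hz (h ▸ y.2)
    simp only [walk, PMF.pure_map, PMF.pure_apply, pow_zero, Matrix.one_apply, Subtype.ext_iff,
      eq_comm (a := z)]
    split_ifs with hy hz <;> simp_all
  | succ T ih =>
    have : Nonempty (Fin _) := ⟨⟨0, hpos⟩⟩
    rw [walk, dif_pos hpos, PMF.map_bind, PMF.bind_apply, tsum_fintype, ENNReal.toReal_sum
      (fun i _ => ENNReal.mul_ne_top (PMF.apply_ne_top _ _) (PMF.apply_ne_top _ _))]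
    simp only [ENNReal.toReal_mul, PMF.uniformOfFintype_apply, ← Finset.mul_sum]
    rw [sum_get_withInverses (fun i => (g i : Perm (Fin n))) fun s : Perm (Fin n) =>
      (((walk (withInverses (List.ofFn fun i => (g i : Perm (Fin n)))) T
        ((y : Perm (Fin n)) * s, t + 2)).map Prod.fst) z).toReal]
    simp only [← coe_letter, ← Subgroup.coe_mul, ih, Fintype.card_fin, hlen]
    by_cases hz : z ∈ H
    · simp only [hz, dif_pos, pow_succ', Matrix.mul_apply, walkMat, Matrix.smul_apply,
        smul_eq_mul, Matrix.sum_apply, mulMat, Matrix.of_apply, mul_assoc, ← Finset.mul_sum,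
        Finset.sum_mul, ite_mul, one_mul, zero_mul]
      rw [Finset.sum_comm]
      simp
    · simp [hz]

theorem tvDist_walkSampler_le {g : Fin k → H} {b : ℝ}
    (hg : ∑ x, |(walkMat g ^ T) 1 x - (Fintype.card H : ℝ)⁻¹| ≤ b) :
    tvDist (walkSampler T (List.ofFn fun i => (g i : Perm (Fin n)))).law
      (uniformSubgroup H) ≤ b := by
  classical
  have hlaw : ∀ z, ((walkSampler T (List.ofFn fun i => (g i : Perm (Fin n)))).law z).toReal =
      if h : z ∈ H then (walkMat g ^ T) 1 ⟨z, h⟩ else 0 := walk_apply g T 1 0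
  have hsum : ∑ z, |((walkSampler T (List.ofFn fun i => (g i : Perm (Fin n)))).law z).toReal -
      (uniformSubgroup H z).toReal| =
      ∑ x, |(walkMat g ^ T) 1 x - (Fintype.card H : ℝ)⁻¹| := by
    rw [← Finset.sum_subset (Finset.subset_univ (Finset.univ.filter fun z => z ∈ H)) ?_,
      ← Finset.sum_subtype_of_mem _ (p := fun z => z ∈ H) (by simp)]
    · refine Finset.sum_congr (by ext; simp) fun x _ => ?_
      rw [hlaw, uniformSubgroup_apply, dif_pos x.2, if_pos x.2]
    · intro z _ hz
      have hz : z ∉ H := by simpa using hz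
      simp [hlaw, uniformSubgroup_apply, hz]
  have hnn : 0 ≤ ∑ x, |(walkMat g ^ T) 1 x - (Fintype.card H : ℝ)⁻¹| := by positivity
  rw [tvDist, hsum]
  linarith

open scoped Matrix.Norms.L2Operator

theorem tvDist_walkSampler_le_of_norm_le (hT : 0 < T) {ε : ℝ} (hε : Fintype.card H ≤ ε * 2 ^ T)
    {g : Fin k → H} (hg : ‖walkMat g - avgMat H‖ ≤ 1 / 2) :
    tvDist (walkSampler T (List.ofFn fun i => (g i : Perm (Fin n)))).law
      (uniformSubgroup H) ≤ ε := by
  refine tvDist_walkSampler_le ((sum_abs_walkMat_pow_sub_inv_card_le hT hg).trans ?_)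
  have hcard : (1 : ℝ) ≤ Fintype.card H := by exact_mod_cast Fintype.card_pos
  rw [div_le_iff₀ (by positivity)]
  exact ((Real.sqrt_le_left (by positivity)).2 (by nlinarith)).trans hε

theorem one_sub_le_prob_iid_tvDist {e : ℕ} {ε δ : ℝ} (hk : 24 * 2 ^ e ≤ k) (hT : 0 < T)
    (hδ : Fintype.card H ≤ δ * 2 ^ 2 ^ e) (hε : Fintype.card H ≤ ε * 2 ^ T) :
    1 - δ ≤ prob (iid (uniformSubgroup H) k)
      {l | tvDist (walkSampler T l).law (uniformSubgroup H) ≤ ε} := by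
  classical
  rw [uniformSubgroup_eq_map, iid_map_uniformOfFintype, ← uniformSubgroup_eq_map, prob_map]
  refine le_trans (one_sub_le_prob_uniformOfFintype ?_) (prob_mono_support
    (E := {g : Fin k → H | ‖walkMat g - avgMat H‖ ≤ 1 / 2})
    fun g _ hg => tvDist_walkSampler_le_of_norm_le hT hε hg)
  simp only [Set.mem_ofPred_eq, not_le]
  refine (card_half_lt_norm_walkMat_sub_avgMat_le (by simpa using hk)).trans ?_
  rw [Fintype.card_fun, Nat.cast_pow, mul_comm δ, Fintype.card_fin]
  gcongr
  rwa [div_le_iff₀ (by positivity)]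

end Walk

/-! ### The learning program -/

section Arithmetic

variable {Ω : Type} {src : Source Ω}

/-- Add `var ctr * var x` to `var dst` by repeated addition, where `var one` holds `1`; the
counter `var ctr` is consumed. -/
def mulAdd (ctr one dst x : ℕ) : Prog := countdown ctr one (.add dst dst x)

theorem reaches_mulAdd {ctr one dst x : ℕ} (hnd : [ctr, one, dst, x].Nodup) {s : State Ω}
    (h1 : s.var one = 1) :
    Reaches src s (mulAdd ctr one dst x) (s.var ctr * 4 + 1)
      fun s' => s'.var dst = s.var dst + s.var ctr * s.var x := by
  simp only [List.nodup_cons, List.mem_cons, List.not_mem_nil, or_false, not_or] at hnd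
  obtain ⟨⟨hco, hcd, hcx⟩, ⟨hod, -⟩, hdx, -⟩ := hnd
  refine (reaches_countdown (t := 1)
    (fun m s' => s'.var dst + m * s.var x = s.var dst + s.var ctr * s.var x)
    (by simpa [Prog.varsWritten] using hcd)
    (by simpa [countdown, Prog.varsWritten] using ⟨Ne.symm hco, hod⟩) h1 rfl ?_).mono le_rfl
    fun s' hs' => by simpa using hs'
  intro m s' _ hframe hs'
  refine reaches_basic rfl ?_
  have hx : s'.var x = s.var x :=
    hframe.var x (by simpa [countdown, Prog.varsWritten] using ⟨Ne.symm hcx, Ne.symm hdx⟩)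
  simp only [State.effect, State.setVar_var, if_true, if_neg (Ne.symm hcd), if_neg (Ne.symm hcx)]
  rw [← hs', hx]
  ring

/-- Count in `var j` the doublings of `var a` needed to reach `var b`; `var 5` holds `1`. -/
def countDoublings (a b j d : ℕ) : Prog :=
  .seq (block [.const j 0, .sub d b a]) (.loop d (block [.add a a a, .add j j 5, .sub d b a]))

theorem reaches_countDoublings {a b j d D : ℕ} {s : State Ω} (hnd : [a, b, j, d, 5].Nodup)
    (h1 : s.var 5 = 1) (hD : ∀ i, D ≤ i ↔ s.var b ≤ 2 ^ i * s.var a) :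
    Reaches src s (countDoublings a b j d) (8 * D + 7) fun s' => s'.var j = D := by
  simp only [List.nodup_cons, List.mem_cons, List.not_mem_nil, not_or, or_false, not_false_eq_true,
    List.nodup_nil, and_true] at hnd
  obtain ⟨⟨hab, haj, had, ha5⟩, ⟨hbj, hbd, -⟩, ⟨hjd, hj5⟩, hd5⟩ := hnd
  let I : ℕ → State Ω → Prop := fun m s' => ∃ i, i + m = D ∧ s'.var a = 2 ^ i * s.var a ∧
    s'.var b = s.var b ∧ s'.var j = i ∧ s'.var 5 = 1 ∧ s'.var d = s.var b - 2 ^ i * s.var a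
  have hinit : Reaches src s (block [.const j 0, .sub d b a]) 5 (I D) := by
    refine reaches_block ⟨0, by omega, ?_⟩ (by simp [Prog.IsBasic])
    simp [State.effect, haj, hbj, had, hbd, hjd, h1, Ne.symm hj5, Ne.symm hd5]
  have hdouble : ∀ s', I D s' → Reaches src s'
      (.loop d (block [.add a a a, .add j j 5, .sub d b a])) (D * 8 + 1) (I 0) := by
    intro s' hs'
    refine Reaches.loop I D hs' ?_ ?_
    · rintro s₁ ⟨i, hi, -, -, -, -, hd⟩
      rw [hd]
      exact Nat.sub_eq_zero_of_le ((hD i).1 (by omega))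
    · rintro m s₁ - - ⟨i, hi, hsa, hsb, hsj, h5, hsd⟩
      have hlt : 2 ^ i * s.var a < s.var b := not_le.1 (mt (hD i).2 (by omega))
      refine ⟨by omega, reaches_block ⟨i + 1, by omega, ?_⟩ (by simp [Prog.IsBasic])⟩
      simp [State.effect, haj, had, hbj, hbd, hjd, Ne.symm hab, Ne.symm haj, Ne.symm ha5,
        Ne.symm hj5, Ne.symm hd5, hsa, hsb, hsj, h5, pow_succ, mul_two, add_mul]
  refine (hinit.seq hdouble).mono (by omega) ?_
  rintro s' ⟨i, hi, -, -, hj, -⟩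
  omega

end Arithmetic

/-- The binary logarithm, rounded up to a natural number. -/
def ceilLog (x : ℝ) : ℕ := ⌈Real.logb 2 x⌉₊

theorem ceilLog_le_iff {x : ℝ} (hx : 0 ≤ x) {j : ℕ} : ceilLog x ≤ j ↔ x ≤ 2 ^ j := by
  rcases hx.eq_or_lt with rfl | hx
  · simp [ceilLog]
  · rw [ceilLog, Nat.ceil_le, Real.logb_le_iff_le_rpow one_lt_two hx, Real.rpow_natCast]

theorem ceilLog_natCast_le_iff {n j : ℕ} : ceilLog n ≤ j ↔ n ≤ 2 ^ j := by
  rw [ceilLog_le_iff n.cast_nonneg]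
  exact_mod_cast Iff.rfl

theorem ceilLog_one_div_le_iff {q : ℚ} (hq : 0 < q) {j : ℕ} :
    ceilLog (1 / (q : ℝ)) ≤ j ↔ q.den ≤ 2 ^ j * q.num.toNat := by
  have hq' : (0 : ℝ) < q := by exact_mod_cast hq
  have hden : (0 : ℝ) < q.den := by exact_mod_cast q.den_pos
  have hnum : ((q.num.toNat : ℕ) : ℝ) = q * q.den := by
    have h : ((q.num.toNat : ℕ) : ℤ) = q.num := Int.toNat_of_nonneg (Rat.num_pos.2 hq).le
    have h' : ((q.num.toNat : ℤ) : ℚ) = q * q.den := by rw [h, Rat.mul_den_eq_num]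
    exact_mod_cast h'
  rw [ceilLog_le_iff (by positivity), ← Nat.cast_le (α := ℝ)]
  push_cast
  rw [hnum, div_le_iff₀ hq', ← mul_assoc, le_mul_iff_one_le_left hden]

/-- The number of samples drawn by the learning program. -/
def numSamples (n : ℕ) (δ : ℝ) : ℕ := 64 * (n * ceilLog n + ceilLog (1 / δ) + 1)

/-- The length of the random walk that the learning program prescribes. -/
def numSteps (n : ℕ) (ε : ℝ) : ℕ := n * ceilLog n + ceilLog (1 / ε) + 1

/-- From the input `n, ε, δ`, compute the rounded logarithms of `n`, `1 / ε` and `1 / δ` in the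
variables `8`, `10` and `11`, and put `1` into `var 5`. -/
def takeLogs : Prog :=
  .seq (block [.const 5 1, .const 7 1])
    (.seq (countDoublings 7 0 8 9) (.seq (countDoublings 1 2 10 9) (countDoublings 3 4 11 9)))

theorem reaches_takeLogs {Ω : Type} {src : Source Ω} {n : ℕ} {ε δ : ℚ} (hε : 0 < ε)
    (hδ : 0 < δ) :
    Reaches src (inverseInput n ε δ) takeLogs
      (8 * ceilLog n + 8 * ceilLog (1 / ε) + 8 * ceilLog (1 / δ) + 29) fun s =>
      s.var 5 = 1 ∧ s.var 8 = ceilLog n ∧ s.var 10 = ceilLog (1 / ε) ∧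
        s.var 11 = ceilLog (1 / δ) := by
  set input : State Ω := inverseInput n ε δ
  have hinit : Reaches src input (block [.const 5 1, .const 7 1]) 5
      fun s => s.var 5 = 1 ∧ s.var 7 = 1 := reaches_block (by simp [State.effect])
  refine (hinit.frame.seq (t' := (8 * ceilLog n + 7) + ((8 * ceilLog (1 / ε) + 7) +
    (8 * ceilLog (1 / δ) + 7) + 1) + 1) fun s ⟨⟨h5, h7⟩, hf⟩ => ?_).mono (by omega) fun _ h => h
  refine (reaches_countDoublings (D := ceilLog n) (by decide) h5 fun i => ?_).frame.seq
    fun s₁ ⟨h₁, hf₁⟩ => ?_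
  · rw [h7, hf.var 0 (by decide), mul_one]
    exact ceilLog_natCast_le_iff
  have h5₁ : s₁.var 5 = 1 := (hf₁.var 5 (by decide)).trans h5
  refine (reaches_countDoublings (D := ceilLog (1 / ε)) (by decide) h5₁ fun i => ?_).frame.seq
    fun s₂ ⟨h₂, hf₂⟩ => ?_
  · rw [hf₁.var 1 (by decide), hf₁.var 2 (by decide), hf.var 1 (by decide), hf.var 2 (by decide)]
    exact ceilLog_one_div_le_iff hε
  have h5₂ : s₂.var 5 = 1 := (hf₂.var 5 (by decide)).trans h5₁
  refine (reaches_countDoublings (D := ceilLog (1 / δ)) (by decide) h5₂ fun i => ?_).frame.mono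
    le_rfl fun s₃ ⟨h₃, hf₃⟩ => ⟨?_, ?_, ?_, h₃⟩
  · rw [hf₂.var 3 (by decide), hf₂.var 4 (by decide), hf₁.var 3 (by decide),
      hf₁.var 4 (by decide), hf.var 3 (by decide), hf.var 4 (by decide)]
    exact ceilLog_one_div_le_iff hδ
  · exact (hf₃.var 5 (by decide)).trans h5₂
  · rw [hf₃.var 8 (by decide), hf₂.var 8 (by decide), h₁]
  · rw [hf₃.var 10 (by decide), h₂]

/-- Compute the length of the walk in `var 1` and the number of samples in `var 13` and
`var 14`, from the logarithms left by `takeLogs`. -/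
def setParameters : Prog :=
  .seq (mulAdd 8 5 12 0)
    (block [.add 1 12 10, .add 1 1 5, .add 13 12 11, .add 13 13 5, .add 13 13 13, .add 13 13 13,
      .add 13 13 13, .add 13 13 13, .add 13 13 13, .add 13 13 13, .add 14 13 6])

/-- The state of affairs while samples are collected: `k` is the number of samples requested in
total and `var 14` the number of samples still to come. The `p`-th sample and its inverse stand
in the rows `p` and `k + p` of `arr 0`. -/
structure Collected {n : ℕ} (k T : ℕ) (s : State (Perm (Fin n))) : Prop where
  var_zero : s.var 0 = n
  var_one : s.var 1 = T
  var_five : s.var 5 = 1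
  var_six : s.var 6 = 0
  var_thirteen : s.var 13 = k
  var_fourteen : s.samples.length + s.var 14 = k
  var_fifteen : s.var 15 = s.samples.length
  rows : ∀ (p : ℕ) (hp : p < s.samples.length) (v : Fin n),
    s.arr 0 p v = (s.samples[p] v : ℕ) ∧ s.arr 0 (k + p) v = ((s.samples[p])⁻¹ v : Fin n)

section Collect

variable {n : ℕ} {src : Source (Perm (Fin n))}

theorem reaches_setup {ε δ : ℚ} (hε : 0 < ε) (hδ : 0 < δ) :
    Reaches src (inverseInput n ε δ) (.seq takeLogs setParameters)
      (12 * ceilLog n + 8 * ceilLog (1 / ε) + 8 * ceilLog (1 / δ) + 55)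
      fun s => Collected (numSamples n δ) (numSteps n ε) s ∧ s.samples = [] := by
  refine ((reaches_takeLogs hε hδ).frame.seq (t' := ceilLog n * 4 + 25)
    fun s ⟨⟨h5, h8, h10, h11⟩, hf⟩ => ?_).mono (by omega) fun _ h => h
  rw [← h8]
  refine ((reaches_mulAdd (by decide) h5).frame.seq (t' := 23)
    fun s₁ ⟨h12, hf₁⟩ => reaches_block ?_).mono (by omega) fun _ h => h
  rw [h8, hf.var 0 (by decide), hf.var 12 (by decide)] at h12
  have hvar : ∀ x ∈ [0, 6, 15], s₁.var x = (inverseInput (Ω := Perm (Fin n)) n ε δ).var x := by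
    simp only [List.forall_mem_cons]
    exact ⟨(hf₁.var 0 (by decide)).trans (hf.var 0 (by decide)),
      (hf₁.var 6 (by decide)).trans (hf.var 6 (by decide)),
      (hf₁.var 15 (by decide)).trans (hf.var 15 (by decide)), by simp⟩
  have hlogs : ∀ x ∈ [5, 10, 11], s₁.var x = s.var x := by
    simp only [List.forall_mem_cons]
    exact ⟨hf₁.var 5 (by decide), hf₁.var 10 (by decide), hf₁.var 11 (by decide), by simp⟩
  have hsamples : s₁.samples = [] :=
    (hf₁.samples (by simp [mulAdd, countdown, Prog.DrawFree])).trans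
      (hf.samples (by simp [takeLogs, countDoublings, block, Prog.DrawFree]))
  simp only [List.forall_mem_cons, h5, h10, h11] at hvar hlogs
  obtain ⟨h0, h6, h15, -⟩ := hvar
  obtain ⟨h5, h10, h11, -⟩ := hlogs
  simp only [inverseInput, State.init] at h0 h6 h15 h12
  refine ⟨⟨?_, ?_, ?_, ?_, ?_, ?_, ?_, ?_⟩, ?_⟩ <;>
    simp [State.effect, h0, h5, h6, h10, h11, h12, h15, hsamples, numSamples, numSteps] <;> ring

/-! ### Collecting the samples and their inverses -/

/-- Write the inverse of the permutation in row `var 15` of `arr 0` into row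
`var 13 + var 15`. -/
def invertRow : Prog :=
  .seq (block [.add 16 13 15, .add 17 0 6])
    (countdown 17 5 (block [.load 18 0 15 17, .store 0 16 18 17]))

theorem reaches_invertRow {Ω : Type} {src : Source Ω} {σ : Perm (Fin n)} {s : State Ω}
    (h0 : s.var 0 = n) (h5 : s.var 5 = 1) (h6 : s.var 6 = 0) (h13 : s.var 13 ≠ 0)
    (hσ : ∀ v : Fin n, s.arr 0 (s.var 15) v = (σ v : ℕ)) :
    Reaches src s invertRow (8 * n + 7) fun s' =>
      (∀ v : Fin n, s'.arr 0 (s.var 13 + s.var 15) v = (σ⁻¹ v : Fin n)) ∧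
        ∀ p ≠ s.var 13 + s.var 15, s'.arr 0 p = s.arr 0 p := by
  set q := s.var 13 + s.var 15 with hq
  let I : ℕ → State Ω → Prop := fun m s' =>
    (∀ v : Fin n, m ≤ v → s'.arr 0 q (σ v) = v) ∧ ∀ p ≠ q, s'.arr 0 p = s.arr 0 p
  have hinit : Reaches src s (block [.add 16 13 15, .add 17 0 6]) 5 fun s' =>
      I n s' ∧ s'.var 16 = q ∧ s'.var 17 = n := by
    refine reaches_block ⟨⟨fun v hv => absurd v.2 (by omega), ?_⟩, ?_⟩ <;>
      simp [State.effect, h0, h6, hq]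
  refine (hinit.frame.seq (t' := n * 8 + 1) fun s₁ ⟨⟨hI, h16, h17⟩, hf⟩ => ?_).mono (by omega)
    (Q := I 0) fun s' ⟨hinv, hrows⟩ => ⟨fun v => ?_, hrows⟩
  swap
  · simpa using hinv (σ⁻¹ v) (Nat.zero_le _)
  rw [← h17] at hI ⊢
  refine reaches_countdown (t := 5) I (by decide) (by decide)
    ((hf.var 5 (by decide)).trans h5) hI fun m s₂ hm hf₂ ⟨hinv, hrows⟩ => ?_
  have h16 : s₂.var 16 = q := (hf₂.var 16 (by decide)).trans h16
  have h15 : s₂.var 15 = s.var 15 := (hf₂.var 15 (by decide)).trans (hf.var 15 (by decide))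
  have hload : s₂.arr 0 (s.var 15) m = σ ⟨m, h17 ▸ hm⟩ := by
    rw [hrows _ (by omega)]
    exact hσ ⟨m, h17 ▸ hm⟩
  refine reaches_block ⟨fun v hv => ?_, fun p hp => ?_⟩
  · simp only [List.foldl, State.effect, State.setArr_arr, State.setVar_var, State.setVar_arr]
    simp only [h15, h16, hload, Nat.reduceEqDiff, if_true, if_false, true_and, Fin.val_inj,
      EmbeddingLike.apply_eq_iff_eq]
    split_ifs with hvm
    · rw [hvm]
    · exact hinv v (lt_of_le_of_ne hv fun h => hvm (Fin.ext h.symm))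
  · ext v
    simp [State.effect, h15, h16, hp, hrows p hp]

/-- Store the inverse of the sample just received and advance the counters. -/
def processSample : Prog := .seq invertRow (block [.sub 14 14 5, .add 15 15 5])

theorem Collected.reaches_processSample (hrow : src.row = oneLine) {k T : ℕ}
    {s : State (Perm (Fin n))} (hs : Collected k T s) (h14 : s.var 14 ≠ 0) (ω : Perm (Fin n)) :
    Reaches src (s.recv src 0 15 ω) processSample (8 * n + 13) fun s' =>
      Collected k T s' ∧ s'.samples = s.samples ++ [ω] ∧ s'.var 14 + 1 = s.var 14 := by
  have hk := hs.var_fourteen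
  have hinvert := reaches_invertRow (src := src) (σ := ω) (s := s.recv src 0 15 ω) hs.var_zero
    hs.var_five hs.var_six (by rw [State.recv_var, hs.var_thirteen]; omega)
    fun v => by simp [hrow, oneLine]
  refine (hinvert.frame.seq (t' := 5) fun s₁ ⟨⟨hinv, hrows⟩, hf⟩ => reaches_block ?_).mono
    (by omega) fun _ h => h
  rw [State.recv_var, hs.var_thirteen, hs.var_fifteen] at hinv hrows
  have hsamples : s₁.samples = s.samples ++ [ω] :=
    hf.samples (by simp [invertRow, countdown, block, Prog.DrawFree])
  have hvar : ∀ x ≤ 15, s₁.var x = s.var x := fun x hx =>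
    hf.var x (by simp [invertRow, countdown, block, Prog.varsWritten]; omega)
  have holdRows : ∀ p < k + s.samples.length, p ≠ s.samples.length → s₁.arr 0 p = s.arr 0 p :=
    fun p hp hp' => by
      ext v
      simp [hrows p hp.ne, hs.var_fifteen, hp']
  refine ⟨⟨?_, ?_, ?_, ?_, ?_, ?_, ?_, fun p hp v => ?_⟩, ?_, ?_⟩
  case refine_8 =>
    simp only [List.foldl, State.effect, State.setVar_samples, State.setVar_arr, hsamples] at hp ⊢
    rw [List.length_append, List.length_singleton] at hp
    rcases Nat.lt_succ_iff_lt_or_eq.1 hp with hlt | rfl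
    · rw [List.getElem_append_left hlt, holdRows p (by omega) hlt.ne,
        holdRows (k + p) (by omega) (by omega)]
      exact hs.rows p hlt v
    · rw [List.getElem_concat_length rfl, hrows _ (by omega)]
      exact ⟨by simp [hs.var_fifteen, hrow, oneLine], hinv v⟩
  all_goals simp [State.effect, hvar, hsamples, hs.var_zero, hs.var_one, hs.var_five, hs.var_six,
    hs.var_thirteen, hs.var_fifteen]
  all_goals omega

/-- Draw the samples and store them together with their inverses. -/
def collect : Prog := .loop 14 (.seq (.draw 0 15) processSample)

theorem Collected.exec_collect (hrow : src.row = oneLine) {k T : ℕ}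
    {s : State (Perm (Fin n))} (hs : Collected k T s) :
    ∃ μ, Exec src [collect] s (s.var 14 * (8 * n + 16) + 1) μ ∧
      (∀ s' ∈ μ.support, Collected k T s' ∧ s'.samples.length = k) ∧
      μ.map State.samples = (iid src.law (s.var 14)).map (s.samples ++ ·) := by
  induction h14 : s.var 14 generalizing s with
  | zero =>
    refine ⟨PMF.pure s, (Exec.loop_zero h14).mono (by omega), fun s' hs' => ?_, ?_⟩
    · rw [PMF.mem_support_pure_iff] at hs'
      exact hs' ▸ ⟨hs, by have := hs.var_fourteen; omega⟩
    · simp [iid, PMF.pure_map]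
  | succ r ih =>
    choose s₁ h₁ hc₁ hsamples₁ h14₁ using hs.reaches_processSample hrow (by omega)
    choose μ₁ hμ₁ hsupp₁ hmap₁ using fun ω => ih (hc₁ ω) (by have := h14₁ ω; omega)
    refine ⟨src.law.bind μ₁, ?_, fun s' hs' => ?_, ?_⟩
    · exact ((Exec.draw fun ω => (h₁ ω).pure_append (hμ₁ ω)).seq.loop_succ (by omega)).mono
        (by ring_nf; omega)
    · rw [PMF.mem_support_bind_iff] at hs'
      obtain ⟨ω, -, h⟩ := hs'
      exact hsupp₁ ω s' h
    · rw [PMF.map_bind, iid, PMF.map_bind]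
      refine congrArg _ (funext fun ω => ?_)
      simp only [hmap₁, hsamples₁, PMF.map_comp, Function.comp_def, List.append_assoc,
        List.singleton_append]

/-- The learning program. -/
def learner : Prog := .seq (.seq takeLogs setParameters) (.seq collect (.add 0 13 13))

/-- A bound on the number of steps of the learning program. -/
def learnerTime (n : ℕ) (ε δ : ℝ) : ℕ :=
  12 * ceilLog n + 8 * ceilLog (1 / ε) + 8 * ceilLog (1 / δ) + numSamples n δ * (8 * n + 16) + 59

theorem Collected.describes {k T : ℕ} {s : State (Perm (Fin n))} (hs : Collected k T s)
    (hk : s.samples.length = k) :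
    Describes (s.setVar 0 (k + k)) (⟨withInverses s.samples, T⟩ : CayleySampler n) := by
  subst hk
  refine ⟨by simp [withInverses], by simp [hs.var_one], fun ⟨i, hi⟩ v => ?_⟩
  by_cases hil : i < s.samples.length
  · simpa [withInverses, List.getElem_append_left hil] using (hs.rows i hil v).1
  · have hlen : (withInverses s.samples).length = s.samples.length + s.samples.length := by
      simp [withInverses]
    have hrow := (hs.rows (i - s.samples.length) (by simp only [hlen] at hi; omega) v).2
    rw [Nat.add_sub_cancel' (by omega)] at hrow
    simpa [withInverses, List.getElem_append_right (not_lt.1 hil)] using hrow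

theorem exec_learner (hrow : src.row = oneLine) {ε δ : ℚ} (hε : 0 < ε) (hδ : 0 < δ) :
    ∃ μ, Exec src [learner] (inverseInput n ε δ) (learnerTime n ε δ) μ ∧
      (∀ s ∈ μ.support, s.samples.length = numSamples n δ ∧
        Describes s (walkSampler (numSteps n ε) s.samples)) ∧
      μ.map State.samples = iid src.law (numSamples n δ) := by
  obtain ⟨s₀, h₀, hc, hs⟩ := reaches_setup (src := src) (n := n) hε hδ
  have h14 : s₀.var 14 = numSamples n δ := by simpa [hs] using hc.var_fourteen
  obtain ⟨μ, hμ, hsupp, hmap⟩ := hc.exec_collect hrow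
  rw [h14, hs] at hmap
  rw [h14] at hμ
  let countGens : State (Perm (Fin n)) → State (Perm (Fin n)) := fun s =>
    s.setVar 0 (s.var 13 + s.var 13)
  have hfin : Exec src [collect, .add 0 13 13] s₀ _ (μ.bind fun s => PMF.pure (countGens s)) :=
    hμ.append (t' := 1) fun s _ => Exec.basic fun _ => rfl
  refine ⟨_, ((h₀.pure_append hfin.seq).seq).mono ?_, fun s hsupp' => ?_, ?_⟩
  · rw [learnerTime]
    omega
  · rw [PMF.mem_support_bind_iff] at hsupp'
    obtain ⟨s', hs', h⟩ := hsupp'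
    rw [PMF.mem_support_pure_iff] at h
    obtain ⟨hc', hlen⟩ := hsupp s' hs'
    rw [h]
    refine ⟨hlen, ?_⟩
    simp only [countGens, hc'.var_thirteen]
    exact hc'.describes hlen
  · simp only [PMF.map_bind, PMF.pure_map, countGens, State.setVar_samples]
    have hlaw : (μ.bind fun s => PMF.pure s.samples) = μ.map State.samples :=
      PMF.bind_pure_comp _ _
    rw [hlaw, hmap]
    exact PMF.map_id _

end Collect

/-! ### Inverse generation -/

theorem le_two_pow_ceilLog {x : ℝ} (hx : 0 ≤ x) : x ≤ 2 ^ ceilLog x := (ceilLog_le_iff hx).1 le_rfl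

theorem ceilLog_le {x : ℝ} (hx : 1 ≤ x) : (ceilLog x : ℝ) ≤ 3 / 2 * Real.log x + 1 := by
  have hlog2 := Real.log_two_gt_d9
  have hlog : 0 ≤ Real.log x := Real.log_nonneg hx
  have hceil := Nat.ceil_lt_add_one (Real.logb_nonneg one_lt_two hx)
  have hlogb : Real.logb 2 x ≤ 3 / 2 * Real.log x := by
    rw [Real.logb, div_le_iff₀ (by linarith)]
    nlinarith
  exact hceil.le.trans (by linarith)

theorem ceilLog_natCast_le (n : ℕ) : (ceilLog n : ℝ) ≤ 3 * Real.log n := by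
  rcases Nat.lt_or_ge n 2 with hn | hn
  · have h0 : ceilLog n = 0 := Nat.le_zero.1 (ceilLog_natCast_le_iff.2 (by omega))
    rw [h0]
    have := Real.log_natCast_nonneg n
    push_cast
    positivity
  · have hlog2 := Real.log_two_gt_d9
    have hle : Real.log 2 ≤ Real.log n := Real.log_le_log two_pos (by exact_mod_cast hn)
    linarith [ceilLog_le (x := n) (by exact_mod_cast (show 1 ≤ n by omega))]

theorem card_le_mul_two_pow {n m : ℕ} (H : Subgroup (Perm (Fin n))) [Fintype H] {q : ℝ}
    (hq : 0 < q) (hm : n * ceilLog n + ceilLog (1 / q) ≤ m) : Fintype.card H ≤ q * 2 ^ m := by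
  have hcard : Fintype.card H ≤ 2 ^ (n * ceilLog n) :=
    calc Fintype.card H ≤ Fintype.card (Perm (Fin n)) :=
          Fintype.card_le_of_injective _ Subtype.val_injective
      _ = n.factorial := by rw [Fintype.card_perm, Fintype.card_fin]
      _ ≤ n ^ n := n.factorial_le_pow
      _ ≤ (2 ^ ceilLog n) ^ n := Nat.pow_le_pow_left (ceilLog_natCast_le_iff.1 le_rfl) n
      _ = 2 ^ (n * ceilLog n) := by rw [← pow_mul, mul_comm]
  have hq' : 1 ≤ q * 2 ^ ceilLog (1 / q) := by
    rw [← div_le_iff₀' hq]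
    exact le_two_pow_ceilLog (by positivity)
  calc (Fintype.card H : ℝ) ≤ 2 ^ (n * ceilLog n) * 1 := by rw [mul_one]; exact_mod_cast hcard
    _ ≤ 2 ^ (n * ceilLog n) * (q * 2 ^ ceilLog (1 / q)) := by gcongr
    _ = q * 2 ^ (n * ceilLog n + ceilLog (1 / q)) := by rw [pow_add]; ring
    _ ≤ q * 2 ^ m := by gcongr; norm_num

theorem log_one_div_nonneg {q : ℝ} (h0 : 0 < q) (h1 : q ≤ 1) : 0 ≤ Real.log (1 / q) :=
  Real.log_nonneg (one_le_one_div h0 h1)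

theorem mul_ceilLog_add_ceilLog_le {q : ℝ} (n : ℕ) (h0 : 0 < q) (h1 : q ≤ 1) :
    (n * ceilLog n + ceilLog (1 / q) + 1 : ℝ) ≤ 3 * (n * Real.log n + Real.log (1 / q) + 1) := by
  have hn := mul_le_mul_of_nonneg_left (ceilLog_natCast_le n) n.cast_nonneg
  linarith [ceilLog_le (one_le_one_div h0 h1), log_one_div_nonneg h0 h1]

theorem numSamples_le {n : ℕ} {δ : ℝ} (hδ : 0 < δ) (hδ1 : δ ≤ 1) :
    (numSamples n δ : ℝ) ≤ 192 * (n * Real.log n + Real.log (1 / δ) + 1) := by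
  have hle := mul_ceilLog_add_ceilLog_le n hδ hδ1
  rw [numSamples]
  push_cast
  linarith

theorem learnerTime_le {n : ℕ} {ε δ : ℝ} (hε : 0 < ε) (hε1 : ε ≤ 1) (hδ : 0 < δ) (hδ1 : δ ≤ 1) :
    (learnerTime n ε δ : ℝ) ≤ 10000 * (n + Real.log (1 / ε) + Real.log (1 / δ) + 1) ^ 3 := by
  have hlε := log_one_div_nonneg hε hε1
  have hlδ := log_one_div_nonneg hδ hδ1
  have hn : (0 : ℝ) ≤ n := n.cast_nonneg
  have hcn := (ceilLog_natCast_le n).trans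
    (mul_le_mul_of_nonneg_left (Real.log_le_self hn) zero_le_three)
  have hcε := ceilLog_le (one_le_one_div hε hε1)
  have hcδ := ceilLog_le (one_le_one_div hδ hδ1)
  set X : ℝ := n + Real.log (1 / ε) + Real.log (1 / δ) + 1
  have hX1 : 1 ≤ X := by linarith
  have hX2 : X ≤ X ^ 2 := le_self_pow₀ hX1 two_ne_zero
  have hX3 : X ^ 2 ≤ X ^ 3 := pow_le_pow_right₀ hX1 (by norm_num)
  have hmul : (n : ℝ) * ceilLog n ≤ X * (3 * X) := by gcongr <;> linarith
  have hsamples : (numSamples n δ : ℝ) ≤ 384 * X ^ 2 := by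
    rw [numSamples]
    push_cast
    linarith
  have hprod : (numSamples n δ : ℝ) * (8 * n + 16) ≤ 384 * X ^ 2 * (24 * X) := by
    gcongr
    linarith
  rw [learnerTime]
  push_cast
  linarith

theorem walkSampler_numSteps_timeAtMost {n : ℕ} {ε : ℝ} (hε : 0 < ε) (hε1 : ε ≤ 1)
    (l : List (Perm (Fin n))) :
    (walkSampler (numSteps n ε) l).TimeAtMost (6 * (n * Real.log n + Real.log (1 / ε) + 1)) := by
  intro z hz
  have hsteps := mul_ceilLog_add_ceilLog_le n hε hε1
  rw [walk_support_snd _ _ _ _ z hz, walkSampler, numSteps]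
  push_cast
  linarith

theorem support_run_learner {n : ℕ} (law : PMF (Perm (Fin n))) {ε δ : ℚ} (hε : 0 < ε)
    (hδ : 0 < δ) :
    ∀ c ∈ (run ⟨law, oneLine⟩ learner (inverseInput n ε δ) (learnerTime n ε δ)).support,
      c.Halted ∧ c.state.samples.length = numSamples n δ ∧
        Describes c.state (walkSampler (numSteps n ε) c.state.samples) := by
  obtain ⟨μ, hμ, hsupp, -⟩ := exec_learner (src := ⟨law, oneLine⟩) rfl hε hδ
  rw [hμ.run_eq, PMF.support_map]
  rintro _ ⟨s, hs, rfl⟩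
  exact ⟨rfl, hsupp s hs⟩

theorem one_sub_le_prob_run_learner {n : ℕ} (H : Subgroup (Perm (Fin n))) {ε δ : ℚ} (hε : 0 < ε)
    (hδ : 0 < δ) :
    1 - (δ : ℝ) ≤
      prob (run ⟨uniformSubgroup H, oneLine⟩ learner (inverseInput n ε δ) (learnerTime n ε δ))
        {c | ∃ W : CayleySampler n, Describes c.state W ∧
          tvDist W.law (uniformSubgroup H) ≤ ε} := by
  have : Fintype H := Fintype.ofFinite H
  have hε' : (0 : ℝ) < ε := by exact_mod_cast hε
  have hδ' : (0 : ℝ) < δ := by exact_mod_cast hδ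
  obtain ⟨μ, hμ, hsupp, hmap⟩ := exec_learner (src := ⟨uniformSubgroup H, oneLine⟩) rfl hε hδ
  let L := n * ceilLog n + ceilLog (1 / (δ : ℝ)) + 1
  have hle : 2 ^ Nat.log 2 (2 * L) ≤ 2 * L := Nat.pow_log_le_self 2 (by omega)
  have hlt : 2 * L < 2 ^ (Nat.log 2 (2 * L) + 1) := Nat.lt_pow_succ_log_self one_lt_two _
  have hk : 24 * 2 ^ Nat.log 2 (2 * L) ≤ numSamples n δ := by rw [numSamples]; omega
  have : NeZero (numSamples n δ) := ⟨by simp [numSamples]⟩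
  rw [hμ.run_eq, prob_map]
  calc 1 - (δ : ℝ)
      ≤ prob (iid (uniformSubgroup H) (numSamples n δ))
          {l | tvDist (walkSampler (numSteps n ε) l).law (uniformSubgroup H) ≤ ε} :=
        one_sub_le_prob_iid_tvDist hk (by simp [numSteps])
          (card_le_mul_two_pow H hδ' (by rw [pow_succ] at hlt; omega))
          (card_le_mul_two_pow H hε' (Nat.le_succ _))
    _ = prob μ {s | tvDist (walkSampler (numSteps n ε) s.samples).law (uniformSubgroup H) ≤ ε} :=
        by rw [← hmap, prob_map]; rfl
    _ ≤ _ := prob_mono_support fun s hs hgood => by exact ⟨_, (hsupp s hs).2, hgood⟩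

section Renaming

variable {Ω : Type} {src : Source Ω} {f : ℕ → ℕ}

/-! ### Renaming the memory of a program -/

theorem Exec.eq_map_state {l : List Prog} {s : State Ω} {t : ℕ} {μ : PMF (State Ω)}
    (h : Exec src l s t μ) : μ = (runFrom src t ⟨l, s⟩).map Config.state := by
  rw [h.runFrom_eq, PMF.map_comp]
  exact (PMF.map_id μ).symm

/-- The law after both programs is the same for all parameters `a` that lead to the same
intermediate memory, since the memory after an execution determines the law of the next. -/
theorem Exec.append_map {α : Type} {l l' : List Prog} {s : State Ω} {t t' : ℕ} {μ : PMF α}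
    {g : α → State Ω} {κ : α → PMF (State Ω)} (h : Exec src l s t (μ.map g))
    (h' : ∀ a ∈ μ.support, Exec src l' (g a) t' (κ a)) :
    Exec src (l ++ l') s (t + t') (μ.bind κ) := by
  have hκ : μ.bind κ = (μ.map g).bind fun s' => (runFrom src t' ⟨l', s'⟩).map Config.state := by
    rw [PMF.bind_map]
    exact bind_congr_support fun a ha => (h' a ha).eq_map_state
  rw [hκ]
  refine h.append fun s' hs' => ?_
  rw [PMF.support_map] at hs'
  obtain ⟨a, ha, rfl⟩ := hs'
  exact (h' a ha).eq_map_state ▸ h' a ha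

/-- The program with variables and arrays renamed by `f`. -/
def Prog.rename (f : ℕ → ℕ) : Prog → Prog
  | .skip => .skip
  | .const x c => .const (f x) c
  | .add x y z => .add (f x) (f y) (f z)
  | .sub x y z => .sub (f x) (f y) (f z)
  | .load x a i j => .load (f x) (f a) (f i) (f j)
  | .store a i j x => .store (f a) (f i) (f j) (f x)
  | .flip x => .flip (f x)
  | .draw a i => .draw (f a) (f i)
  | .seq p q => .seq (p.rename f) (q.rename f)
  | .ite x p q => .ite (f x) (p.rename f) (q.rename f)
  | .loop x p => .loop (f x) (p.rename f)

theorem Prog.DrawFree.rename {p : Prog} (h : p.DrawFree) : (p.rename f).DrawFree := by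
  induction p with
  | draw => exact h
  | seq p q ihp ihq => exact ⟨ihp h.1, ihq h.2⟩
  | ite x p q ihp ihq => exact ⟨ihp h.1, ihq h.2⟩
  | loop x p ih => exact ih h
  | _ => trivial

/-- The memory `s₀`, with the memory `s` written to the places `f x`. -/
def State.embed (f : ℕ → ℕ) (s₀ s : State Ω) : State Ω :=
  ⟨Function.extend f s.var s₀.var, Function.extend f s.arr s₀.arr, s.samples⟩

theorem extend_update {β : Type} (hf : f.Injective) (v e : ℕ → β) (x : ℕ) (c : β) :
    Function.extend f (Function.update v x c) e =
      Function.update (Function.extend f v e) (f x) c := by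
  funext y
  by_cases hy : ∃ a, f a = y
  · obtain ⟨a, rfl⟩ := hy
    simp [hf.extend_apply, Function.update_apply, hf.eq_iff]
  · have hne : y ≠ f x := fun h => hy ⟨x, h.symm⟩
    rw [Function.update_of_ne hne, Function.extend_apply' _ _ _ hy,
      Function.extend_apply' _ _ _ hy]

theorem State.embed_var (hf : f.Injective) (s₀ s : State Ω) (x : ℕ) :
    (State.embed f s₀ s).var (f x) = s.var x :=
  hf.extend_apply _ _ _

theorem State.embed_arr (hf : f.Injective) (s₀ s : State Ω) (a : ℕ) :
    (State.embed f s₀ s).arr (f a) = s.arr a :=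
  hf.extend_apply _ _ _

theorem State.embed_setVar (hf : f.Injective) (s₀ s : State Ω) (x v : ℕ) :
    State.embed f s₀ (s.setVar x v) = (State.embed f s₀ s).setVar (f x) v := by
  simp only [State.embed, State.setVar, extend_update hf]

theorem State.embed_setRow (hf : f.Injective) (s₀ s : State Ω) (a i : ℕ) (r : ℕ → ℕ) :
    State.embed f s₀ (s.setRow a i r) = (State.embed f s₀ s).setRow (f a) i r := by
  have harr := State.embed_arr hf s₀ s a
  simp only [State.embed] at harr
  simp only [State.embed, State.setRow, extend_update hf, harr]

theorem State.embed_setArr (hf : f.Injective) (s₀ s : State Ω) (a i j v : ℕ) :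
    State.embed f s₀ (s.setArr a i j v) = (State.embed f s₀ s).setArr (f a) i j v := by
  rw [State.setArr, State.setArr, State.embed_setRow hf, State.embed_arr hf]

/-- The configuration `c`, moved to the places `f x` of the memory `s₀`. -/
def Config.embed (f : ℕ → ℕ) (s₀ : State Ω) (c : Config Ω) : Config Ω :=
  ⟨c.todo.map (Prog.rename f), State.embed f s₀ c.state⟩

theorem step_embed (hf : f.Injective) (s₀ : State Ω) (c : Config Ω) :
    step src (c.embed f s₀) = (step src c).map (Config.embed f s₀) := by
  obtain ⟨_ | ⟨p, l⟩, s⟩ := c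
  · simp [Config.embed, step, PMF.pure_map]
  cases p
  case draw a i =>
    simp only [Config.embed, List.map_cons, Prog.rename, step, PMF.map_comp, Function.comp_def,
      State.embed_var hf, ← State.embed_setRow hf]
    rfl
  case ite x p q =>
    simp only [Config.embed, List.map_cons, Prog.rename, step, PMF.pure_map, State.embed_var hf]
    split_ifs <;> rfl
  case loop x p =>
    simp only [Config.embed, List.map_cons, Prog.rename, step, PMF.pure_map, State.embed_var hf]
    split_ifs <;> rfl
  all_goals simp [Config.embed, Prog.rename, step, PMF.pure_map, PMF.map_comp, Function.comp_def,
    State.embed_var hf, State.embed_arr hf, State.embed_setVar hf, State.embed_setArr hf]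

theorem runFrom_embed (hf : f.Injective) (s₀ : State Ω) (t : ℕ) (c : Config Ω) :
    runFrom src t (c.embed f s₀) = (runFrom src t c).map (Config.embed f s₀) := by
  induction t generalizing c with
  | zero => simp [runFrom, PMF.pure_map]
  | succ t ih => simp only [runFrom, step_embed hf, PMF.bind_map, PMF.map_bind, Function.comp_def,
      ih]

theorem exec_rename (hf : f.Injective) (s₀ s : State Ω) {p : Prog} {t : ℕ}
    (h : ∀ c ∈ (run src p s t).support, c.Halted) :
    Exec src [p.rename f] (State.embed f s₀ s) t
      ((run src p s t).map fun c => State.embed f s₀ c.state) := by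
  have hrun : runFrom src t ⟨[p.rename f], State.embed f s₀ s⟩ =
      (run src p s t).map (Config.embed f s₀) := runFrom_embed hf s₀ t ⟨[p], s⟩
  have hhalts : ∀ c ∈ (runFrom src t ⟨[p.rename f], State.embed f s₀ s⟩).support, c.Halted := by
    rw [hrun, PMF.support_map]
    rintro _ ⟨c, hc, rfl⟩
    exact List.map_eq_nil_iff.2 (h c hc)
  obtain ⟨μ, hμ⟩ := exists_exec_of_halted t _ _ hhalts
  have hlaw := hμ.eq_map_state
  rw [hrun, PMF.map_comp] at hlaw
  exact hlaw ▸ hμ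

end Renaming

/-! ### Writing a permutation takes time -/

theorem exists_forall_ne_of_mem_support_step (a i : ℕ) {c c' : Config Unit}
    (h : c' ∈ (step noSource c).support) :
    ∃ j, ∀ v ≠ j, c'.state.arr a i v ≠ 0 → c.state.arr a i v ≠ 0 := by
  obtain ⟨_ | ⟨p, l⟩, s⟩ := c
  · rw [step, PMF.mem_support_pure_iff] at h
    exact ⟨0, fun v _ hv => h ▸ hv⟩
  cases p
  case store b i' j x =>
    rw [step, PMF.mem_support_pure_iff] at h
    subst h
    exact ⟨s.var j, fun v hv => by simp [hv]⟩
  case flip x =>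
    rw [step, PMF.support_map] at h
    obtain ⟨b, -, rfl⟩ := h
    exact ⟨0, fun v _ hv => hv⟩
  case draw b i' =>
    rw [step, PMF.support_map] at h
    obtain ⟨ω, -, rfl⟩ := h
    refine ⟨0, fun v _ hv => ?_⟩
    have hrecv := State.recv_arr (src := noSource) s b i' ω a i v
    rw [State.recv] at hrecv
    rw [hrecv] at hv
    split_ifs at hv
    · exact absurd rfl hv
    · exact hv
  all_goals
    rw [step, PMF.mem_support_pure_iff] at h
    subst h
    exact ⟨0, fun v _ hv => hv⟩

theorem exists_finset_of_mem_support_runFrom (a i : ℕ) {t : ℕ} {c c' : Config Unit}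
    (h : c' ∈ (runFrom noSource t c).support) :
    ∃ J : Finset ℕ, J.card ≤ t ∧ ∀ v ∉ J, c'.state.arr a i v ≠ 0 → c.state.arr a i v ≠ 0 := by
  induction t generalizing c with
  | zero =>
    rw [runFrom, PMF.mem_support_pure_iff] at h
    exact ⟨∅, by simp, fun v _ hv => h ▸ hv⟩
  | succ t ih =>
    rw [runFrom, PMF.mem_support_bind_iff] at h
    obtain ⟨c₁, h₁, h₂⟩ := h
    obtain ⟨j, hj⟩ := exists_forall_ne_of_mem_support_step a i h₁
    obtain ⟨J, hcard, hJ⟩ := ih h₂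
    refine ⟨insert j J, (Finset.card_insert_le j J).trans (by omega), fun v hv h0 => ?_⟩
    rw [Finset.mem_insert, not_or] at hv
    exact hj v hv.1 (hJ v hv.2 h0)

theorem readPerm_eq_some {n : ℕ} {r : ℕ → ℕ} {σ : Equiv.Perm (Fin n)}
    (h : readPerm n r = some σ) (v : Fin n) : r v = σ v := by
  unfold readPerm at h
  split_ifs at h with hex
  rw [Option.some.injEq] at h
  rw [← h]
  exact hex.choose_spec v

/-! ### Disjoint unions of cones -/

section Cone

variable {V W ι : Type*} {G : SimpleGraph V} {H : SimpleGraph W}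

/-- The graph `G` with an additional vertex `none`, the apex, adjacent to all others. -/
def cone (G : SimpleGraph V) : SimpleGraph (Option V) where
  Adj
    | some u, some v => G.Adj u v
    | none, none => False
    | none, some _ | some _, none => True
  symm := ⟨by
    rintro (_ | u) (_ | v) h
    exacts [h, h, h, SimpleGraph.Adj.symm h]⟩
  loopless := ⟨by
    rintro (_ | u) h
    exacts [h, G.irrefl h]⟩

@[simp] theorem cone_adj_some_some {u v : V} : (cone G).Adj (some u) (some v) ↔ G.Adj u v :=
  Iff.rfl

@[simp] theorem cone_adj_none_some (u : V) : (cone G).Adj none (some u) := trivial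

@[simp] theorem cone_adj_some_none (u : V) : (cone G).Adj (some u) none := trivial

theorem cone_adj_none_iff {o : Option V} : (cone G).Adj none o ↔ o ≠ none := by
  cases o <;> simp

/-- An isomorphism of cones need not preserve the apexes, but the apex and a vertex that is mapped
to the apex are both adjacent to all other vertices, and so can be exchanged. -/
theorem nonempty_iso_of_cone_iso (e : cone G ≃g cone H) : Nonempty (G ≃g H) := by
  have hsome : ∀ u, e (some u) ≠ none → some (e.toEquiv.removeNone u) = e (some u) := fun u h =>
    removeNone_some e.toEquiv (Option.ne_none_iff_exists'.1 h)
  have hnone : ∀ u, e (some u) = none → some (e.toEquiv.removeNone u) = e none := fun u h =>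
    removeNone_none e.toEquiv h
  refine ⟨⟨e.toEquiv.removeNone, fun {u v} => ?_⟩⟩
  rw [← cone_adj_some_some (G := H), ← cone_adj_some_some (G := G), ← e.map_adj_iff]
  by_cases huv : u = v
  · simp [huv]
  by_cases hu : e (some u) = none <;> by_cases hv : e (some v) = none
  · exact absurd (e.injective (hu.trans hv.symm)) (by simpa using huv)
  · rw [hnone u hu, hsome v hv, hu]
    exact iff_of_true (e.map_adj_iff.2 (cone_adj_none_some v)) (cone_adj_none_iff.2 hv)
  · rw [hsome u hu, hnone v hv, hv]
    exact iff_of_true (e.map_adj_iff.2 (cone_adj_some_none u)) (cone_adj_none_iff.2 hu).symm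
  · rw [hsome u hu, hsome v hv]

/-- The disjoint union of the cones over a family of graphs. -/
def coneSum (F : ι → SimpleGraph V) : SimpleGraph (ι × Option V) where
  Adj x y := x.1 = y.1 ∧ (cone (F x.1)).Adj x.2 y.2
  symm := ⟨fun _ _ h => ⟨h.1.symm, h.1 ▸ h.2.symm⟩⟩
  loopless := ⟨fun _ h => h.2.ne rfl⟩

variable {F : ι → SimpleGraph V}

@[simp] theorem coneSum_adj {i j : ι} {a b : Option V} :
    (coneSum F).Adj (i, a) (j, b) ↔ i = j ∧ (cone (F i)).Adj a b :=
  Iff.rfl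

theorem cone_adj_optionCongr (e : G ≃g H) {a b : Option V} :
    (cone H).Adj (e.toEquiv.optionCongr a) (e.toEquiv.optionCongr b) ↔ (cone G).Adj a b := by
  cases a <;> cases b <;> simp [cone_adj_none_iff, e.map_adj_iff]

/-- A disjoint union of cones over graphs isomorphic to `H` is made of copies of the cone over
`H`. -/
def coneSumIso (e : ∀ i, F i ≃g H) : coneSum F ≃g coneSum fun _ : ι => H where
  toEquiv := prodShear (Equiv.refl ι) fun i => (e i).toEquiv.optionCongr
  map_rel_iff' := by
    rintro ⟨i, a⟩ ⟨j, b⟩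
    refine and_congr_right fun hij => ?_
    obtain rfl : i = j := hij
    exact cone_adj_optionCongr (e i)

/-- The automorphism that exchanges the cones `i` and `j` of a disjoint union of isomorphic
cones. -/
def exchangeCones [DecidableEq ι] (e : ∀ i, F i ≃g H) (i j : ι) : coneSum F ≃g coneSum F :=
  ((coneSumIso e).trans
    { toEquiv := (swap i j).prodCongr (Equiv.refl _)
      map_rel_iff' := by rintro ⟨k, a⟩ ⟨l, b⟩; simp }).trans (coneSumIso e).symm

theorem exchangeCones_apply_fst [DecidableEq ι] (e : ∀ i, F i ≃g H) (i j : ι) (o : Option V) :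
    (exchangeCones e i j (i, o)).1 = j := by
  simp [exchangeCones, coneSumIso, prodShear]

end Cone

theorem viaEmbedding_mem_aut {V : Type*} {N : ℕ} {Γ : SimpleGraph V} (f : V ↪ Fin N)
    (α : Γ ≃g Γ) : Perm.viaEmbedding α.toEquiv f ∈ Aut (Γ.map f) := by
  have hα : ∀ v, Perm.viaEmbedding α.toEquiv f (f v) = f (α v) := Perm.viaEmbedding_apply _ f
  intro x y
  simp only [SimpleGraph.map_adj]
  constructor
  · rintro ⟨a, b, hab, rfl, rfl⟩
    exact ⟨α a, α b, α.map_adj_iff.2 hab, (hα a).symm, (hα b).symm⟩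
  · rintro ⟨a, b, hab, ha, hb⟩
    refine ⟨α.symm a, α.symm b, α.symm.map_adj_iff.2 hab, ?_, ?_⟩ <;>
      refine (Perm.viaEmbedding α.toEquiv f).injective ?_ <;>
      simpa only [hα, RelIso.apply_symm_apply]

/-! ### The gadget graph -/

section AdjArray

variable {n n' : ℕ} {G : SimpleGraph (Fin n)} {G' : SimpleGraph (Fin n')} {u v u' v' : ℕ}

theorem adjArray_eq_one_iff :
    adjArray G u v = 1 ↔ ∃ (hu : u < n) (hv : v < n), G.Adj ⟨u, hu⟩ ⟨v, hv⟩ := by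
  simp [adjArray]

theorem adjArray_val_eq_one_iff {x y : Fin n} : adjArray G x y = 1 ↔ G.Adj x y := by
  simp [adjArray_eq_one_iff]

theorem adjArray_eq_iff :
    adjArray G u v = adjArray G' u' v' ↔ (adjArray G u v = 1 ↔ adjArray G' u' v' = 1) := by
  unfold adjArray
  split_ifs <;> simp

end AdjArray

section Gadget

variable {m n N : ℕ}

/-- The vertices of `m` disjoint cones over graphs with `n` vertices as numbers: each cone
occupies an interval of length `n + 1`, with the apex at its end. -/
def place (hN : m * (n + 1) ≤ N) : Fin m × Option (Fin n) ↪ Fin N :=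
  ((prodCongrRight fun _ => finSuccEquivLast.symm).trans finProdFinEquiv).toEmbedding.trans
    (Fin.castLEEmb hN)

/-- The disjoint union of cones over a family of graphs, with numbers as vertices and padded with
isolated vertices. -/
def gadget (hN : m * (n + 1) ≤ N) (F : Fin m → SimpleGraph (Fin n)) : SimpleGraph (Fin N) :=
  (coneSum F).map (place hN)

variable {hN : m * (n + 1) ≤ N} {F : Fin m → SimpleGraph (Fin n)}

theorem place_some_val (j : Fin m) (u : Fin n) :
    (place hN (j, some u) : ℕ) = j * (n + 1) + u := by
  simp [place, finProdFinEquiv, add_comm, mul_comm]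

theorem place_none_val (j : Fin m) : (place hN (j, none) : ℕ) = j * (n + 1) + n := by
  simp [place, finProdFinEquiv, add_comm, mul_comm]

theorem exists_place_eq (j : Fin m) {x : ℕ} (hx : x ≤ n) :
    ∃ o, (place hN (j, o) : ℕ) = j * (n + 1) + x := by
  rcases hx.lt_or_eq with h | rfl
  · exact ⟨some ⟨x, h⟩, place_some_val j _⟩
  · exact ⟨none, place_none_val j⟩

theorem place_val_div (j : Fin m) (o : Option (Fin n)) :
    (place hN (j, o) : ℕ) / (n + 1) = j := by
  rcases o with _ | u
  · rw [place_none_val, mul_comm]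
    simp [Nat.mul_add_div]
  · rw [place_some_val, mul_comm, Nat.mul_add_div n.succ_pos,
      Nat.div_eq_of_lt (u.2.trans n.lt_succ_self), add_zero]

theorem gadget_adj_iff {x y : Fin N} : (gadget hN F).Adj x y ↔
    ∃ j a b, (cone (F j)).Adj a b ∧ place hN (j, a) = x ∧ place hN (j, b) = y := by
  rw [gadget, SimpleGraph.map_adj]
  constructor
  · rintro ⟨⟨i, a⟩, ⟨j, b⟩, ⟨hij, hab⟩, hx, hy⟩
    obtain rfl : i = j := hij
    exact ⟨i, a, b, hab, hx, hy⟩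
  · rintro ⟨j, a, b, hab, hx, hy⟩
    exact ⟨(j, a), (j, b), ⟨rfl, hab⟩, hx, hy⟩

theorem gadget_adj_place {j : Fin m} {a b : Option (Fin n)} :
    (gadget hN F).Adj (place hN (j, a)) (place hN (j, b)) ↔ (cone (F j)).Adj a b := by
  rw [gadget, SimpleGraph.map_adj_apply, coneSum_adj]
  simp

theorem div_eq_div_of_gadget_adj {x y : Fin N} (h : (gadget hN F).Adj x y) :
    (x : ℕ) / (n + 1) = y / (n + 1) := by
  obtain ⟨j, a, b, -, rfl, rfl⟩ := gadget_adj_iff.1 h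
  rw [place_val_div, place_val_div]

/-- The condition on the pair `u`, `v` for the row `r` to map the first cone of the graph `Γ`
into the remaining vertices, as an induced subgraph. -/
def EmbedsPair (n : ℕ) (Γ : ℕ → ℕ → ℕ) (r : ℕ → ℕ) (u v : ℕ) : Prop :=
  Γ u v = Γ (r u) (r v) ∧ n + 1 ≤ r u ∧ (u ≠ v → r u ≠ r v)

/-- The row `r` maps the first cone of the graph `Γ` into the remaining vertices, as an induced
subgraph. -/
def EmbedsFirst (n : ℕ) (Γ : ℕ → ℕ → ℕ) (r : ℕ → ℕ) : Prop :=
  ∀ u < n + 1, ∀ v < n + 1, EmbedsPair n Γ r u v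

section NeZero

variable [NeZero m]

theorem place_zero_lt (o : Option (Fin n)) : (place hN (0, o) : ℕ) < n + 1 := by
  rw [← Nat.div_eq_zero_iff_lt n.succ_pos, place_val_div, Fin.val_zero]

theorem EmbedsFirst.embedsPair_place {Γ : ℕ → ℕ → ℕ} {r : ℕ → ℕ} (h : EmbedsFirst n Γ r)
    (hN : m * (n + 1) ≤ N) (a b : Option (Fin n)) :
    EmbedsPair n Γ r (place hN (0, a)) (place hN (0, b)) :=
  h _ (place_zero_lt a) _ (place_zero_lt b)

/-- An embedded cone stays inside one cone, because the image of the apex is adjacent to all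
other image vertices. -/
theorem EmbedsFirst.exists_cone [NeZero n] {r : ℕ → ℕ}
    (h : EmbedsFirst n (adjArray (gadget hN F)) r) :
    ∃ j, ∀ o, ∃ o', r (place hN (0, o)) = place hN (j, o') := by
  have hadj : ∀ u : Fin n, ∃ j a b, r (place hN (0, some u)) = place hN (j, a) ∧
      r (place hN (0, none)) = place hN (j, b) := fun u => by
    have hu := (h.embedsPair_place hN (some u) none).1
    rw [adjArray_val_eq_one_iff.2 (gadget_adj_place.2 (cone_adj_some_none u)), eq_comm,
      adjArray_eq_one_iff] at hu
    obtain ⟨hx, hy, hxy⟩ := hu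
    obtain ⟨j, a, b, -, ha, hb⟩ := gadget_adj_iff.1 hxy
    exact ⟨j, a, b, congrArg Fin.val ha.symm, congrArg Fin.val hb.symm⟩
  obtain ⟨j, -, b, -, hb⟩ := hadj 0
  refine ⟨j, fun o => ?_⟩
  rcases o with _ | u
  · exact ⟨b, hb⟩
  · obtain ⟨i, a, b', ha, hb'⟩ := hadj u
    have hij : i = j := congrArg Prod.fst ((place hN).injective (Fin.ext (hb'.symm.trans hb)))
    exact ⟨a, hij ▸ ha⟩

theorem EmbedsFirst.exists_iso [NeZero n] {r : ℕ → ℕ}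
    (h : EmbedsFirst n (adjArray (gadget hN F)) r) : ∃ j ≠ 0, Nonempty (F 0 ≃g F j) := by
  obtain ⟨j, hj⟩ := h.exists_cone
  choose φ hφ using hj
  have hφ_inj : φ.Injective := fun a b hab => by
    by_contra hne
    refine (h.embedsPair_place hN a b).2.2 (fun hc => hne ?_) ?_
    · exact congrArg Prod.snd ((place hN).injective (Fin.ext hc))
    · rw [hφ, hφ, hab]
  have hφ_adj : ∀ a b, (cone (F j)).Adj (φ a) (φ b) ↔ (cone (F 0)).Adj a b := fun a b => by
    have hab := (h.embedsPair_place hN a b).1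
    rwa [adjArray_eq_iff, hφ, hφ, adjArray_val_eq_one_iff, adjArray_val_eq_one_iff,
      gadget_adj_place, gadget_adj_place, iff_comm] at hab
  refine ⟨j, ?_, nonempty_iso_of_cone_iso
    ⟨Equiv.ofBijective φ (Finite.injective_iff_bijective.1 hφ_inj), hφ_adj _ _⟩⟩
  rintro rfl
  refine (h.embedsPair_place hN none none).2.1.not_gt ?_
  rw [hφ]
  exact place_zero_lt _

theorem embedsFirst_of_mem_aut {σ : Perm (Fin N)} (hσ : σ ∈ Aut (gadget hN F))
    (ha : n + 1 ≤ σ (place hN (0, none))) {r : ℕ → ℕ} (hr : ∀ v : Fin N, r v = σ v) :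
    EmbedsFirst n (adjArray (gadget hN F)) r := by
  intro u hu v hv
  obtain ⟨a, ha'⟩ := exists_place_eq (hN := hN) 0 (Nat.lt_succ_iff.1 hu)
  obtain ⟨b, hb'⟩ := exists_place_eq (hN := hN) 0 (Nat.lt_succ_iff.1 hv)
  simp only [Fin.val_zero, zero_mul, zero_add] at ha' hb'
  subst ha' hb'
  rw [EmbedsPair, hr, hr]
  refine ⟨?_, ?_, fun hne heq => hne ?_⟩
  · rw [adjArray_eq_iff, adjArray_val_eq_one_iff, adjArray_val_eq_one_iff]
    exact hσ _ _
  · rcases a with _ | w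
    · exact ha
    · have hadj := (hσ _ _).1 (gadget_adj_place.2 (cone_adj_some_none (G := F 0) w))
      rw [← not_lt, ← Nat.div_eq_zero_iff_lt n.succ_pos] at ha ⊢
      rwa [div_eq_div_of_gadget_adj hadj]
  · rw [σ.injective (Fin.ext heq)]

/-- Composing an automorphism that preserves the first cone with the exchanges of the first cone
with the `m` cones gives `m` different automorphisms. -/
theorem mul_card_aut_preserving_le {H : SimpleGraph (Fin n)} (e : ∀ j, F j ≃g H) :
    m * Nat.card {σ : Aut (gadget hN F) // ((σ : Perm (Fin N)) (place hN (0, none)) : ℕ) < n + 1} ≤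
      Nat.card (Aut (gadget hN F)) := by
  let exch (j : Fin m) : Aut (gadget hN F) := ⟨_, viaEmbedding_mem_aut _ (exchangeCones e 0 j)⟩
  have hexch : ∀ j, ∀ x : Fin N, (x : ℕ) < n + 1 →
      ((exch j : Perm (Fin N)) x : ℕ) / (n + 1) = j := fun j x hx => by
    obtain ⟨o, ho⟩ := exists_place_eq (hN := hN) 0 (Nat.lt_succ_iff.1 hx)
    obtain rfl : place hN (0, o) = x := Fin.ext (by simpa using ho)
    change (Perm.viaEmbedding (exchangeCones e 0 j).toEquiv (place hN) _ : ℕ) / _ = _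
    rw [Perm.viaEmbedding_apply, ← exchangeCones_apply_fst e 0 j o]
    exact place_val_div _ _
  refine (congrArg (· * _) (Nat.card_fin m).symm).trans_le ?_
  rw [← Nat.card_prod]
  refine Nat.card_le_card_of_injective (fun z => exch z.1 * z.2.1) ?_
  rintro ⟨i, σ, hσ⟩ ⟨j, τ, hτ⟩ h
  have hapex := congrArg
    (fun ρ : Aut (gadget hN F) => ((ρ : Perm (Fin N)) (place hN (0, none)) : ℕ) / (n + 1)) h
  simp only [Subgroup.coe_mul, Perm.mul_apply, hexch _ _ hσ, hexch _ _ hτ] at hapex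
  obtain rfl : i = j := Fin.ext hapex
  simpa using h

end NeZero

end Gadget

/-! ### Writing the gadget -/

section WriteGadget

variable {Ω : Type} {src : Source Ω}

theorem countdown_varsWritten (x one : ℕ) (p : Prog) :
    (countdown x one p).varsWritten = x :: p.varsWritten :=
  rfl

theorem countdown_arrsWritten (x one : ℕ) (p : Prog) :
    (countdown x one p).arrsWritten = p.arrsWritten :=
  rfl

/-- A countdown whose round `m` adds `E m` to the quantity `f` adds the supremum of the `E m`. -/
theorem reaches_countdown_iSup {α : Type*} [CompleteLattice α] {x one t : ℕ} {p : Prog}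
    {s₀ : State Ω} (f : State Ω → α) (E : ℕ → α) (hx : x ∉ p.varsWritten)
    (hone : one ∉ (countdown x one p).varsWritten) (h1 : s₀.var one = 1)
    (body : ∀ m s, m < s₀.var x → Frame (countdown x one p) s₀ s →
      Reaches src (s.setVar x m) p t fun s' => f s' = f s ⊔ E m) :
    Reaches src s₀ (countdown x one p) (s₀.var x * (t + 3) + 1)
      fun s' => f s' = f s₀ ⊔ ⨆ m < s₀.var x, E m := by
  refine (reaches_countdown (fun m s => f s = f s₀ ⊔ ⨆ j ∈ Set.Ico m (s₀.var x), E j) hx hone h1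
    (by simp) ?_).mono le_rfl fun s' hs' => by simpa using hs'
  intro m s hm hframe hs
  refine (body m s hm hframe).mono le_rfl fun s' hs' => ?_
  rw [hs', hs, ← Set.insert_Ico_add_one_left_eq_Ico hm, iSup_insert, sup_assoc, sup_comm (E m)]

/-- The entries of `arr b` that agree with the table `tgt` to be written there. -/
def agreeSet (b : ℕ) (tgt : ℕ → ℕ → ℕ) (s : State Ω) : Set (ℕ × ℕ) :=
  {e | s.arr b e.1 e.2 = tgt e.1 e.2}

theorem agreeSet_setVar (b : ℕ) (tgt : ℕ → ℕ → ℕ) (s : State Ω) (x v : ℕ) :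
    agreeSet b tgt (s.setVar x v) = agreeSet b tgt s :=
  rfl

theorem agreeSet_setArr {b i j v : ℕ} {tgt : ℕ → ℕ → ℕ} (s : State Ω) (h : v = tgt i j) :
    agreeSet b tgt (s.setArr b i j v) = agreeSet b tgt s ∪ {(i, j)} := by
  ext ⟨i', j'⟩
  by_cases hij : i' = i ∧ j' = j
  · simp [agreeSet, hij, h]
  · simp [agreeSet, hij]

/-- Copy row `var 8` of `arr a`, of length `var 9`, to row `var 10` of `arr b`, shifted by
`var 7`. -/
def copyRow (b a : ℕ) : Prog :=
  countdown 9 1 (block [.add 11 7 9, .load 12 a 8 9, .store b 10 11 12])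

theorem reaches_copyRow {a b : ℕ} (hab : a ≠ b) {tgt : ℕ → ℕ → ℕ} {s : State Ω}
    (h1 : s.var 1 = 1)
    (htgt : ∀ v < s.var 9, s.arr a (s.var 8) v = tgt (s.var 10) (s.var 7 + v)) :
    Reaches src s (copyRow b a) (s.var 9 * 10 + 1) fun s' => agreeSet b tgt s' =
      agreeSet b tgt s ∪ ⋃ v < s.var 9, {(s.var 10, s.var 7 + v)} := by
  refine reaches_countdown_iSup (t := 7) (agreeSet b tgt) (fun v => {(s.var 10, s.var 7 + v)})
    (by simp [block, Prog.varsWritten])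
    (by simp [countdown_varsWritten, block, Prog.varsWritten]) h1 fun v s' hv hframe => ?_
  have hvar : ∀ x ∉ [9, 11, 12], s'.var x = s.var x := hframe.var
  have harr : s'.arr a = s.arr a := hframe.arr a (by
    simpa [countdown_arrsWritten, block, Prog.arrsWritten] using hab)
  refine reaches_block ?_ (by simp [Prog.IsBasic])
  simp only [List.foldl, State.effect]
  rw [agreeSet_setArr]
  · simp [agreeSet_setVar, hvar]
  · simp [hvar, harr, htgt v hv]

/-- The entries of the adjacency matrix of a cone that belong to the vertex `u` of its base, if the
vertices of the cone are the numbers from `c` to `c + n`. -/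
def coneRow (c n u : ℕ) : Set (ℕ × ℕ) :=
  {(c + u, c + n)} ∪ {(c + n, c + u)} ∪ ⋃ v < n, {(c + u, c + v)}

/-- Write the cone over the graph in `arr a` to the places of `arr b` that start at `var 7`. -/
def fillCone (b a : ℕ) : Prog :=
  .seq (block [.add 8 0 2, .add 13 7 0])
    (countdown 8 1
      (.seq (block [.add 10 7 8, .store b 10 13 1, .store b 13 10 1, .add 9 0 2])
        (copyRow b a)))

/-- The variables that hold constants. -/
structure Constants (n : ℕ) (s : State Ω) : Prop where
  var_zero : s.var 0 = n
  var_one : s.var 1 = 1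
  var_two : s.var 2 = 0
  var_three : s.var 3 = n + 1

theorem Constants.of_var_eq {n : ℕ} {s s' : State Ω} (h : Constants n s)
    (hs' : ∀ x < 4, s'.var x = s.var x) : Constants n s' :=
  ⟨(hs' 0 (by decide)).trans h.var_zero, (hs' 1 (by decide)).trans h.var_one,
    (hs' 2 (by decide)).trans h.var_two, (hs' 3 (by decide)).trans h.var_three⟩

theorem Constants.of_frame {n : ℕ} {p : Prog} {s s' : State Ω} (h : Constants n s)
    (hframe : Frame p s s') (hp : ∀ x ∈ p.varsWritten, 4 ≤ x) : Constants n s' :=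
  h.of_var_eq fun x hx => hframe.var x fun hmem => by have := hp x hmem; omega

theorem Constants.setVar {n x : ℕ} {s : State Ω} (h : Constants n s) (hx : 4 ≤ x) (v : ℕ) :
    Constants n (s.setVar x v) :=
  h.of_var_eq fun y hy => by rw [State.setVar_var, if_neg (by omega)]

section FillCone

variable {a b n : ℕ} {tgt : ℕ → ℕ → ℕ} {s : State Ω}

theorem reaches_fillConeRow (hab : a ≠ b) (hs : Constants n s)
    (hu : tgt (s.var 7 + s.var 8) (s.var 13) = 1 ∧ tgt (s.var 13) (s.var 7 + s.var 8) = 1)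
    (h13 : s.var 13 = s.var 7 + n)
    (htgt : ∀ v < n, s.arr a (s.var 8) v = tgt (s.var 7 + s.var 8) (s.var 7 + v)) :
    Reaches src s (.seq (block [.add 10 7 8, .store b 10 13 1, .store b 13 10 1, .add 9 0 2])
      (copyRow b a)) (n * 10 + 11)
      fun s' => agreeSet b tgt s' = agreeSet b tgt s ∪ coneRow (s.var 7) n (s.var 8) := by
  have hblock : Reaches src s
      (block [.add 10 7 8, .store b 10 13 1, .store b 13 10 1, .add 9 0 2]) 9 fun s' =>
        agreeSet b tgt s' = agreeSet b tgt s ∪ {(s.var 7 + s.var 8, s.var 7 + n)} ∪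
          {(s.var 7 + n, s.var 7 + s.var 8)} ∧ s'.var 9 = n ∧ s'.var 10 = s.var 7 + s.var 8 := by
    refine reaches_block ?_ (by simp [Prog.IsBasic])
    simp only [List.foldl, State.effect, agreeSet_setVar]
    rw [agreeSet_setArr, agreeSet_setArr]
    · simp [agreeSet_setVar, h13, hs.var_zero, hs.var_two]
    · simp [hu, hs.var_one]
    · simp [hu, hs.var_one]
  refine (hblock.frame.seq (t' := n * 10 + 1) fun s' ⟨⟨hagree, h9, h10⟩, hframe⟩ => ?_).mono
    (by omega) fun _ h => h
  have hvar : ∀ x ∉ [10, 9], s'.var x = s.var x := hframe.var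
  have harr : s'.arr a = s.arr a := hframe.arr a (by simpa [block, Prog.arrsWritten] using hab)
  refine (reaches_copyRow (src := src) (tgt := tgt) hab (hvar 1 (by decide) |>.trans hs.var_one)
    ?_).mono (by rw [h9]) fun s'' hs'' => ?_
  · rw [h9, h10, harr, hvar 8 (by decide), hvar 7 (by decide)]
    exact htgt
  · rw [hs'', hagree, h9, h10, hvar 7 (by decide), coneRow]
    simp only [Set.union_assoc]

theorem reaches_fillCone (hab : a ≠ b) (hs : Constants n s)
    (hbase : ∀ u < n, ∀ v < n, s.arr a u v = tgt (s.var 7 + u) (s.var 7 + v))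
    (hapex : ∀ u < n, tgt (s.var 7 + u) (s.var 7 + n) = 1 ∧ tgt (s.var 7 + n) (s.var 7 + u) = 1) :
    Reaches src s (fillCone b a) (n * (n * 10 + 14) + 7) fun s' =>
      agreeSet b tgt s' = agreeSet b tgt s ∪ ⋃ u < n, coneRow (s.var 7) n u := by
  have hblock : Reaches src s (block [.add 8 0 2, .add 13 7 0]) 5 fun s' =>
      agreeSet b tgt s' = agreeSet b tgt s ∧ s'.var 8 = n ∧ s'.var 13 = s.var 7 + n := by
    refine reaches_block ?_
    simp [agreeSet_setVar, State.effect, hs.var_zero, hs.var_two]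
  refine (hblock.frame.seq (t' := n * (n * 10 + 14) + 1)
    fun s₁ ⟨⟨hagree, h8, h13⟩, hframe₁⟩ => ?_).mono (by omega) fun _ h => h
  have hs₁ : Constants n s₁ := hs.of_frame hframe₁ (by decide)
  have harr₁ : s₁.arr a = s.arr a := hframe₁.arr a (by simp [block, Prog.arrsWritten])
  have h7 : s₁.var 7 = s.var 7 := hframe₁.var 7 (by decide)
  rw [← hagree]
  refine (reaches_countdown_iSup (src := src) (t := n * 10 + 11) (agreeSet b tgt)
    (coneRow (s.var 7) n)
    (by simp [copyRow, countdown_varsWritten, block, Prog.varsWritten])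
    (by simp [copyRow, countdown_varsWritten, block, Prog.varsWritten]) hs₁.var_one
    fun u s₂ hu hframe₂ => ?_).mono (by rw [h8]) fun s' hs' => by rw [hs', h8]; rfl
  rw [h8] at hu
  have hvar : ∀ x ∉ [8, 10, 9, 9, 11, 12], s₂.var x = s₁.var x := hframe₂.var
  have harr₂ : s₂.arr a = s.arr a := (hframe₂.arr a (by
    simpa [countdown_arrsWritten, copyRow, block, Prog.arrsWritten] using hab)).trans harr₁
  have hc : Constants n (s₂.setVar 8 u) := (hs₁.of_frame hframe₂ (by
    simp [copyRow, countdown_varsWritten, block, Prog.varsWritten])).setVar (by decide) u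
  have h7' : (s₂.setVar 8 u).var 7 = s.var 7 := by simp [hvar, h7]
  have h13' : (s₂.setVar 8 u).var 13 = s.var 7 + n := by simp [hvar, h13]
  have h8' : (s₂.setVar 8 u).var 8 = u := by simp
  refine (reaches_fillConeRow (src := src) (tgt := tgt) hab hc ?_ (by rw [h7', h13']) ?_).mono
    le_rfl fun s' hs' => by rw [hs', h7', h8', agreeSet_setVar]; rfl
  · rw [h7', h8', h13']
    exact hapex u hu
  · rw [h7', h8', State.setVar_arr, harr₂]
    exact hbase u hu

end FillCone

section FillGadget

variable {m n N : ℕ} {hN : m * (n + 1) ≤ N} {F : Fin m → SimpleGraph (Fin n)}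

theorem adjArray_gadget_base (j : Fin m) {u v : ℕ} (hu : u < n) (hv : v < n) :
    adjArray (gadget hN F) (j * (n + 1) + u) (j * (n + 1) + v) = adjArray (F j) u v := by
  have huv := gadget_adj_place (hN := hN) (F := F) (j := j) (a := some ⟨u, hu⟩) (b := some ⟨v, hv⟩)
  rw [← adjArray_val_eq_one_iff, place_some_val, place_some_val, cone_adj_some_some,
    ← adjArray_val_eq_one_iff] at huv
  exact adjArray_eq_iff.2 huv

theorem adjArray_gadget_apex (j : Fin m) {u : ℕ} (hu : u < n) :
    adjArray (gadget hN F) (j * (n + 1) + u) (j * (n + 1) + n) = 1 ∧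
      adjArray (gadget hN F) (j * (n + 1) + n) (j * (n + 1) + u) = 1 := by
  have hadj : (gadget hN F).Adj (place hN (j, some ⟨u, hu⟩)) (place hN (j, none)) :=
    gadget_adj_place.2 (cone_adj_some_none _)
  have hadj' := hadj.symm
  rw [← adjArray_val_eq_one_iff, place_some_val, place_none_val] at hadj hadj'
  exact ⟨hadj, hadj'⟩

theorem mem_coneRow_of_adjArray_gadget_eq_one {x y : ℕ} (h : adjArray (gadget hN F) x y = 1) :
    ∃ j < m, ∃ u < n, (x, y) ∈ coneRow (j * (n + 1)) n u := by
  obtain ⟨hx, hy, hxy⟩ := adjArray_eq_one_iff.1 h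
  obtain ⟨j, a, b, hab, ha, hb⟩ := gadget_adj_iff.1 hxy
  obtain rfl : _ = x := congrArg Fin.val ha
  obtain rfl : _ = y := congrArg Fin.val hb
  refine ⟨j, j.2, ?_⟩
  rcases a with _ | u <;> rcases b with _ | v
  · exact absurd rfl hab.ne
  · exact ⟨v, v.2, .inl (.inr (by rw [place_none_val, place_some_val]; rfl))⟩
  · exact ⟨u, u.2, .inl (.inl (by rw [place_none_val, place_some_val]; rfl))⟩
  · refine ⟨u, u.2, .inr ?_⟩
    simp only [place_some_val, Set.mem_iUnion]
    exact ⟨v, v.2, rfl⟩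

theorem adjArray_gadget_eq_zero_of_notMem {x y : ℕ}
    (h : (x, y) ∉ ⋃ j < m, ⋃ u < n, coneRow (j * (n + 1)) n u) :
    adjArray (gadget hN F) x y = 0 := by
  refine if_neg fun hxy => h ?_
  obtain ⟨j, hj, u, hu, hmem⟩ := mem_coneRow_of_adjArray_gadget_eq_one (if_pos hxy)
  exact Set.mem_biUnion hj (Set.mem_biUnion hu hmem)

/-- Write the adjacency matrix of the gadget with `m` cones to `arr b`: the first cone is taken
over the graph in `arr 0`, the others over the graph in `arr 1`. -/
def fillGadget (b m : ℕ) : Prog :=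
  .seq (.const 14 m)
    (countdown 14 1
      (.seq (block [.const 7 0, .add 15 14 2])
        (.seq (mulAdd 15 1 7 3) (.ite 14 (fillCone b 1) (fillCone b 0)))))

theorem reaches_cone_offset {j : ℕ} {s : State Ω} (hs : Constants n s) (h14 : s.var 14 = j)
    {p : Prog} {t : ℕ} {Q : State Ω → Prop}
    (h : ∀ s', s'.var 7 = j * (n + 1) → s'.var 14 = j → s'.arr = s.arr → Constants n s' →
      Reaches src s' p t Q) :
    Reaches src s (.seq (block [.const 7 0, .add 15 14 2]) (.seq (mulAdd 15 1 7 3) p))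
      (j * 4 + t + 8) Q := by
  have hblock : Reaches src s (block [.const 7 0, .add 15 14 2]) 5 fun s' =>
      s'.var 7 = 0 ∧ s'.var 15 = j := by
    refine reaches_block ?_
    simp [State.effect, h14, hs.var_two]
  refine (hblock.frame.seq (t' := j * 4 + 1 + t + 1) fun s₁ ⟨⟨h7, h15⟩, hframe₁⟩ => ?_).mono
    (by omega) fun _ h => h
  have hs₁ : Constants n s₁ := hs.of_frame hframe₁ (by decide)
  refine ((reaches_mulAdd (src := src) (by decide) hs₁.var_one).frame.seq (t' := t)
    fun s₂ ⟨hs₂, hframe₂⟩ => h s₂ ?_ ?_ ?_ (hs₁.of_frame hframe₂ (by decide))).mono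
    (by rw [h15]) fun _ h => h
  · rw [hs₂, h7, h15, hs₁.var_three, zero_add]
  · rw [hframe₂.var 14 (by decide), hframe₁.var 14 (by decide), h14]
  · funext a
    rw [hframe₂.arr a (by simp [mulAdd, countdown, Prog.arrsWritten]),
      hframe₁.arr a (by simp [block, Prog.arrsWritten])]

/-- The graph `G₁` once and the graph `G₂` for all other indices. -/
def pairFamily [NeZero m] (G₁ G₂ : SimpleGraph (Fin n)) (j : Fin m) : SimpleGraph (Fin n) :=
  if j = 0 then G₁ else G₂

variable [NeZero m] {b : ℕ} {G₁ G₂ : SimpleGraph (Fin n)} {s : State Ω}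

theorem reaches_fillGadgetCone (hb0 : b ≠ 0) (hb1 : b ≠ 1) (hs : Constants n s) (j : Fin m)
    (h7 : s.var 7 = j * (n + 1)) (h14 : s.var 14 = j) (ha0 : s.arr 0 = adjArray G₁)
    (ha1 : s.arr 1 = adjArray G₂) :
    Reaches src s (.ite 14 (fillCone b 1) (fillCone b 0)) (n * (n * 10 + 14) + 8) fun s' =>
      agreeSet b (adjArray (gadget hN (pairFamily G₁ G₂))) s' =
        agreeSet b (adjArray (gadget hN (pairFamily G₁ G₂))) s ∪
          ⋃ u < n, coneRow (j * (n + 1)) n u := by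
  rw [← h7]
  have hapex := fun u (hu : u < n) =>
    adjArray_gadget_apex (hN := hN) (F := pairFamily G₁ G₂) j hu
  have hbase := fun u (hu : u < n) v (hv : v < n) =>
    adjArray_gadget_base (hN := hN) (F := pairFamily G₁ G₂) j hu hv
  rw [← h7] at hapex hbase
  refine Reaches.ite (fun h => ?_) fun h => ?_
  · have hj : j ≠ 0 := by rintro rfl; exact h (by simpa using h14)
    refine reaches_fillCone (Ne.symm hb1) hs (fun u hu v hv => ?_) hapex
    rw [hbase u hu v hv, ha1, pairFamily, if_neg hj]
  · obtain rfl : j = 0 := Fin.ext (by rw [← h14, h, Fin.val_zero])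
    refine reaches_fillCone (Ne.symm hb0) hs (fun u hu v hv => ?_) hapex
    rw [hbase u hu v hv, ha0, pairFamily, if_pos rfl]

theorem reaches_fillGadget (hN : m * (n + 1) ≤ N) (hb0 : b ≠ 0) (hb1 : b ≠ 1)
    (hs : Constants n s) (ha0 : s.arr 0 = adjArray G₁) (ha1 : s.arr 1 = adjArray G₂)
    (hb : s.arr b = 0) :
    Reaches src s (fillGadget b m) (m * (n * (n * 10 + 14) + 4 * m + 19) + 3) fun s' =>
      s'.arr b = adjArray (gadget hN (pairFamily G₁ G₂)) := by
  have hconst : Reaches src s (.const 14 m) 1 (· = s.setVar 14 m) := reaches_basic rfl rfl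
  refine (hconst.seq (t' := m * (n * (n * 10 + 14) + 4 * m + 19) + 1) fun s₁ hs₁ => ?_).mono
    (by omega) fun _ h => h
  have hc₁ : Constants n s₁ := hs₁ ▸ hs.setVar (by decide) m
  have h14 : s₁.var 14 = m := by simp [hs₁]
  have harr₁ : s₁.arr = s.arr := by rw [hs₁]; rfl
  refine (reaches_countdown_iSup (src := src) (t := n * (n * 10 + 14) + 4 * m + 16)
    (agreeSet b (adjArray (gadget hN (pairFamily G₁ G₂))))
    (fun j => ⋃ u < n, coneRow (j * (n + 1)) n u)
    (by simp [fillCone, copyRow, countdown_varsWritten, mulAdd, block, Prog.varsWritten])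
    (by simp [fillCone, copyRow, countdown_varsWritten, mulAdd, block, Prog.varsWritten])
    hc₁.var_one fun j s₂ hj hframe => ?_).mono (by rw [h14]) fun s' hs' => ?_
  · rw [h14] at hj
    have hc₂ : Constants n (s₂.setVar 14 j) := (hc₁.of_frame hframe (by
      simp [fillCone, copyRow, countdown_varsWritten, mulAdd, block,
        Prog.varsWritten])).setVar (by decide) j
    have harr₂ : ∀ a ≠ b, s₂.arr a = s.arr a := fun a ha => (hframe.arr a (by
      simpa [fillCone, copyRow, countdown_arrsWritten, mulAdd, block, Prog.arrsWritten]
        using ha)).trans (congrFun harr₁ a)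
    refine (reaches_cone_offset (t := n * (n * 10 + 14) + 8) hc₂ (by simp) fun s₃ h7 h14 harr hc₃ =>
      (reaches_fillGadgetCone (src := src) (hN := hN) (G₁ := G₁) (G₂ := G₂) hb0 hb1 hc₃ ⟨j, hj⟩ h7
        h14 ?_ ?_).mono le_rfl fun s' hs' => ?_).mono (by omega) fun _ h => h
    · rw [harr, State.setVar_arr, harr₂ 0 hb0.symm, ha0]
    · rw [harr, State.setVar_arr, harr₂ 1 hb1.symm, ha1]
    · rw [hs', agreeSet, agreeSet, harr]
      rfl
  · funext x y
    change (x, y) ∈ agreeSet b _ s'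
    rw [hs', h14]
    refine (em _).symm.imp_left fun hxy => ?_
    change s₁.arr b x y = _
    rw [adjArray_gadget_eq_zero_of_notMem hxy, harr₁, hb]
    rfl

end FillGadget

/-! ### Verifying an isomorphism -/

/-- Set `var 4` to the `k`-th power of `var 0`. -/
def setPower (k : ℕ) : Prog :=
  .seq (block [.const 4 1, .const 15 k])
    (countdown 15 1
      (.seq (block [.const 5 0, .add 6 0 2]) (.seq (mulAdd 6 1 5 4) (.add 4 5 2))))

theorem reaches_setPower {n : ℕ} (k : ℕ) {s : State Ω} (hs : Constants n s) :
    Reaches src s (setPower k) (k * (n * 4 + 12) + 7) (·.var 4 = n ^ k) := by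
  have hblock : Reaches src s (block [.const 4 1, .const 15 k]) 5 fun s' =>
      s'.var 4 = 1 ∧ s'.var 15 = k := reaches_block (by simp [State.effect]) (by
    simp [Prog.IsBasic])
  refine (hblock.frame.seq (t' := k * (n * 4 + 12) + 1) fun s₁ ⟨⟨h4, h15⟩, hframe₁⟩ => ?_).mono
    (by omega) fun _ h => h
  have hs₁ : Constants n s₁ := hs.of_frame hframe₁ (by
    simp [block, Prog.varsWritten])
  refine (reaches_countdown (src := src) (t := n * 4 + 9) (fun m s' => s'.var 4 = n ^ (k - m))
    (by decide) (by decide) hs₁.var_one (by simp [h4, h15]) fun m s₂ hm hframe₂ h => ?_).mono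
    (by rw [h15]) fun s' hs' => by simpa using hs'
  have hs₂ : Constants n (s₂.setVar 15 m) :=
    (hs₁.of_frame hframe₂ (by decide)).setVar (by decide) m
  have hcopy : Reaches src (s₂.setVar 15 m) (block [.const 5 0, .add 6 0 2]) 5 fun s' =>
      s'.var 5 = 0 ∧ s'.var 6 = n := by
    refine reaches_block ?_
    have h0 := hs₂.var_zero
    have h2 := hs₂.var_two
    simp_all [State.effect]
  refine (hcopy.frame.seq (t' := n * 4 + 3) fun s₃ ⟨⟨h5, h6⟩, hframe₃⟩ => ?_).mono (by omega)
    fun _ h => h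
  have hs₃ : Constants n s₃ := hs₂.of_frame hframe₃ (by decide)
  refine ((reaches_mulAdd (src := src) (by decide) hs₃.var_one).frame.seq (t' := 1)
    fun s₄ ⟨h, hframe₄⟩ => reaches_basic rfl ?_).mono (by rw [h6]) fun _ h => h
  have hs₄ : Constants n s₄ := hs₃.of_frame hframe₄ (by decide)
  have hk : k - m = k - (m + 1) + 1 := by omega
  have h4' : s₃.var 4 = n ^ (k - (m + 1)) := by
    rw [hframe₃.var 4 (by decide), State.setVar_var, if_neg (by decide)]
    assumption
  simp [State.effect, h, hs₄.var_two, h5, h6, h4', pow_succ', hk]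

/-- Add to `var 21` the violations of `EmbedsPair` at the pair `(var 8, var 9)` by row `0` of
`arr a`. -/
def compareStep (a : ℕ) : Prog :=
  block [.load 10 a 2 8, .load 11 a 2 9, .load 12 2 8 9, .load 13 2 10 11,
    .sub 22 12 13, .add 21 21 22, .sub 22 13 12, .add 21 21 22, .sub 22 3 10, .add 21 21 22,
    .sub 22 8 9, .sub 23 9 8, .add 22 22 23, .sub 22 1 22, .sub 22 1 22,
    .sub 23 10 11, .sub 24 11 10, .add 23 23 24, .sub 22 22 23, .add 21 21 22]

/-- Set `var 20` to `1` if row `0` of `arr a` embeds the first cone of the graph in `arr 2` away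
from its place. -/
def verify (a : ℕ) : Prog :=
  .seq (block [.const 21 0, .add 8 3 2])
    (.seq (countdown 8 1 (.seq (.add 9 3 2) (countdown 9 1 (compareStep a))))
      (.ite 21 .skip (.const 20 1)))

section Verify

variable {a n : ℕ} {s : State Ω}

theorem reaches_compareStep (hs : Constants n s) :
    Reaches src s (compareStep a) 41 fun s' => s'.var 21 = 0 ↔
      s.var 21 = 0 ∧ EmbedsPair n (s.arr 2) (s.arr a 0) (s.var 8) (s.var 9) := by
  refine reaches_block ?_ (by simp [Prog.IsBasic])
  simp only [State.effect, List.foldl, State.setVar_var, State.setVar_arr, if_true, if_false,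
    Nat.reduceEqDiff, hs.var_one, hs.var_two, hs.var_three, EmbedsPair]
  omega

theorem reaches_compareRow (hs : Constants n s) :
    Reaches src s (.seq (.add 9 3 2) (countdown 9 1 (compareStep a))) ((n + 1) * 44 + 3)
      fun s' => s'.var 21 = 0 ↔ s.var 21 = 0 ∧
        ∀ v < n + 1, EmbedsPair n (s.arr 2) (s.arr a 0) (s.var 8) v := by
  have hadd : Reaches src s (.add 9 3 2) 1 (· = s.setVar 9 (n + 1)) :=
    reaches_basic rfl (by simp [State.effect, hs.var_two, hs.var_three])
  refine (hadd.seq (t' := (n + 1) * 44 + 1) ?_).mono (by omega) fun _ h => h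
  rintro _ rfl
  have hs₁ : Constants n (s.setVar 9 (n + 1)) := hs.setVar (by decide) _
  refine (reaches_countdown_iSup (src := src) (t := 41) (fun s' => s'.var 21 ≠ 0)
    (fun v => ¬ EmbedsPair n (s.arr 2) (s.arr a 0) (s.var 8) v)
    (by simp [compareStep, block, Prog.varsWritten])
    (by simp [compareStep, countdown_varsWritten, block, Prog.varsWritten]) hs₁.var_one
    fun v s₂ _ hframe => ?_).mono (by simp) fun s' hs' => ?_
  · have hs₂ : Constants n (s₂.setVar 9 v) := (hs₁.of_frame hframe (by
      simp [compareStep, countdown_varsWritten, block, Prog.varsWritten])).setVar (by decide) v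
    have harr : s₂.arr = s.arr := funext fun b => hframe.arr b (by
      simp [compareStep, countdown_arrsWritten, block, Prog.arrsWritten])
    have h8 : s₂.var 8 = s.var 8 := hframe.var 8 (by
      simp [compareStep, countdown_varsWritten, block, Prog.varsWritten])
    refine (reaches_compareStep (src := src) (a := a) hs₂).mono le_rfl fun s' hs' => ?_
    simp [hs', harr, h8, imp_iff_not_or]
  · rw [← not_iff_not, ← ne_eq, hs']
    simp [imp_iff_not_or]

theorem reaches_verifyLoop (hs : Constants n s) (h21 : s.var 21 = 0) (h8 : s.var 8 = n + 1) :
    Reaches src s (countdown 8 1 (.seq (.add 9 3 2) (countdown 9 1 (compareStep a))))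
      ((n + 1) * ((n + 1) * 44 + 6) + 1)
      fun s' => s'.var 21 = 0 ↔ EmbedsFirst n (s.arr 2) (s.arr a 0) := by
  refine (reaches_countdown_iSup (src := src) (t := (n + 1) * 44 + 3) (fun s' => s'.var 21 ≠ 0)
    (fun u => ¬ ∀ v < n + 1, EmbedsPair n (s.arr 2) (s.arr a 0) u v)
    (by simp [compareStep, countdown_varsWritten, block, Prog.varsWritten])
    (by simp [compareStep, countdown_varsWritten, block, Prog.varsWritten]) hs.var_one
    fun u s₁ _ hframe => ?_).mono (by rw [h8]) fun s' hs' => ?_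
  · have hs₁ : Constants n (s₁.setVar 8 u) := (hs.of_frame hframe (by
      simp [compareStep, countdown_varsWritten, block, Prog.varsWritten])).setVar (by decide) u
    have harr : s₁.arr = s.arr := funext fun b => hframe.arr b (by
      simp [compareStep, countdown_arrsWritten, block, Prog.arrsWritten])
    refine (reaches_compareRow (src := src) (a := a) hs₁).mono le_rfl fun s' hs' => ?_
    simp [hs', harr, imp_iff_not_or]
  · rw [← not_iff_not, ← ne_eq, hs', h8, h21, EmbedsFirst]
    simp

open Classical in
theorem reaches_verify (hs : Constants n s) :
    Reaches src s (verify a) ((n + 1) * ((n + 1) * 44 + 6) + 10) fun s' =>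
      s'.var 20 = if EmbedsFirst n (s.arr 2) (s.arr a 0) then 1 else s.var 20 := by
  have hblock : Reaches src s (block [.const 21 0, .add 8 3 2]) 5 fun s' =>
      s'.var 21 = 0 ∧ s'.var 8 = n + 1 :=
    reaches_block (by simp [State.effect, hs.var_two, hs.var_three])
  refine (hblock.frame.seq (t' := (n + 1) * ((n + 1) * 44 + 6) + 4)
    fun s₁ ⟨⟨h21, h8⟩, hframe₁⟩ => ?_).mono (by omega) fun _ h => h
  have hs₁ : Constants n s₁ := hs.of_frame hframe₁ (by decide)
  have harr₁ : s₁.arr = s.arr := funext fun b => hframe₁.arr b (by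
    simp [block, Prog.arrsWritten])
  refine ((reaches_verifyLoop (src := src) (a := a) hs₁ h21 h8).frame.seq (t' := 2)
    fun s₂ ⟨h, hframe₂⟩ => ?_).mono (by omega) fun _ h => h
  have h20 : s₂.var 20 = s.var 20 := (hframe₂.var 20 (by
    simp [compareStep, countdown_varsWritten, block, Prog.varsWritten])).trans
      (hframe₁.var 20 (by decide))
  rw [harr₁] at h
  refine Reaches.ite (fun hne => reaches_basic rfl ?_) fun heq => reaches_basic rfl ?_
  · rw [if_neg (mt h.2 hne)]
    exact h20
  · rw [if_pos (h.1 heq)]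
    rfl

end Verify

end WriteGadget

/-! ### The program for graph isomorphism -/

section FillGadgets

variable {Ω : Type} {src : Source Ω}

/-- Write the adjacency matrix of the gadget with `m` cones to each of the listed arrays. -/
def fillGadgets (m : ℕ) : List ℕ → Prog
  | [] => .skip
  | b :: l => .seq (fillGadget b m) (fillGadgets m l)

theorem mem_varsWritten_fillGadget {b m x : ℕ} (hx : x ∈ (fillGadget b m).varsWritten) :
    7 ≤ x ∧ x < 16 := by
  have hmem : x ∈ [14, 7, 15, 15, 7, 8, 13, 8, 10, 9, 9, 11, 12, 8, 13, 8, 10, 9, 9, 11, 12] := by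
    simpa [fillGadget, fillCone, copyRow, countdown_varsWritten, mulAdd, block,
      Prog.varsWritten] using hx
  clear hx
  decide +revert

theorem mem_arrsWritten_fillGadget {a b m : ℕ} (ha : a ∈ (fillGadget b m).arrsWritten) :
    a = b := by
  simpa [fillGadget, fillCone, copyRow, countdown_arrsWritten, mulAdd, block,
    Prog.arrsWritten] using ha

theorem mem_varsWritten_fillGadgets {m x : ℕ} {l : List ℕ}
    (hx : x ∈ (fillGadgets m l).varsWritten) : 7 ≤ x ∧ x < 16 := by
  induction l with
  | nil => simp [fillGadgets, Prog.varsWritten] at hx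
  | cons b l ih => exact (List.mem_append.1 hx).elim mem_varsWritten_fillGadget ih

theorem mem_arrsWritten_fillGadgets {a m : ℕ} {l : List ℕ}
    (ha : a ∈ (fillGadgets m l).arrsWritten) : a ∈ l := by
  induction l with
  | nil => simp [fillGadgets, Prog.arrsWritten] at ha
  | cons b l ih =>
    rw [List.mem_cons]
    exact (List.mem_append.1 ha).imp mem_arrsWritten_fillGadget ih

theorem reaches_fillGadgets {m n N : ℕ} [NeZero m] (hN : m * (n + 1) ≤ N)
    {G₁ G₂ : SimpleGraph (Fin n)} {l : List ℕ} (hl : l.Nodup) {s : State Ω} (hs : Constants n s)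
    (ha0 : s.arr 0 = adjArray G₁) (ha1 : s.arr 1 = adjArray G₂)
    (h : ∀ b ∈ l, b ≠ 0 ∧ b ≠ 1 ∧ s.arr b = 0) :
    Reaches src s (fillGadgets m l)
      (l.length * (m * (n * (n * 10 + 14) + 4 * m + 19) + 4) + 1) fun s' =>
        ∀ b ∈ l, s'.arr b = adjArray (gadget hN (pairFamily G₁ G₂)) := by
  induction l generalizing s with
  | nil => exact (reaches_basic (Q := fun _ => True) rfl trivial).mono (by simp) (by simp)
  | cons b l ih =>
    obtain ⟨hbl, hl⟩ := List.nodup_cons.1 hl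
    obtain ⟨⟨hb0, hb1, hb⟩, hl0⟩ := List.forall_mem_cons.1 h
    refine ((reaches_fillGadget (src := src) hN hb0 hb1 hs ha0 ha1 hb).frame.seq
      (t' := l.length * (m * (n * (n * 10 + 14) + 4 * m + 19) + 4) + 1)
      fun s₁ ⟨hb₁, hframe⟩ => ?_).mono (by rw [List.length_cons]; lia) fun _ h => h
    have harr : ∀ a ≠ b, s₁.arr a = s.arr a := fun a hab =>
      hframe.arr a fun hmem => hab (mem_arrsWritten_fillGadget hmem)
    have hs₁ : Constants n s₁ := hs.of_frame hframe fun x hx => by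
      have := mem_varsWritten_fillGadget hx
      omega
    refine (ih hl hs₁ ((harr 0 hb0.symm).trans ha0) ((harr 1 hb1.symm).trans ha1) fun c hc =>
      ⟨(hl0 c hc).1, (hl0 c hc).2.1, ?_⟩).frame.mono le_rfl fun s' ⟨hs', hframe'⟩ => ?_
    · rw [harr c fun hcb => hbl (hcb ▸ hc), (hl0 c hc).2.2]
    · refine List.forall_mem_cons.2 ⟨?_, hs'⟩
      rw [hframe'.arr b fun hmem => hbl (mem_arrsWritten_fillGadgets hmem), hb₁]

end FillGadgets

/-- The place of the variable or array `x` of a program in its copy `i`. The numbers below `100`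
are left to the program that contains the copies. -/
def copyPlace (i : Fin 2) (x : ℕ) : ℕ := 100 + 2 * x + i

theorem copyPlace_injective (i : Fin 2) : (copyPlace i).Injective := fun x y h => by
  simp only [copyPlace] at h
  omega

theorem notMem_range_copyPlace_of_lt (i : Fin 2) {y : ℕ} (hy : y < 100) :
    y ∉ Set.range (copyPlace i) := by
  rintro ⟨x, rfl⟩
  simp only [copyPlace] at hy
  omega

theorem copyPlace_notMem_range {i j : Fin 2} (hij : i ≠ j) (x : ℕ) :
    copyPlace i x ∉ Set.range (copyPlace j) := by
  rintro ⟨y, h⟩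
  simp only [copyPlace] at h
  omega

section Embed

variable {Ω : Type} {f : ℕ → ℕ} {s s' : State Ω}

theorem extend_eq_self {β : Type} (hf : f.Injective) {v e : ℕ → β} (h : ∀ x, e (f x) = v x) :
    Function.extend f v e = e := by
  rw [show v = e ∘ f from funext fun x => (h x).symm]
  funext y
  by_cases hy : ∃ x, f x = y
  · obtain ⟨x, rfl⟩ := hy
    exact hf.extend_apply _ _ _
  · exact Function.extend_apply' _ _ _ hy

theorem State.embed_eq_self (hf : f.Injective) (hv : ∀ x, s.var (f x) = s'.var x)
    (ha : ∀ a, s.arr (f a) = s'.arr a) (hs : s.samples = s'.samples) :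
    State.embed f s s' = s := by
  rw [State.embed, extend_eq_self hf hv, extend_eq_self hf ha, ← hs]

theorem State.embed_var_of_notMem {y : ℕ} (hy : y ∉ Set.range f) :
    (State.embed f s s').var y = s.var y :=
  Function.extend_apply' _ _ _ hy

theorem State.embed_arr_of_notMem {y : ℕ} (hy : y ∉ Set.range f) :
    (State.embed f s s').arr y = s.arr y :=
  Function.extend_apply' _ _ _ hy

end Embed

section IsoProg

variable {n N : ℕ} {Γ : SimpleGraph (Fin N)} {I : Set (Fin 2)} {s : State Unit}

/-- The memory is ready for the attempts with the copies in `I`: the graph `Γ` is in its place,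
and the copies in `I` find `Γ` as their input. -/
structure Ready (n : ℕ) (Γ : SimpleGraph (Fin N)) (I : Set (Fin 2)) (s : State Unit) : Prop where
  constants : Constants n s
  graph : s.arr 2 = adjArray Γ
  samples : s.samples = []
  input_var : ∀ i ∈ I, ∀ x, s.var (copyPlace i x) = (graphInput Γ).var x
  input_arr : ∀ i ∈ I, ∀ a, s.arr (copyPlace i a) = (graphInput Γ).arr a

theorem Ready.embed_eq_self {i : Fin 2} (hs : Ready n Γ I s) (hi : i ∈ I) :
    State.embed (copyPlace i) s (graphInput Γ) = s :=
  State.embed_eq_self (copyPlace_injective i) (hs.input_var i hi) (hs.input_arr i hi) hs.samples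

theorem Ready.embed {c : State Unit} (hs : Ready n Γ I s) (hc : c.samples = []) (i : Fin 2) :
    Ready n Γ (I \ {i}) (State.embed (copyPlace i) s c) where
  constants := hs.constants.of_var_eq fun _ hx =>
    State.embed_var_of_notMem (notMem_range_copyPlace_of_lt i (by omega))
  graph := (State.embed_arr_of_notMem (notMem_range_copyPlace_of_lt i (by decide))).trans hs.graph
  samples := hc
  input_var j hj x :=
    (State.embed_var_of_notMem (copyPlace_notMem_range hj.2 x)).trans (hs.input_var j hj.1 x)
  input_arr j hj a :=
    (State.embed_arr_of_notMem (copyPlace_notMem_range hj.2 a)).trans (hs.input_arr j hj.1 a)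

theorem Ready.of_frame_verify {a : ℕ} {s' : State Unit} (hs : Ready n Γ I s)
    (hframe : Frame (verify a) s s') : Ready n Γ I s' := by
  have hwritten : ∀ x ∈ (verify a).varsWritten, 4 ≤ x ∧ x < 100 := by
    change ∀ x ∈ [21, 8, 8, 9, 9, 10, 11, 12, 13, 22, 21, 22, 21, 22, 21, 22, 23, 22, 22, 22, 23,
      24, 23, 22, 21, 20], _
    decide
  have hvar : ∀ x ≥ 100, s'.var x = s.var x := fun x hx =>
    hframe.var x fun hmem => (hwritten x hmem).2.not_ge hx
  have harr : ∀ b, s'.arr b = s.arr b := fun b => hframe.arr b (by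
    simp [verify, compareStep, countdown_arrsWritten, block, Prog.arrsWritten])
  refine ⟨hs.constants.of_frame hframe fun x hx => (hwritten x hx).1, (harr 2).trans hs.graph,
    (hframe.samples ?_).trans hs.samples, fun i hi x => (hvar _ ?_).trans (hs.input_var i hi x),
    fun i hi b => (harr _).trans (hs.input_arr i hi b)⟩
  · simp [verify, compareStep, countdown, block, Prog.DrawFree]
  · rw [copyPlace]
    omega

/-- Run the copy `i` of `A` and record in `var 20` whether its output proves an isomorphism. -/
def attempt (A : Prog) (i : Fin 2) : Prog := .seq (A.rename (copyPlace i)) (verify (102 + i))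

/-- Run both copies of `A` and report in `var 0` whether one of the outputs proves an
isomorphism. -/
def attempts (A : Prog) : Prog := .seq (attempt A 0) (.seq (attempt A 1) (.add 0 20 2))

variable {A : Prog} {t : ℕ}

open Classical in
theorem exec_attempt {i : Fin 2} (hi : i ∈ I) (hA : A.DrawFree)
    (hhalts : ∀ c ∈ (run noSource A (graphInput Γ) t).support, c.Halted) (hs : Ready n Γ I s) :
    ∃ F : Config Unit → State Unit,
      Exec noSource [attempt A i] s (t + (n + 1) * ((n + 1) * 44 + 6) + 11)
        ((run noSource A (graphInput Γ) t).map F) ∧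
      ∀ c ∈ (run noSource A (graphInput Γ) t).support, Ready n Γ (I \ {i}) (F c) ∧
        (F c).var 20 = if EmbedsFirst n (adjArray Γ) (c.state.arr 1 0) then 1 else s.var 20 := by
  set μ := run noSource A (graphInput Γ) t
  have hcopy : Exec noSource [A.rename (copyPlace i)] s t
      (μ.map fun c => State.embed (copyPlace i) s c.state) := by
    have := exec_rename (copyPlace_injective i) s (graphInput Γ) hhalts
    rwa [hs.embed_eq_self hi] at this
  have hverify : ∀ c ∈ μ.support, Reaches noSource (State.embed (copyPlace i) s c.state)
      (verify (102 + i)) ((n + 1) * ((n + 1) * 44 + 6) + 10) fun s' => Ready n Γ (I \ {i}) s' ∧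
        s'.var 20 = if EmbedsFirst n (adjArray Γ) (c.state.arr 1 0) then 1 else s.var 20 := by
    intro c hc
    have hsamples : c.state.samples = s.samples :=
      (hcopy.frame (s' := State.embed (copyPlace i) s c.state) (by
        rw [PMF.support_map]
        exact ⟨c, hc, rfl⟩)).samples hA.rename
    have hready := hs.embed (hsamples.trans hs.samples) i
    refine (reaches_verify hready.constants).frame.mono le_rfl fun s' ⟨h, hframe⟩ =>
      ⟨hready.of_frame_verify hframe, ?_⟩
    have hout : (State.embed (copyPlace i) s c.state).arr (102 + i) = c.state.arr 1 :=
      State.embed_arr (copyPlace_injective i) s c.state 1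
    rw [h, hready.graph, hout,
      State.embed_var_of_notMem (notMem_range_copyPlace_of_lt i (by decide))]
  have : Nonempty (State Unit) := ⟨s⟩
  choose! F hF hready using hverify
  exact ⟨F, (hcopy.append_map hF).seq.mono (by omega), hready⟩

open Classical in
theorem exec_attempts (hA : A.DrawFree)
    (hhalts : ∀ c ∈ (run noSource A (graphInput Γ) t).support, c.Halted)
    (hs : Ready n Γ Set.univ s) (h20 : s.var 20 = 0) :
    ∃ F : Config Unit → Config Unit → State Unit,
      Exec noSource [attempts A] s (2 * (t + (n + 1) * ((n + 1) * 44 + 6)) + 25)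
        ((run noSource A (graphInput Γ) t).bind fun c =>
          (run noSource A (graphInput Γ) t).map (F c)) ∧
      ∀ c ∈ (run noSource A (graphInput Γ) t).support,
        ∀ d ∈ (run noSource A (graphInput Γ) t).support,
          (F c d).var 0 = if EmbedsFirst n (adjArray Γ) (c.state.arr 1 0) ∨
            EmbedsFirst n (adjArray Γ) (d.state.arr 1 0) then 1 else 0 := by
  obtain ⟨F₁, hF₁, hready₁⟩ := exec_attempt (Set.mem_univ 0) hA hhalts hs
  have : Nonempty (Config Unit → State Unit) := ⟨F₁⟩
  choose! F₂ hF₂ hready₂ using fun c hc =>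
    exec_attempt (i := 1) (by simp) hA hhalts (hready₁ c hc).1
  refine ⟨fun c d => (F₂ c d).setVar 0 ((F₂ c d).var 20 + (F₂ c d).var 2), ?_, fun c hc d hd => ?_⟩
  · exact (hF₁.append_map fun c hc => ((hF₂ c hc).append_map fun d _ =>
      .basic fun _ => rfl).seq).seq.mono (by omega)
  · obtain ⟨hready, h⟩ := hready₂ c hc d hd
    rw [State.setVar_var, if_pos rfl, hready.constants.var_two, h, (hready₁ c hc).2, h20]
    split_ifs <;> simp_all

/-- Write the gadget with thirteen cones, on `var 4` vertices, for the verification and as the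
input of both copies. -/
def fillInputs : Prog :=
  .seq (fillGadgets 13 [2, 100, 101]) (block [.add 100 4 2, .add 101 4 2])

/-- Prepare the memory for the attempts, with a gadget on `(var 0) ^ 6` vertices. -/
def prepare : Prog := .seq (setPower 6) fillInputs

/-- Decide graph isomorphism by means of the program `A`, which generates automorphisms. -/
def isoProg (A : Prog) : Prog :=
  .seq (block [.const 1 1, .sub 5 0 1, .add 3 0 1])
    (.ite 5 (.seq prepare (attempts A)) (.const 0 1))

theorem drawFree_isoProg (hA : A.DrawFree) : (isoProg A).DrawFree := by
  simp [isoProg, prepare, fillInputs, attempts, attempt, Prog.DrawFree, block, setPower, mulAdd,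
    countdown, fillGadgets, fillGadget, fillCone, copyRow, verify, compareStep, hA.rename]

theorem le_pow_six (hn : 2 ≤ n) : 13 * (n + 1) ≤ n ^ 6 := by
  have h : 2 ^ 5 * n ≤ n ^ 5 * n := Nat.mul_le_mul_right n (Nat.pow_le_pow_left hn 5)
  rw [← pow_succ, show 5 + 1 = 6 from rfl] at h
  omega

/-- The gadget by which `isoProg` compares two graphs: one cone over the first graph and twelve
cones over the second one, on `n ^ 6` vertices. -/
abbrev isoGadget (hn : 2 ≤ n) (G₁ G₂ : SimpleGraph (Fin n)) : SimpleGraph (Fin (n ^ 6)) :=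
  gadget (le_pow_six hn) (pairFamily G₁ G₂)

theorem Ready.of_memory (hs : Constants n s) (hgraph : ∀ b ∈ [2, 100, 101], s.arr b = adjArray Γ)
    (harr : ∀ a > 101, s.arr a = 0) (hsize : ∀ x ∈ [100, 101], s.var x = N)
    (hvar : ∀ x > 101, s.var x = 0) (hsamples : s.samples = []) : Ready n Γ Set.univ s := by
  have hzero : ∀ i : Fin 2, copyPlace i 0 ∈ [100, 101] := by decide
  have hpos : ∀ (i : Fin 2) (x : ℕ), copyPlace i (x + 1) > 101 := fun i x => by
    simp only [copyPlace]
    omega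
  refine ⟨hs, hgraph 2 (by decide), hsamples, fun i _ x => ?_, fun i _ a => ?_⟩
  · cases x with
    | zero => exact hsize _ (hzero i)
    | succ x => exact hvar _ (hpos i x)
  · cases a with
    | zero => exact hgraph _ (List.mem_cons_of_mem 2 (hzero i))
    | succ a => exact harr _ (hpos i a)

theorem reaches_fillInputs (hn : 2 ≤ n) {G₁ G₂ : SimpleGraph (Fin n)} (hs : Constants n s)
    (h4 : s.var 4 = n ^ 6) (hvar : ∀ x ≥ 20, s.var x = 0)
    (harr : s.arr = (graphPairInput G₁ G₂).arr) (hsamples : s.samples = []) :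
    Reaches noSource s fillInputs (390 * n ^ 2 + 546 * n + 2800) fun s' =>
      Ready n (isoGadget hn G₁ G₂) Set.univ s' ∧ s'.var 20 = 0 := by
  refine ((reaches_fillGadgets (le_pow_six hn) (G₁ := G₁) (G₂ := G₂) (l := [2, 100, 101])
    (by decide) hs (by rw [harr]; rfl) (by rw [harr]; rfl)
    (by rw [harr]; simp [graphPairInput, State.init])).frame.seq (t' := 5)
    fun s₁ ⟨hgadget, hframe⟩ => ?_).mono
    (by simp only [List.length_cons, List.length_nil]; lia) fun _ h => h
  have hvar₁ : ∀ x, ¬ (7 ≤ x ∧ x < 16) → s₁.var x = s.var x := fun x hx =>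
    hframe.var x (mt mem_varsWritten_fillGadgets hx)
  have hs₁ : Constants n s₁ := hs.of_var_eq fun x hx => hvar₁ x (by omega)
  have hzero : ∀ x ≥ 20, s₁.var x = 0 := fun x hx => (hvar₁ x (by omega)).trans (hvar x hx)
  have harr₁ : ∀ a > 101, s₁.arr a = 0 := fun a ha => by
    rw [hframe.arr a fun hmem => ?_, harr]
    · simp [graphPairInput, State.init, show a ≠ 0 by omega, show a ≠ 1 by omega]
    · exact (by decide : ∀ b ∈ [2, 100, 101], ¬ b > 101) a (mem_arrsWritten_fillGadgets hmem) ha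
  have hsamples₁ : s₁.samples = [] := (hframe.samples (by
    simp [Prog.DrawFree, fillGadgets, fillGadget, fillCone, copyRow, mulAdd, countdown,
      block])).trans hsamples
  have h4₁ : s₁.var 4 = n ^ 6 := (hvar₁ 4 (by omega)).trans h4
  refine reaches_block ⟨.of_memory (hs₁.of_var_eq fun x hx => ?_) hgadget harr₁ ?_ (fun x hx => ?_)
    ?_, ?_⟩
  · simp [State.effect, show x ≠ 100 by omega, show x ≠ 101 by omega]
  · simp [State.effect, h4₁, hs₁.var_two]
  · simp [State.effect, show x ≠ 100 by omega, show x ≠ 101 by omega, hzero x (by omega)]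
  · simp [State.effect, hsamples₁]
  · simp [State.effect, hzero]

theorem reaches_prepare (hn : 2 ≤ n) {G₁ G₂ : SimpleGraph (Fin n)} (hs : Constants n s)
    (hvar : ∀ x ≥ 20, s.var x = 0) (harr : s.arr = (graphPairInput G₁ G₂).arr)
    (hsamples : s.samples = []) :
    Reaches noSource s prepare (390 * n ^ 2 + 570 * n + 2900) fun s' =>
      Ready n (isoGadget hn G₁ G₂) Set.univ s' ∧ s'.var 20 = 0 := by
  refine ((reaches_setPower 6 hs).frame.seq (t' := 390 * n ^ 2 + 546 * n + 2800)
    fun s₁ ⟨h4, hframe⟩ => ?_).mono (by lia) fun _ h => h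
  have harr₁ : s₁.arr = s.arr := funext fun a => hframe.arr a (by
    simp [setPower, countdown_arrsWritten, mulAdd, block, Prog.arrsWritten])
  have hsamples₁ : s₁.samples = s.samples := hframe.samples (by
    simp [setPower, mulAdd, countdown, block, Prog.DrawFree])
  refine reaches_fillInputs hn (hs.of_frame hframe (by decide)) h4 (fun x hx => ?_)
    (harr₁.trans harr) (hsamples₁.trans hsamples)
  have hwritten : ∀ y ∈ (setPower 6).varsWritten, y < 20 := by decide
  rw [hframe.var x fun hmem => (hwritten x hmem).not_ge hx, hvar x hx]

open Classical in
theorem exec_isoProg (hn : 2 ≤ n) {G₁ G₂ : SimpleGraph (Fin n)} (hA : A.DrawFree)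
    (hhalts : ∀ c ∈ (run noSource A (graphInput (isoGadget hn G₁ G₂)) t).support, c.Halted) :
    ∃ F : Config Unit → Config Unit → State Unit,
      Exec noSource [isoProg A] (graphPairInput G₁ G₂) (2 * t + 500 * (n + 2) ^ 2)
        ((run noSource A (graphInput (isoGadget hn G₁ G₂)) t).bind fun c =>
          (run noSource A (graphInput (isoGadget hn G₁ G₂)) t).map (F c)) ∧
      ∀ c ∈ (run noSource A (graphInput (isoGadget hn G₁ G₂)) t).support,
        ∀ d ∈ (run noSource A (graphInput (isoGadget hn G₁ G₂)) t).support,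
          (F c d).var 0 =
            if EmbedsFirst n (adjArray (isoGadget hn G₁ G₂)) (c.state.arr 1 0) ∨
              EmbedsFirst n (adjArray (isoGadget hn G₁ G₂)) (d.state.arr 1 0) then 1 else 0 := by
  obtain ⟨s₁, hs₁, hconst, h5, hvar, harr, hsamples⟩ : Reaches noSource (graphPairInput G₁ G₂)
      (block [.const 1 1, .sub 5 0 1, .add 3 0 1]) 7 fun s => Constants n s ∧ s.var 5 ≠ 0 ∧
        (∀ x ≥ 20, s.var x = 0) ∧ s.arr = (graphPairInput G₁ G₂).arr ∧ s.samples = [] := by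
    refine reaches_block ⟨⟨?_, ?_, ?_, ?_⟩, ?_, fun x hx => ?_, ?_, ?_⟩
    case refine_6 =>
      simp [State.effect, graphPairInput, State.init, show x ≠ 0 by omega, show x ≠ 1 by omega,
        show x ≠ 3 by omega, show x ≠ 5 by omega]
    case refine_5 =>
      exact Nat.sub_ne_zero_of_lt hn
    all_goals simp [State.effect, graphPairInput, State.init]
  obtain ⟨s₂, hs₂, hready, h20⟩ := reaches_prepare hn hconst hvar harr hsamples
  obtain ⟨F, hF, hval⟩ := exec_attempts hA hhalts hready h20
  have hmain := (hs₂.pure_append hF).seq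
  have hbranch := Exec.ite (x := 5) (q := .const 0 1) (by rwa [if_pos h5])
  exact ⟨F, (hs₁.pure_append hbranch).seq.mono (by lia), hval⟩

theorem reaches_isoProg_of_lt_two (hn : n < 2) (G₁ G₂ : SimpleGraph (Fin n)) (A : Prog) :
    Reaches noSource (graphPairInput G₁ G₂) (isoProg A) 10 fun s => s.var 0 = 1 := by
  have hblock : Reaches noSource (graphPairInput G₁ G₂)
      (block [.const 1 1, .sub 5 0 1, .add 3 0 1]) 7 fun s => s.var 5 = 0 := by
    exact reaches_block <| Nat.sub_eq_zero_of_le (Nat.le_of_lt_succ hn)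
  exact hblock.seq (t' := 2) fun s hs => .ite (fun h => absurd hs h) fun _ =>
    reaches_basic rfl (by simp [State.effect])

end IsoProg

/-! ### From automorphisms to isomorphisms -/

theorem one_sub_inv_le_prob_uniformAut_gadget {m n N : ℕ} [NeZero m] {hN : m * (n + 1) ≤ N}
    {F : Fin m → SimpleGraph (Fin n)} {H : SimpleGraph (Fin n)} (e : ∀ j, F j ≃g H) :
    1 - (m : ℝ)⁻¹ ≤ prob (uniformAut (gadget hN F))
      {σ | σ ∈ Aut (gadget hN F) ∧ n + 1 ≤ (σ (place hN (0, none)) : ℕ)} := by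
  classical
  rw [show uniformAut (gadget hN F) = uniformSubgroup (Aut (gadget hN F)) from rfl,
    uniformSubgroup_eq_map, prob_map]
  refine one_sub_le_prob_uniformOfFintype ?_
  have hcard := mul_card_aut_preserving_le (hN := hN) e
  rw [Nat.card_eq_fintype_card, Nat.card_eq_fintype_card, Fintype.card_subtype] at hcard
  rw [inv_mul_eq_div, le_div_iff₀' (Nat.cast_pos.2 (NeZero.pos m))]
  refine le_trans ?_ (Nat.cast_le.2 hcard)
  rw [Nat.cast_mul]
  gcongr with σ
  exact fun hσ => not_le.1 fun hle => hσ ⟨σ.2, hle⟩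

section IsoProg

variable {A : Prog} {t : ℕ → ℕ}

theorem exists_readPerm_eq_some {η : ℝ} (hA : GeneratesAut A t η) (hη : η < 1) {n : ℕ}
    (G : SimpleGraph (Fin n)) :
    ∃ c ∈ (run noSource A (graphInput G) (t n)).support,
      ∃ σ, readPerm n (c.state.arr 1 0) = some σ := by
  by_contra! hnone
  have hsome : prob ((uniformAut G).map some) {o | o ≠ none} = 1 := prob_eq_one (by
    rw [PMF.support_map]
    rintro _ ⟨σ, -, rfl⟩
    exact Option.some_ne_none σ)
  have hrun : prob ((run noSource A (graphInput G) (t n)).map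
      fun c => readPerm n (c.state.arr 1 0)) {o | o ≠ none}ᶜ = 1 := prob_eq_one (by
    rw [PMF.support_map]
    rintro _ ⟨c, hc, rfl⟩ hne
    obtain ⟨σ, hσ⟩ := Option.ne_none_iff_exists'.1 hne
    exact hnone c hc σ hσ)
  have hle := prob_le_add_tvDist ((run noSource A (graphInput G) (t n)).map
    fun c => readPerm n (c.state.arr 1 0)) ((uniformAut G).map some) {o | o ≠ none}
  rw [prob_compl] at hrun
  linarith [(hA.2 n G).2]

/-- Every step writes at most one entry, and a permutation has at most one entry `0`. -/
theorem le_time_of_generatesAut {η : ℝ} (hA : GeneratesAut A t η) (hη : η < 1) (n : ℕ) :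
    n ≤ t n + 1 := by
  obtain ⟨c, hc, σ, hσ⟩ := exists_readPerm_eq_some hA hη (⊥ : SimpleGraph (Fin n))
  obtain ⟨J, hJ, hunwritten⟩ := exists_finset_of_mem_support_runFrom 1 0 hc
  rcases n with - | n
  · exact Nat.zero_le _
  have hsub : Finset.range (n + 1) ⊆ insert (σ.symm 0 : ℕ) J := by
    intro v hv
    rw [Finset.mem_insert, or_iff_not_imp_right]
    intro hvJ
    have hzero : σ ⟨v, Finset.mem_range.1 hv⟩ = 0 := by
      by_contra hne
      refine hunwritten v hvJ ?_ rfl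
      rw [readPerm_eq_some hσ ⟨v, Finset.mem_range.1 hv⟩]
      exact fun h => hne (Fin.ext h)
    rw [← hzero, symm_apply_apply]
  have hcard := (Finset.card_le_card hsub).trans (Finset.card_insert_le _ _)
  rw [Finset.card_range] at hcard
  omega

theorem prob_embedsFirst_run (hA : GeneratesAut A t (1 / 2)) {n : ℕ} (hn : 2 ≤ n)
    {G₁ G₂ : SimpleGraph (Fin n)} (e : G₁ ≃g G₂) :
    11 / 26 ≤ prob (run noSource A (graphInput (isoGadget hn G₁ G₂)) (t (n ^ 6)))
      {c | EmbedsFirst n (adjArray (isoGadget hn G₁ G₂)) (c.state.arr 1 0)} := by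
  set Γ := isoGadget hn G₁ G₂
  let E : Set (Perm (Fin (n ^ 6))) :=
    {σ | σ ∈ Aut Γ ∧ n + 1 ≤ (σ (place (le_pow_six hn) (0, none)) : ℕ)}
  have huniform : 1 - (13 : ℝ)⁻¹ ≤ prob (uniformAut Γ) E :=
    one_sub_inv_le_prob_uniformAut_gadget (H := G₂) fun j => by
      rw [pairFamily]
      split_ifs
      exacts [e, .refl]
  have htv := prob_le_add_tvDist _ _ (some '' E) |>.trans (add_le_add_right (hA.2 (n ^ 6) Γ).2 _)
  rw [prob_map, prob_map, Set.preimage_image_eq _ (Option.some_injective _)] at htv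
  refine le_trans ?_ (prob_mono_support (E := (fun c => readPerm (n ^ 6) (c.state.arr 1 0)) ⁻¹'
    (some '' E)) ?_)
  · linarith
  · rintro c - ⟨σ, ⟨hmem, hmove⟩, hσ⟩
    exact embedsFirst_of_mem_aut hmem hmove (readPerm_eq_some hσ.symm)

theorem isoProg_time_le {n t C : ℕ} (hn : 2 ≤ n) (ht : n ^ 6 ≤ t + 1) (hC : 502 ≤ C) :
    2 * t + 500 * (n + 2) ^ 2 ≤ C * (t + 1) ^ C := by
  have hcube : n + 2 ≤ n ^ 3 := by
    calc n + 2 ≤ 2 ^ 2 * n := by omega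
      _ ≤ n ^ 2 * n := Nat.mul_le_mul_right n (Nat.pow_le_pow_left hn 2)
      _ = n ^ 3 := (pow_succ n 2).symm
  calc 2 * t + 500 * (n + 2) ^ 2 ≤ 2 * t + 500 * (n ^ 3) ^ 2 := by gcongr
    _ = 2 * t + 500 * n ^ 6 := by rw [← pow_mul]
    _ ≤ 502 * (t + 1) := by omega
    _ ≤ C * (t + 1) ^ C := Nat.mul_le_mul hC (Nat.le_self_pow (by omega) (t + 1))

theorem nonempty_iso_of_lt_two {n : ℕ} (hn : n < 2) (G₁ G₂ : SimpleGraph (Fin n)) :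
    Nonempty (G₁ ≃g G₂) := by
  have : Subsingleton (Fin n) := Fin.subsingleton_iff_le_one.2 (by omega)
  exact ⟨⟨Equiv.refl _, fun {a b} => by simp [Subsingleton.elim a b]⟩⟩

theorem EmbedsFirst.nonempty_iso {n : ℕ} {hn : 2 ≤ n} {G₁ G₂ : SimpleGraph (Fin n)}
    {r : ℕ → ℕ} (h : EmbedsFirst n (adjArray (isoGadget hn G₁ G₂)) r) :
    Nonempty (G₁ ≃g G₂) := by
  have : NeZero n := ⟨by omega⟩
  obtain ⟨j, hj, e⟩ := h.exists_iso
  rwa [pairFamily, pairFamily, if_pos rfl, if_neg hj] at e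

theorem decidesGraphIso_isoProg (hA : GeneratesAut A t (1 / 2)) {C : ℕ} (hC : 502 ≤ C) :
    DecidesGraphIso (isoProg A) fun n => C * (t (n ^ 6) + 1) ^ C := by
  refine ⟨drawFree_isoProg hA.1, fun n G₁ G₂ => ?_⟩
  rcases lt_or_ge n 2 with hn | hn
  · obtain ⟨s, hs, hs1⟩ := reaches_isoProg_of_lt_two hn G₁ G₂ A
    have hs' := hs.mono (t' := C * (t (n ^ 6) + 1) ^ C)
      (le_mul_of_le_of_one_le (by omega) (Nat.one_le_pow C _ (Nat.succ_pos _)))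
    simp only [hs'.run_eq, PMF.pure_map, PMF.support_pure, Set.mem_singleton_iff, forall_eq]
    refine ⟨rfl, fun _ => ?_, fun h => (h.false (nonempty_iso_of_lt_two hn G₁ G₂).some).elim⟩
    rw [prob_eq_one (by simpa using hs1)]
    norm_num
  obtain ⟨F, hF, hval⟩ := exec_isoProg hn hA.1 (hA.2 (n ^ 6) (isoGadget hn G₁ G₂)).1
  have hF' := hF.mono (isoProg_time_le hn (le_time_of_generatesAut hA (by norm_num) (n ^ 6)) hC)
  simp only [hF'.run_eq, prob_map]
  refine ⟨fun c hc => ?_, fun ⟨e⟩ => ?_, fun hempty => ?_⟩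
  · rw [PMF.support_map] at hc
    obtain ⟨s, -, rfl⟩ := hc
    rfl
  · let S : Set (Config Unit) :=
      {c | EmbedsFirst n (adjArray (isoGadget hn G₁ G₂)) (c.state.arr 1 0)}
    have hsuccess : 11 / 26 ≤ prob _ S := prob_embedsFirst_run hA hn e
    have hle := prob_le_one (run noSource A (graphInput (isoGadget hn G₁ G₂)) (t (n ^ 6))) S
    refine le_trans ?_ (one_sub_sq_le_prob_bind_map (A := S)
      fun c hc d hd h => (hval c hc d hd).trans (if_pos h))
    nlinarith
  · have hfail : ∀ r, ¬ EmbedsFirst n (adjArray (isoGadget hn G₁ G₂)) r :=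
      fun r hr => hempty.false hr.nonempty_iso.some
    rw [prob_eq_one]
    · norm_num
    intro s hs
    simp only [PMF.mem_support_bind_iff, PMF.mem_support_map_iff] at hs
    obtain ⟨c, hc, d, hd, rfl⟩ := hs
    exact (hval c hc d hd).trans (if_neg (not_or.2 ⟨hfail _, hfail _⟩))

end IsoProg

end InvGen

end

theorem mainTheorem12_general :
    (∃ (A : InvGen.Prog) (C : ℕ) (k T : ℕ → ℚ → ℕ),
      ∀ (n : ℕ) (H : Subgroup (Equiv.Perm (Fin n))) (ε δ : ℚ),
        0 < ε → ε ≤ 1 → 0 < δ → δ ≤ 1 →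
        (k n δ : ℝ) ≤ C * (n * Real.log n + Real.log (1 / δ) + 1) ∧
        ∃ t : ℕ, (t : ℝ) ≤ C * (n + Real.log (1 / ε) + Real.log (1 / δ) + 1) ^ C ∧
          (∀ c ∈ (InvGen.run ⟨InvGen.uniformSubgroup H, InvGen.oneLine⟩ A
              (InvGen.inverseInput n ε δ) t).support,
            c.Halted ∧ c.state.samples.length = k n δ ∧
            ∃ W : InvGen.CayleySampler n, InvGen.Describes c.state W ∧
              W.gens = c.state.samples ++ c.state.samples.map (fun g => g⁻¹) ∧
              W.steps = T n ε ∧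
              W.TimeAtMost (C * (n * Real.log n + Real.log (1 / ε) + 1))) ∧
          1 - (δ : ℝ) ≤
            InvGen.prob (InvGen.run ⟨InvGen.uniformSubgroup H, InvGen.oneLine⟩ A
                (InvGen.inverseInput n ε δ) t)
              {c | ∃ W : InvGen.CayleySampler n, InvGen.Describes c.state W ∧
                InvGen.tvDist W.law (InvGen.uniformSubgroup H) ≤ ε}) ∧
    (∃ c C : ℕ, 0 < c ∧
      ∀ (t : ℕ → ℕ) (A : InvGen.Prog), InvGen.GeneratesAut A t (1 / 2) →
        ∃ B : InvGen.Prog,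
          InvGen.DecidesGraphIso B (fun n => C * (t (n ^ c) + 1) ^ C)) := by
  refine ⟨⟨InvGen.learner, 10000, fun n δ => InvGen.numSamples n δ,
    fun n ε => InvGen.numSteps n ε, fun n H ε δ hε hε1 hδ hδ1 => ?_⟩,
    6, 502, by norm_num, fun t A hA => ⟨_, InvGen.decidesGraphIso_isoProg hA le_rfl⟩⟩
  have hεR : (0 : ℝ) < ε := Rat.cast_pos.2 hε
  have hδR : (0 : ℝ) < δ := Rat.cast_pos.2 hδ
  have hεR1 : (ε : ℝ) ≤ 1 := by exact_mod_cast hε1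
  have hδR1 : (δ : ℝ) ≤ 1 := by exact_mod_cast hδ1
  have hlogε := InvGen.log_one_div_nonneg hεR hεR1
  have hlogδ := InvGen.log_one_div_nonneg hδR hδR1
  have hn : (0 : ℝ) ≤ n := n.cast_nonneg
  have hnlog : 0 ≤ n * Real.log n := mul_nonneg hn (Real.log_natCast_nonneg n)
  rw [Nat.cast_ofNat]
  refine ⟨(InvGen.numSamples_le hδR hδR1).trans (by linarith), InvGen.learnerTime n ε δ,
    (InvGen.learnerTime_le hεR hεR1 hδR hδR1).trans ?_, fun c hc => ?_,
    InvGen.one_sub_le_prob_run_learner H hε hδ⟩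
  · gcongr
    exacts [by linarith, by norm_num]
  · obtain ⟨hhalted, hlength, hdescribes⟩ := InvGen.support_run_learner _ hε hδ c hc
    exact ⟨hhalted, hlength, _, hdescribes, rfl, rfl, fun z hz =>
      (InvGen.walkSampler_numSteps_timeAtMost hεR hεR1 _ z hz).trans (by linarith)⟩

/-- First part: one program learns, from uniform random automorphisms of an unknown graph, a
sampler for the automorphism group. Second part: forward generation is as hard as graph
isomorphism. -/
theorem mainTheorem12 :
    (∃ (A : InvGen.Prog) (C : ℕ) (k T : ℕ → ℚ → ℕ),
      ∀ (n : ℕ) (G : SimpleGraph (Fin n)) (ε δ : ℚ), 0 < ε → ε ≤ 1 → 0 < δ → δ ≤ 1 →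
        (k n δ : ℝ) ≤ C * (n * Real.log n + Real.log (1 / δ) + 1) ∧
        ∃ t : ℕ, (t : ℝ) ≤ C * (n + Real.log (1 / ε) + Real.log (1 / δ) + 1) ^ C ∧
          (∀ c ∈ (InvGen.run (InvGen.autSource G) A (InvGen.inverseInput n ε δ) t).support,
            c.Halted ∧ c.state.samples.length = k n δ ∧
            ∃ W : InvGen.CayleySampler n, InvGen.Describes c.state W ∧
              W.gens = c.state.samples ++ c.state.samples.map (fun g => g⁻¹) ∧
              W.steps = T n ε ∧
              W.TimeAtMost (C * (n * Real.log n + Real.log (1 / ε) + 1))) ∧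
          1 - (δ : ℝ) ≤
            InvGen.prob (InvGen.run (InvGen.autSource G) A (InvGen.inverseInput n ε δ) t)
              {c | ∃ W : InvGen.CayleySampler n, InvGen.Describes c.state W ∧
                InvGen.tvDist W.law (InvGen.uniformAut G) ≤ ε}) ∧
    (∃ c C : ℕ, 0 < c ∧
      ∀ (t : ℕ → ℕ) (A : InvGen.Prog), InvGen.GeneratesAut A t (1 / 2) →
        ∃ B : InvGen.Prog,
          InvGen.DecidesGraphIso B (fun n => C * (t (n ^ c) + 1) ^ C)) :=
  ⟨mainTheorem12_general.1.imp fun _ ⟨C, k, T, h⟩ => ⟨C, k, T, fun n G => h n (InvGen.Aut G)⟩,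
    mainTheorem12_general.2⟩
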